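/- Let $\mathbb K$ be a field of characteristic $0$. A *3-Lie algebra* is a vector space with an alternating trilinear bracket satisfying $$[x_1,x_2,[x_3,x_4,x_5]]=[[x_1,x_2,x_3],x_4,x_5]+[x_3,[x_1,x_2,x_4],x_5]+[x_3,x_4,[x_1,x_2,x_5]].$$ Let $(\mathfrak g,\pi=[\cdot,\cdot,\cdot]_{\mathfrak g})$ and $(\mathfrak h,\mu=[\cdot,\cdot,\cdot]_{\mathfrak h})$ be 3-Lie algebras over $\mathbb K$, and let $\rho:\wedge^2\mathfrak g\to\mathfrak{gl}(\mathfrak h)$ be an *action*, i.e. a linear map with $$\rho(x_1,x_2)\rho(x_3,x_4)=\rho([x_1,x_2,x_3]_{\mathfrak g},x_4)+\rho(x_3,[x_1,x_2,x_4]_{\mathfrak g})+\rho(x_3,x_4)\rho(x_1,x_2),$$ $$\rho(x_1,[x_2,x_3,x_4]_{\mathfrak g})=\rho(x_3,x_4)\rho(x_1,x_2)-\rho(x_2,x_4)\rho(x_1,x_3)+\rho(x_2,x_3)\rho(x_1,x_4),$$ $[\rho(x,y)u,v,w]_{\mathfrak h}=0$ and $\rho(x,y)[u,v,w]_{\mathfrak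 h}=0$. Let $H:\mathfrak g\to\mathfrak h$ be a *crossed homomorphism*, i.e. a linear map with $$H[x,y,z]_{\mathfrak g}=\rho(x,y)(Hz)+\rho(y,z)(Hx)+\rho(z,x)(Hy)+[Hx,Hy,Hz]_{\mathfrak h}.$$ For vector spaces $V,W$ and $n\ge 0$ let $C^n(V,W)=\mathrm{Hom}(\underbrace{\wedge^2V\otimes\cdots\otimes\wedge^2V}_{n}\wedge V,W)$, where the last factor $\wedge^2V$ and the final $V$ are wedged together to $\wedge^3V$ (so $C^0(V,W)=\mathrm{Hom}(V,W)$), and put $C^*(V,W)=\bigoplus_{n\ge0}C^n(V,W)$, graded by $n$. On $C^*(V,V)$ let $[P,Q]=P\circ Q-(-1)^{pq}Q\circ P$ for $P\in C^p(V,V)$, $Q\in C^q(V,V)$, where, for $\mathfrak X_i=x_i\wedge y_i$ and with $\mathbb S(a,b)$ the set of $(a,b)$-shuffles, $$\begin{aligned}(P\circ Q)(\mathfrak X_1,\dots,\mathfrak X_{p+q},x)=\ &\sum_{k=1}^{p}(-1)^{(k-1)q}\sum_{\sigma\in\mathbb S(k-1,q)}(-1)^\sigma P\big(\mathfrak X_{\sigma(1)},\dots,\mathfrak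 X_{\sigma(k-1)},\,Q_\sigma(x_{k+q})\wedge y_{k+q}+x_{k+q}\wedge Q_\sigma(y_{k+q}),\,\mathfrak X_{k+q+1},\dots,\mathfrak X_{p+q},x\big)\\&+\sum_{\sigma\in\mathbb S(p,q)}(-1)^{pq}(-1)^\sigma P\big(\mathfrak X_{\sigma(1)},\dots,\mathfrak X_{\sigma(p)},Q(\mathfrak X_{\sigma(p+1)},\dots,\mathfrak X_{\sigma(p+q)},x)\big),\end{aligned}$$ with $Q_\sigma(z)=Q(\mathfrak X_{\sigma(k)},\dots,\mathfrak X_{\sigma(k+q-1)},z)$. Let $\Delta=\pi+\rho+\mu\in C^1(\mathfrak g\oplus\mathfrak h,\mathfrak g\oplus\mathfrak h)$ be $$\Delta(x+u,y+v,z+w)=[x,y,z]_{\mathfrak g}+\rho(x,y)w+\rho(y,z)u+\rho(z,x)v+[u,v,w]_{\mathfrak h}.$$ Regard $C^*(\mathfrak g,\mathfrak h)$ as a subspace of $C^*(\mathfrak g\oplus\mathfrak h,\mathfrak g\oplus\mathfrak h)$ (extending by zero on $\mathfrak h$), let $\mathcal P$ be the projection onto it (restrict to $\mathfrak g$ and take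 the $\mathfrak h$-component), and for $k\ge1$ let $$l_k(a_1,\dots,a_k)=\mathcal P[\cdots[[\Delta,a_1],a_2],\cdots,a_k],\qquad a_1,\dots,a_k\in C^*(\mathfrak g,\mathfrak h).$$ An *$L_\infty$-algebra* is a $\mathbb Z$-graded vector space with multilinear maps $l_k$ ($k\ge1$) of degree $1$ such that, for homogeneous elements and with $\varepsilon(\sigma)$ the Koszul sign, $l_n(x_{\sigma(1)},\dots,x_{\sigma(n)})=\varepsilon(\sigma)l_n(x_1,\dots,x_n)$ for all $\sigma\in\mathbb S_n$, and $$\sum_{i=1}^n\sum_{\sigma\in\mathbb S(i,n-i)}\varepsilon(\sigma)\,l_{n-i+1}\big(l_i(x_{\sigma(1)},\dots,x_{\sigma(i)}),x_{\sigma(i+1)},\dots,x_{\sigma(n)}\big)=0\qquad(n\ge1).$$ A *Maurer–Cartan element* is a degree-$0$ element $\alpha$ with $\sum_{n\ge1}\frac1{n!}l_n(\alpha,\dots,\alpha)=0$ (a finite sum), and the *twisted brackets* are $l_k^\alpha(x_1,\dots,x_k)=\sum_{n\ge0}\frac1{n!}l_{n+k}(\underbrace{\alpha,\dots,\alpha}_n,x_1,\dots,x_k)$.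 **Proposition.** $(C^*(\mathfrak g,\mathfrak h),\{l_k\}_{k\ge1})$ is an $L_\infty$-algebra with $l_k=0$ for all $k\ne1,3$, the map $H\in C^0(\mathfrak g,\mathfrak h)$ is a Maurer–Cartan element of it, and the twisted brackets $\{l_k^H\}_{k\ge1}$ again form an $L_\infty$-algebra structure on $C^*(\mathfrak g,\mathfrak h)$. For all $P,Q,R\in C^*(\mathfrak g,\mathfrak h)$ they are given by $$l_1^H(P)=l_1(P)+\tfrac12\,l_3(H,H,P),\qquad l_2^H(P,Q)=l_3(H,P,Q),\qquad l_3^H(P,Q,R)=l_3(P,Q,R),\qquad l_k^H=0\ \ (k\ge4).$$ -/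

import Mathlib

namespace ThreeLie

section AltTwo
variable {K M N : Type*} [Field K] [AddCommGroup M] [Module K M] [AddCommGroup N] [Module K N]

theorem alt_add_left (f : M [⋀^Fin 2]→ₗ[K] N) (x y z : M) :
    f ![x + y, z] = f ![x, z] + f ![y, z] := f.toMultilinearMap.cons_add ![z] x y

theorem alt_smul_left (f : M [⋀^Fin 2]→ₗ[K] N) (t : K) (x z : M) :
    f ![t • x, z] = t • f ![x, z] := f.toMultilinearMap.cons_smul ![z] t x

theorem alt_swap (f : M [⋀^Fin 2]→ₗ[K] N) (x y : M) : f ![x, y] = - f ![y, x] := by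
  have := f.map_swap ![y, x] (i := 0) (j := 1) (by decide)
  rw [← this]; congr 1; ext k; fin_cases k <;> simp

theorem alt_self (f : M [⋀^Fin 2]→ₗ[K] N) (x : M) : f ![x, x] = 0 :=
  f.map_eq_zero_of_eq ![x, x] (i := 0) (j := 1) rfl (by decide)

theorem alt_add_right (f : M [⋀^Fin 2]→ₗ[K] N) (x y z : M) :
    f ![z, x + y] = f ![z, x] + f ![z, y] := by
  rw [alt_swap, alt_add_left, alt_swap f z x, alt_swap f z y]; abel

theorem alt_smul_right (f : M [⋀^Fin 2]→ₗ[K] N) (t : K) (x z : M) :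
    f ![z, t • x] = t • f ![z, x] := by
  rw [alt_swap, alt_smul_left, alt_swap f z x, smul_neg]

end AltTwo

section Algebra
variable {K g h : Type*} [Field K] [AddCommGroup g] [Module K g] [AddCommGroup h] [Module K h]

/-- The Fundamental Identity: the alternating trilinear map `π` is a 3-Lie bracket. -/
def IsThreeLieBracket (π : g [⋀^Fin 3]→ₗ[K] g) : Prop :=
  ∀ x₁ x₂ x₃ x₄ x₅ : g, π ![x₁, x₂, π ![x₃, x₄, x₅]] =
    π ![π ![x₁, x₂, x₃], x₄, x₅] + π ![x₃, π ![x₁, x₂, x₄], x₅] + π ![x₃, x₄, π ![x₁, x₂, x₅]]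

/-- A representation `ρ : ∧²g → gl(h)` of the 3-Lie algebra `(g, π)` on the vector space `h`. -/
structure IsRepresentation (π : g [⋀^Fin 3]→ₗ[K] g) (ρ : g [⋀^Fin 2]→ₗ[K] Module.End K h) :
    Prop where
  rho_mul_rho : ∀ x₁ x₂ x₃ x₄ : g, ρ ![x₁, x₂] * ρ ![x₃, x₄] =
    ρ ![π ![x₁, x₂, x₃], x₄] + ρ ![x₃, π ![x₁, x₂, x₄]] + ρ ![x₃, x₄] * ρ ![x₁, x₂]
  rho_bracket : ∀ x₁ x₂ x₃ x₄ : g, ρ ![x₁, π ![x₂, x₃, x₄]] =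
    ρ ![x₃, x₄] * ρ ![x₁, x₂] - ρ ![x₂, x₄] * ρ ![x₁, x₃] + ρ ![x₂, x₃] * ρ ![x₁, x₄]

/-- The center of the 3-Lie algebra `(h, μ)`. -/
def center (μ : h [⋀^Fin 3]→ₗ[K] h) : Set h := {u | ∀ v w : h, μ ![u, v, w] = 0}

/-- An action of the 3-Lie algebra `(g, π)` on the 3-Lie algebra `(h, μ)`. -/
structure IsAction (π : g [⋀^Fin 3]→ₗ[K] g) (μ : h [⋀^Fin 3]→ₗ[K] h)
    (ρ : g [⋀^Fin 2]→ₗ[K] Module.End K h) : Prop extends IsRepresentation π ρ where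
  rho_mem_center : ∀ (x y : g) (u : h), ρ ![x, y] u ∈ center μ
  rho_bracket_eq_zero : ∀ (x y : g) (u v w : h), ρ ![x, y] (μ ![u, v, w]) = 0

/-- `H` is a crossed homomorphism from `(g, π)` to `(h, μ)` with respect to the action `ρ`. -/
def IsCrossedHom (π : g [⋀^Fin 3]→ₗ[K] g) (μ : h [⋀^Fin 3]→ₗ[K] h)
    (ρ : g [⋀^Fin 2]→ₗ[K] Module.End K h) (H : g →ₗ[K] h) : Prop :=
  ∀ x y z : g, H (π ![x, y, z]) =
    ρ ![x, y] (H z) + ρ ![y, z] (H x) + ρ ![z, x] (H y) + μ ![H x, H y, H z]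

/-- The mixed part `(x + u, y + v, z + w) ↦ ρ(x, y) w + ρ(y, z) u + ρ(z, x) v`. -/
def mixedBracket (ρ : g [⋀^Fin 2]→ₗ[K] Module.End K h) : (g × h) [⋀^Fin 3]→ₗ[K] h :=
  { MultilinearMap.mk' (fun a : Fin 3 → g × h =>
      ρ ![(a 0).1, (a 1).1] (a 2).2 + ρ ![(a 1).1, (a 2).1] (a 0).2
        + ρ ![(a 2).1, (a 0).1] (a 1).2)
      (by
        intro a i b c
        fin_cases i <;> simp [alt_add_left, alt_add_right] <;> abel)
      (by
        intro a i b c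
        fin_cases i <;> simp [alt_smul_left, alt_smul_right]) with
    map_eq_zero_of_eq' := by
      intro a i j hij hne
      change ρ ![(a 0).1, (a 1).1] (a 2).2 + ρ ![(a 1).1, (a 2).1] (a 0).2
        + ρ ![(a 2).1, (a 0).1] (a 1).2 = 0
      have h3 : a 0 = a 1 ∨ a 1 = a 2 ∨ a 2 = a 0 := by
        fin_cases i <;> fin_cases j <;> simp_all
      rcases h3 with e | e | e
      · rw [e, alt_self, alt_swap ρ (a 2).1]; simp
      · rw [e, alt_self, alt_swap ρ (a 2).1]; simp
      · rw [e, alt_self, alt_swap ρ (a 1).1]; simp }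

/-- The semidirect product bracket `π + ρ + μ` on `g ⊕ h`, see `semidirectBracket_apply`. -/
def semidirectBracket (π : g [⋀^Fin 3]→ₗ[K] g) (μ : h [⋀^Fin 3]→ₗ[K] h)
    (ρ : g [⋀^Fin 2]→ₗ[K] Module.End K h) : (g × h) [⋀^Fin 3]→ₗ[K] (g × h) :=
  (LinearMap.inl K g h).compAlternatingMap (π.compLinearMap (LinearMap.fst K g h)) +
  (LinearMap.inr K g h).compAlternatingMap
    (mixedBracket ρ + μ.compLinearMap (LinearMap.snd K g h))

theorem semidirectBracket_apply (π : g [⋀^Fin 3]→ₗ[K] g) (μ : h [⋀^Fin 3]→ₗ[K] h)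
    (ρ : g [⋀^Fin 2]→ₗ[K] Module.End K h) (x y z : g) (u v w : h) :
    semidirectBracket π μ ρ ![(x, u), (y, v), (z, w)] =
      (π ![x, y, z], ρ ![x, y] w + ρ ![y, z] u + ρ ![z, x] v + μ ![u, v, w]) := by
  have e1 : (fun i => (![(x, u), (y, v), (z, w)] i).1) = ![x, y, z] := by
    ext i; fin_cases i <;> rfl
  have e2 : (fun i => (![(x, u), (y, v), (z, w)] i).2) = ![u, v, w] := by
    ext i; fin_cases i <;> rfl
  simp [semidirectBracket, mixedBracket, e1, e2]
end Algebra

section Cochain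
variable (K V W : Type*) [Field K] [AddCommGroup V] [Module K V] [AddCommGroup W] [Module K W]

/-- The decomposable element `x ∧ y` of `∧²V`. -/
def wedge {V : Type*} [AddCommGroup V] [Module K V] (x y : V) : ⋀[K]^2 V :=
  exteriorPower.ιMulti K 2 ![x, y]

/-- `Hom(∧²V ⊗ ⋯ ⊗ ∧²V ⊗ V, W)` with `n` factors `∧²V`, in curried form. -/
abbrev PreCochain (n : ℕ) : Type _ := MultilinearMap K (fun _ : Fin n => ⋀[K]^2 V) (V →ₗ[K] W)

/-- `Cⁿ(V, W) = Hom(∧²V ⊗ ⋯ ⊗ ∧²V ∧ V, W)` with `n` factors `∧²V`. The last `∧` means that the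
last factor `∧²V` and the final `V` are wedged to `∧³V`: the value at `(X₁, …, X_{n-1}, x ∧ y, z)`
is alternating in `x, y, z`. As it is alternating in `x, y` anyway, this amounts to its
vanishing for `z = y`. In particular `C⁰ = Hom(V, W)` and `C¹ = Hom(∧³V, W)`. -/
def Cochain (n : ℕ) : Submodule K (PreCochain K V W n) where
  carrier := {f | ∀ (X : Fin n → ⋀[K]^2 V) (i : Fin n) (x y : V), (i : ℕ) + 1 = n →
    X i = wedge K x y → f X y = 0}
  add_mem' := by
    intro f f' hf hf' X i x y hi hX
    simp [hf X i x y hi hX, hf' X i x y hi hX]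
  zero_mem' := by intro X i x y hi hX; simp
  smul_mem' := by
    intro c f hf X i x y hi hX
    simp [hf X i x y hi hX]

instance (n : ℕ) : AddCommGroup (Cochain K V W n) := inferInstance

instance (n : ℕ) : Module K (Cochain K V W n) := inferInstance

variable {K V W}

/-- The endomorphism `x ∧ y ↦ T x ∧ y + x ∧ T y` of `∧²V`, linear in `T`. -/
noncomputable def wedgeDer : (V →ₗ[K] V) →ₗ[K] (⋀[K]^2 V →ₗ[K] ⋀[K]^2 V) :=
  (exteriorPower.alternatingMapLinearEquiv (R := K) (n := 2)).toLinearMap ∘ₗ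
  { toFun := fun T =>
    { MultilinearMap.mk' (fun a : Fin 2 → V => wedge K (T (a 0)) (a 1) + wedge K (a 0) (T (a 1)))
        (by
          intro a i b c
          fin_cases i <;> simp [wedge, alt_add_left, alt_add_right] <;> abel)
        (by
          intro a i b c
          fin_cases i <;> simp [wedge, alt_smul_left, alt_smul_right]) with
      map_eq_zero_of_eq' := by
        intro a i j hij hne
        change wedge K (T (a 0)) (a 1) + wedge K (a 0) (T (a 1)) = 0
        have e : a 0 = a 1 := by
          fin_cases i <;> fin_cases j <;> simp_all
        rw [e, wedge, alt_swap, wedge, neg_add_cancel] }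
    map_add' := by
      intro S T
      ext a : 1
      change wedge K (S (a 0) + T (a 0)) (a 1) + wedge K (a 0) (S (a 1) + T (a 1)) =
        (wedge K (S (a 0)) (a 1) + wedge K (a 0) (S (a 1))) +
        (wedge K (T (a 0)) (a 1) + wedge K (a 0) (T (a 1)))
      simp only [wedge, alt_add_left, alt_add_right]; abel
    map_smul' := by
      intro t T
      ext a : 1
      change wedge K (t • T (a 0)) (a 1) + wedge K (a 0) (t • T (a 1)) =
        t • (wedge K (T (a 0)) (a 1) + wedge K (a 0) (T (a 1)))
      simp only [wedge, alt_smul_left, alt_smul_right, smul_add] }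

theorem wedgeDer_wedge (T : V →ₗ[K] V) (x y : V) :
    wedgeDer T (wedge K x y) = wedge K (T x) y + wedge K x (T y) := by
  simp [wedgeDer, wedge]


/-- The `(i, n - i)`-shuffles: `σ(1) < ⋯ < σ(i)` and `σ(i+1) < ⋯ < σ(n)`
(positions are numbered from `0` in the code). -/
def shuffles (i n : ℕ) : Finset (Equiv.Perm (Fin n)) :=
  Finset.univ.filter fun σ => ∀ a b : Fin n, a < b → ((b : ℕ) < i ∨ i ≤ (a : ℕ)) → σ a < σ b

/-- The list of arguments
`X_{σ(1)}, …, X_{σ(k)}, Q(X_{σ(k+1)}, …, X_{σ(k+q)}, x) ∧ y + x ∧ Q(X_{σ(k+1)}, …, X_{σ(k+q)}, y),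
X_{k+q+2}, …, X_{p+q}`, where `X_{k+q+1} = x ∧ y` and `k = 0, …, p - 1`. -/
noncomputable def insertArgs {p q : ℕ} (Q : PreCochain K V V q) (k : Fin p)
    (σ : Equiv.Perm (Fin (k + q))) (X : Fin (p + q) → ⋀[K]^2 V) (j : Fin p) : ⋀[K]^2 V :=
  if hj : (j : ℕ) < k then X (Fin.castLE (by omega) (σ ⟨j, by omega⟩))
  else if j = k then
    wedgeDer (Q fun i => X (Fin.castLE (by omega) (σ (Fin.natAdd k i)))) (X ⟨k + q, by omega⟩)
  else X ⟨j + q, by omega⟩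

theorem insertArgs_update {p q : ℕ} (Q : PreCochain K V V q) (k : Fin p)
    (σ : Equiv.Perm (Fin (k + q))) (X : Fin (p + q) → ⋀[K]^2 V) (m : Fin (p + q)) :
    ∃ (j : Fin p) (A : Fin p → ⋀[K]^2 V) (T : ⋀[K]^2 V →ₗ[K] ⋀[K]^2 V), ∀ v,
      insertArgs Q k σ (Function.update X m v) = Function.update A j (T v) := by
  by_cases hm : (m : ℕ) < k + q
  · obtain ⟨s, hs⟩ := σ.surjective ⟨m, hm⟩
    have key (t : Fin (k + q)) (h : (k : ℕ) + q ≤ p + q) (v) :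
        Function.update X m v (Fin.castLE h (σ t)) =
          if t = s then v else X (Fin.castLE h (σ t)) := by
      by_cases ht : t = s
      · subst ht; rw [if_pos rfl]
        have : Fin.castLE h (σ t) = m := by rw [hs]; rfl
        rw [this, Function.update_self]
      · rw [if_neg ht, Function.update_of_ne]
        intro hc
        apply ht
        apply σ.injective
        rw [hs]
        have := congrArg Fin.val hc
        exact Fin.ext (by simpa using this)
    by_cases hsk : (s : ℕ) < k
    · refine ⟨⟨s, by omega⟩, insertArgs Q k σ X, LinearMap.id, fun v => ?_⟩
      ext1 j
      by_cases hj : j = ⟨s, by omega⟩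
      · subst hj
        simp only [Function.update_self, insertArgs, dif_pos hsk, key, if_pos, LinearMap.id_apply]
      · rw [Function.update_of_ne hj]
        have hjs : (j : ℕ) ≠ s := fun h => hj (Fin.ext h)
        unfold insertArgs
        split_ifs with h1 h2
        · rw [key, if_neg (by rw [Fin.ext_iff]; exact hjs)]
        · have e1 : ∀ i : Fin q, ¬ (Fin.natAdd (k : ℕ) i = s) := by
            intro i hi
            have := congrArg Fin.val hi
            simp at this; omega
          simp only [key, e1, if_false]
          rw [Function.update_of_ne]
          intro hc; have := congrArg Fin.val hc; simp at this; omega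
        · rw [Function.update_of_ne]
          intro hc; have := congrArg Fin.val hc; simp at this
          have : (j : ℕ) ≠ k := fun h => h2 (Fin.ext h)
          omega
    · refine ⟨k, insertArgs Q k σ X,
        (wedgeDer.flip (X ⟨k + q, by omega⟩)) ∘ₗ Q.toLinearMap
          (fun i => X (Fin.castLE (by omega) (σ (Fin.natAdd k i)))) ⟨s - k, by omega⟩,
        fun v => ?_⟩
      ext1 j
      by_cases hj : j = k
      · subst hj
        have e2 : (fun i : Fin q => Function.update X m v (Fin.castLE (by omega)
            (σ (Fin.natAdd (j : ℕ) i)))) = Function.update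
            (fun i => X (Fin.castLE (by omega) (σ (Fin.natAdd j i)))) ⟨s - j, by omega⟩ v := by
          ext1 i
          rw [key]
          by_cases hi : i = ⟨s - j, by omega⟩
          · subst hi
            rw [if_pos (by apply Fin.ext; simp; omega), Function.update_self]
          · rw [Function.update_of_ne hi, if_neg]
            intro hc
            apply hi
            apply Fin.ext
            have := congrArg Fin.val hc
            simp at this ⊢; omega
        have e3 : (⟨j + q, by omega⟩ : Fin (p + q)) ≠ m := by
          intro hc; have := congrArg Fin.val hc; simp at this; omega
        simp only [Function.update_self, insertArgs, lt_irrefl, dif_neg, not_false_eq_true, if_pos,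
          LinearMap.comp_apply, LinearMap.flip_apply, MultilinearMap.toLinearMap_apply]
        rw [e2, Function.update_of_ne e3]
      · rw [Function.update_of_ne hj]
        have hjk : (j : ℕ) ≠ k := fun h => hj (Fin.ext h)
        unfold insertArgs
        split_ifs with h1
        · rw [key, if_neg (by rw [Fin.ext_iff]; simp; omega)]
        · rw [Function.update_of_ne]
          intro hc; have := congrArg Fin.val hc; simp at this; omega
  · have key (t : Fin (k + q)) (h : (k : ℕ) + q ≤ p + q) (v) :
        Function.update X m v (Fin.castLE h (σ t)) = X (Fin.castLE h (σ t)) := by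
      rw [Function.update_of_ne]
      intro hc; have := congrArg Fin.val hc; simp at this; omega
    by_cases hmk : (m : ℕ) = k + q
    · refine ⟨k, insertArgs Q k σ X,
        wedgeDer (Q fun i => X (Fin.castLE (by omega) (σ (Fin.natAdd k i)))), fun v => ?_⟩
      have e3 : (⟨k + q, by omega⟩ : Fin (p + q)) = m := Fin.ext hmk.symm
      ext1 j
      by_cases hj : j = k
      · subst hj
        simp only [Function.update_self, insertArgs, lt_irrefl, dif_neg, not_false_eq_true, if_pos,
          key]
        rw [e3, Function.update_self]
      · rw [Function.update_of_ne hj]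
        have hjk : (j : ℕ) ≠ k := fun h => hj (Fin.ext h)
        unfold insertArgs
        rw [if_neg hj, if_neg hj]
        simp only [key]
        rw [Function.update_of_ne]
        intro hc; have := congrArg Fin.val hc; simp at this; omega
    · refine ⟨⟨m - q, by omega⟩, insertArgs Q k σ X, LinearMap.id, fun v => ?_⟩
      ext1 j
      by_cases hj : j = ⟨m - q, by omega⟩
      · have h1 : (j : ℕ) = m - q := congrArg Fin.val hj
        rw [hj, Function.update_self, ← hj]
        have h2 : ¬ (j : ℕ) < k := by omega
        have h3 : j ≠ k := fun h => by subst h; omega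
        have e3 : (⟨j + q, by omega⟩ : Fin (p + q)) = m := Fin.ext (by simp; omega)
        rw [insertArgs, dif_neg h2, if_neg h3, e3, Function.update_self, LinearMap.id_apply]
      · rw [Function.update_of_ne hj]
        have hjk : (j : ℕ) ≠ m - q := fun h => hj (Fin.ext h)
        unfold insertArgs
        simp only [key]
        rw [Function.update_of_ne (a := (⟨k + q, by omega⟩ : Fin (p + q))),
          Function.update_of_ne (a := (⟨j + q, by omega⟩ : Fin (p + q)))]
        · intro hc; have := congrArg Fin.val hc; simp at this; omega
        · intro hc; have := congrArg Fin.val hc; simp at this; omega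

/-- `P` evaluated at `insertArgs`. -/
noncomputable def insertTerm {p q : ℕ} (P : PreCochain K V V p) (Q : PreCochain K V V q)
    (k : Fin p) (σ : Equiv.Perm (Fin (k + q))) : PreCochain K V V (p + q) :=
  MultilinearMap.mk' (fun X => P (insertArgs Q k σ X))
    (by
      intro X m v w
      obtain ⟨j, A, T, hT⟩ := insertArgs_update Q k σ X m
      simp only [hT, map_add, MultilinearMap.map_update_add])
    (by
      intro X m c v
      obtain ⟨j, A, T, hT⟩ := insertArgs_update Q k σ X m
      simp only [hT, map_smul, MultilinearMap.map_update_smul])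

theorem outer_update_left {M : Type*} {p q : ℕ} (σ : Equiv.Perm (Fin (p + q)))
    (X : Fin (p + q) → M) (j : Fin p) (v : M) :
    (fun t => Function.update X (σ (Fin.castAdd q j)) v (σ (Fin.castAdd q t))) =
      Function.update (fun t => X (σ (Fin.castAdd q t))) j v := by
  ext1 t
  by_cases ht : t = j
  · subst ht; simp
  · rw [Function.update_of_ne ht, Function.update_of_ne]
    intro hc; exact ht (Fin.castAdd_injective _ _ (σ.injective hc))

theorem outer_update_left' {M : Type*} {p q : ℕ} (σ : Equiv.Perm (Fin (p + q)))
    (X : Fin (p + q) → M) (j : Fin p) (v : M) :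
    (fun t => Function.update X (σ (Fin.castAdd q j)) v (σ (Fin.natAdd p t))) =
      (fun t => X (σ (Fin.natAdd p t))) := by
  ext1 t
  rw [Function.update_of_ne]
  intro hc
  have := congrArg Fin.val (σ.injective hc)
  simp at this; omega

theorem outer_update_right {M : Type*} {p q : ℕ} (σ : Equiv.Perm (Fin (p + q)))
    (X : Fin (p + q) → M) (j : Fin q) (v : M) :
    (fun t => Function.update X (σ (Fin.natAdd p j)) v (σ (Fin.natAdd p t))) =
      Function.update (fun t => X (σ (Fin.natAdd p t))) j v := by
  ext1 t
  by_cases ht : t = j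
  · subst ht; simp
  · rw [Function.update_of_ne ht, Function.update_of_ne]
    intro hc; exact ht (Fin.natAdd_injective _ _ (σ.injective hc))

theorem outer_update_right' {M : Type*} {p q : ℕ} (σ : Equiv.Perm (Fin (p + q)))
    (X : Fin (p + q) → M) (j : Fin q) (v : M) :
    (fun t => Function.update X (σ (Fin.natAdd p j)) v (σ (Fin.castAdd q t))) =
      (fun t => X (σ (Fin.castAdd q t))) := by
  ext1 t
  rw [Function.update_of_ne]
  intro hc
  have := congrArg Fin.val (σ.injective hc)
  simp at this; omega

/-- `P(X_{σ(1)}, …, X_{σ(p)}, Q(X_{σ(p+1)}, …, X_{σ(p+q)}, x))`. -/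
noncomputable def outerTerm {p q : ℕ} (P : PreCochain K V V p) (Q : PreCochain K V V q)
    (σ : Equiv.Perm (Fin (p + q))) : PreCochain K V V (p + q) :=
  MultilinearMap.mk' (fun X => (P fun j => X (σ (Fin.castAdd q j))) ∘ₗ
      (Q fun i => X (σ (Fin.natAdd p i))))
    (by
      intro X m v w
      obtain ⟨s, rfl⟩ := σ.surjective m
      refine Fin.addCases (fun j => ?_) (fun i => ?_) s
      · simp only [outer_update_left, outer_update_left', MultilinearMap.map_update_add,
          LinearMap.add_comp]
      · simp only [outer_update_right, outer_update_right', MultilinearMap.map_update_add,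
          LinearMap.comp_add])
    (by
      intro X m c v
      obtain ⟨s, rfl⟩ := σ.surjective m
      refine Fin.addCases (fun j => ?_) (fun i => ?_) s
      · simp only [outer_update_left, outer_update_left', MultilinearMap.map_update_smul,
          LinearMap.smul_comp]
      · simp only [outer_update_right, outer_update_right', MultilinearMap.map_update_smul,
          LinearMap.comp_smul])

/-- The circle product `P ∘ Q`; here `k` runs through `0, …, p - 1`, so it is the usual summation
index minus one. -/
noncomputable def circ {p q : ℕ} (P : PreCochain K V V p) (Q : PreCochain K V V q) :
    PreCochain K V V (p + q) :=
  (∑ k : Fin p, ∑ σ ∈ shuffles k (k + q),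
    ((-1 : K) ^ ((k : ℕ) * q) * ((Equiv.Perm.sign σ : ℤ) : K)) • insertTerm P Q k σ) +
  ∑ σ ∈ shuffles p (p + q),
    ((-1 : K) ^ (p * q) * ((Equiv.Perm.sign σ : ℤ) : K)) • outerTerm P Q σ

theorem insertArgs_eq_update {p q : ℕ} (Q Q' : PreCochain K V V q) (k : Fin p)
    (σ : Equiv.Perm (Fin (k + q))) (X : Fin (p + q) → ⋀[K]^2 V) :
    insertArgs Q k σ X = Function.update (insertArgs Q' k σ X) k
      (wedgeDer (Q fun i => X (Fin.castLE (by omega) (σ (Fin.natAdd k i))))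
        (X ⟨k + q, by omega⟩)) := by
  ext1 j
  by_cases hj : j = k
  · subst hj; simp [insertArgs]
  · rw [Function.update_of_ne hj]; simp [insertArgs, hj]

theorem insertTerm_add_right {p q : ℕ} (P : PreCochain K V V p) (Q Q' : PreCochain K V V q)
    (k : Fin p) (σ : Equiv.Perm (Fin (k + q))) :
    insertTerm P (Q + Q') k σ = insertTerm P Q k σ + insertTerm P Q' k σ := by
  ext1 X
  change P (insertArgs _ k σ X) = P (insertArgs _ k σ X) + P (insertArgs _ k σ X)
  rw [insertArgs_eq_update (Q + Q') 0, insertArgs_eq_update Q 0, insertArgs_eq_update Q' 0]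
  simp

theorem insertTerm_smul_right {p q : ℕ} (P : PreCochain K V V p) (c : K) (Q : PreCochain K V V q)
    (k : Fin p) (σ : Equiv.Perm (Fin (k + q))) :
    insertTerm P (c • Q) k σ = c • insertTerm P Q k σ := by
  ext1 X
  change P (insertArgs _ k σ X) = c • P (insertArgs _ k σ X)
  rw [insertArgs_eq_update (c • Q) 0, insertArgs_eq_update Q 0]
  simp

/-- The circle product as a bilinear map. -/
noncomputable def circLinear (p q : ℕ) :
    PreCochain K V V p →ₗ[K] PreCochain K V V q →ₗ[K] PreCochain K V V (p + q) :=
  LinearMap.mk₂ K circ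
    (by
      intro P P' Q
      have e1 (k σ) : insertTerm (P + P') Q k σ = insertTerm P Q k σ + insertTerm P' Q k σ := rfl
      have e2 (σ) : outerTerm (P + P') Q σ = outerTerm P Q σ + outerTerm P' Q σ := rfl
      simp only [circ, e1, e2, smul_add, Finset.sum_add_distrib]; abel)
    (by
      intro c P Q
      have e1 (k σ) : insertTerm (c • P) Q k σ = c • insertTerm P Q k σ := rfl
      have e2 (σ) : outerTerm (c • P) Q σ = c • outerTerm P Q σ := rfl
      simp only [circ, e1, e2, smul_add, Finset.smul_sum, smul_comm c])
    (by
      intro P Q Q'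
      have e2 (σ) : outerTerm P (Q + Q') σ = outerTerm P Q σ + outerTerm P Q' σ := by
        ext1 X; exact LinearMap.comp_add _ _ _
      simp only [circ, insertTerm_add_right, e2, smul_add, Finset.sum_add_distrib]; abel)
    (by
      intro c P Q
      have e2 (σ) : outerTerm P (c • Q) σ = c • outerTerm P Q σ := by
        ext1 X; exact LinearMap.comp_smul _ _ _
      simp only [circ, insertTerm_smul_right, e2, smul_add, Finset.smul_sum, smul_comm c])


theorem exists_shuffle_ext (n k m : ℕ) (hk : k ≤ n) (hm : m = n + 1) :
    ∃ e : Equiv.Perm (Fin n) → Equiv.Perm (Fin m),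
      (∀ τ (j : ℕ) (hj : j < k), (e τ ⟨j, by omega⟩ : ℕ) = τ ⟨j, by omega⟩) ∧
      (∀ τ, (e τ ⟨k, by omega⟩ : ℕ) = n) ∧
      (∀ τ (j : ℕ) (_ : k ≤ j) (hn : j < n), (e τ ⟨j + 1, by omega⟩ : ℕ) = τ ⟨j, hn⟩) ∧
      (∀ τ, Equiv.Perm.sign (e τ) = (-1) ^ (n - k) * Equiv.Perm.sign τ) ∧
      (∀ (M : Type _) [AddCommMonoid M] (F : Equiv.Perm (Fin m) → M),
        ∑ σ ∈ (shuffles (k + 1) m).filter (fun σ => (σ ⟨k, by omega⟩ : ℕ) = n), F σ =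
          ∑ τ ∈ shuffles k n, F (e τ)) := by
  subst hm
  set k' : Fin (n + 1) := ⟨k, by omega⟩ with hk'
  let e₁ : Fin (n + 1) ≃ Option (Fin n) := finSuccEquiv' k'
  let e₂ : Fin (n + 1) ≃ Option (Fin n) := finSuccEquiv' (Fin.last n)
  let e : Equiv.Perm (Fin n) → Equiv.Perm (Fin (n + 1)) := fun τ =>
    (e₁.trans (Equiv.optionCongr τ)).trans e₂.symm
  have ek (τ) : e τ k' = Fin.last n := by simp [e, e₁, e₂]
  have es (τ) (j : Fin n) : e τ (k'.succAbove j) = (τ j).castSucc := by simp [e, e₁, e₂]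
  have hlt (j : Fin n) (hj : (j : ℕ) < k) : k'.succAbove j = j.castSucc :=
    Fin.succAbove_of_castSucc_lt _ _ (by simpa [Fin.lt_def, hk'] using hj)
  have hge (j : Fin n) (hj : k ≤ (j : ℕ)) : k'.succAbove j = j.succ :=
    Fin.succAbove_of_le_castSucc _ _ (by simpa [Fin.le_def, hk'] using hj)
  have hmem (τ) : e τ ∈ shuffles (k + 1) (n + 1) ↔ τ ∈ shuffles k n := by
    simp only [shuffles, Finset.mem_filter, Finset.mem_univ, true_and]
    constructor
    · intro h a b hab hc
      have := h (k'.succAbove a) (k'.succAbove b) ((Fin.strictMono_succAbove k') hab) (by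
        rcases hc with hc | hc
        · left; rw [hlt b hc]; simp; omega
        · right; rw [hge a hc]; simp; omega)
      rwa [es, es, Fin.castSucc_lt_castSucc_iff] at this
    · intro h a b hab hc
      rcases Fin.eq_self_or_eq_succAbove k' a with rfl | ⟨a, rfl⟩
      · have : (k' : ℕ) < b := hab
        simp [hk'] at this hc; omega
      rcases Fin.eq_self_or_eq_succAbove k' b with rfl | ⟨b, rfl⟩
      · rw [ek, es]; exact Fin.castSucc_lt_last _
      rw [es, es, Fin.castSucc_lt_castSucc_iff]
      apply h a b ((Fin.strictMono_succAbove k').lt_iff_lt.1 hab)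
      rcases hc with hc | hc
      · left
        by_contra hb
        rw [hge b (by omega)] at hc; simp at hc; omega
      · right
        by_contra hb
        rw [hlt a (by omega)] at hc; simp at hc; omega
  refine ⟨e, ?_, ?_, ?_, ?_, ?_⟩
  · intro τ j hj
    have := es τ ⟨j, by omega⟩
    rw [hlt _ hj] at this
    exact congrArg Fin.val this
  · intro τ; exact congrArg Fin.val (ek τ)
  · intro τ j hj hn
    have := es τ ⟨j, by omega⟩
    rw [hge _ hj] at this
    exact congrArg Fin.val this
  · intro τ
    have h1 : e τ = e₂.symm.permCongr (Equiv.optionCongr τ) * (e₁.trans e₂.symm) := by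
      ext x; simp [e]
    have h2 : Fin.cycleIcc k' (Fin.last n) * (e₁.trans e₂.symm) = 1 := by
      ext x
      rcases Fin.eq_self_or_eq_succAbove k' x with rfl | ⟨x, rfl⟩
      · simp [e₁, e₂, Fin.cycleIcc_of_last (Fin.le_last _), -Fin.cycleIcc_def_le]
      · have := congrFun (Fin.cycleIcc_comp_succAbove k' (Fin.last n) (Fin.le_last _)) x
        simp only [Function.comp_apply, Fin.succAbove_last] at this
        simp [e₁, e₂, this, -Fin.cycleIcc_def_le]
    have h3 := congrArg Equiv.Perm.sign h2
    rw [Equiv.Perm.sign_mul, Fin.sign_cycleIcc_of_le (Fin.le_last _), Equiv.Perm.sign_one] at h3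
    have h4 : Equiv.Perm.sign (e₁.trans e₂.symm) = (-1) ^ (n - k) := by
      have h5 : ((-1 : ℤˣ) ^ (n - k)) * (-1) ^ (n - k) = 1 := by
        rw [← mul_pow]; simp
      have : ((Fin.last n : ℕ) - (k' : ℕ)) = n - k := rfl
      rw [this] at h3
      exact mul_left_cancel (h3.trans h5.symm)
    rw [h1, Equiv.Perm.sign_mul, h4, Equiv.Perm.sign_permCongr, Equiv.optionCongr_sign, mul_comm]
  · intro M _ F
    symm
    refine Finset.sum_bij (fun τ _ => e τ) ?_ ?_ ?_ ?_
    · intro τ hτ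
      rw [Finset.mem_filter]
      exact ⟨(hmem τ).2 hτ, congrArg Fin.val (ek τ)⟩
    · intro τ _ τ' _ h
      ext j
      have := congrArg (fun f => f (k'.succAbove j)) h
      simp only [es] at this
      exact congrArg Fin.val (Fin.castSucc_injective _ this)
    · intro σ hσ
      rw [Finset.mem_filter] at hσ
      let f : Equiv.Perm (Option (Fin n)) := (e₁.symm.trans σ).trans e₂
      have hf : f none = none := by
        have : σ k' = Fin.last n := Fin.ext hσ.2
        simp [f, e₁, e₂, this]
      have h1 : Equiv.optionCongr (Equiv.removeNone f) = f := by
        rw [map_equiv_removeNone, hf, Equiv.swap_self]; rfl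
      have h2 : e (Equiv.removeNone f) = σ := by
        simp only [e, h1]; ext x; simp [f]
      exact ⟨Equiv.removeNone f, (hmem _).1 (h2 ▸ hσ.1), h2⟩
    · intro τ _; rfl


theorem Cochain.swap_last {p : ℕ} {P : PreCochain K V W p} (hP : P ∈ Cochain K V W p)
    (A : Fin p → ⋀[K]^2 V) (j : Fin p) (hj : (j : ℕ) + 1 = p) (x y z : V) :
    P (Function.update A j (wedge K x z)) y = - P (Function.update A j (wedge K x y)) z := by
  have h (u v : V) : P (Function.update A j (wedge K u v)) v = 0 :=
    hP _ j u v hj (Function.update_self ..)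
  have h1 := h x (y + z)
  have e : wedge K x (y + z) = wedge K x y + wedge K x z := alt_add_right _ _ _ _
  rw [e, P.map_update_add, map_add, LinearMap.add_apply, LinearMap.add_apply, h x y, h x z] at h1
  rw [zero_add, add_zero] at h1
  exact eq_neg_of_add_eq_zero_left h1

theorem outerTerm_eq_zero {p q : ℕ} (P : PreCochain K V V p) {Q : PreCochain K V V q}
    (hQ : Q ∈ Cochain K V V q) (σ : Equiv.Perm (Fin (p + q))) (hσ : σ ∈ shuffles p (p + q))
    (X : Fin (p + q) → ⋀[K]^2 V) (i : Fin (p + q)) (x y : V) (hi : (i : ℕ) + 1 = p + q)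
    (hX : X i = wedge K x y) (hne : ∀ j : Fin p, (j : ℕ) + 1 = p → σ (Fin.castAdd q j) ≠ i) :
    outerTerm P Q σ X y = 0 := by
  simp only [shuffles, Finset.mem_filter, Finset.mem_univ, true_and] at hσ
  obtain ⟨s, hs⟩ := σ.surjective i
  have hmax (t : Fin (p + q)) : ¬ σ s < σ t := by
    rw [hs]; intro h; have := Fin.lt_def.1 h; omega
  have hsp : p ≤ (s : ℕ) := by
    by_contra hsp
    by_cases h1 : (s : ℕ) + 1 = p
    · exact hne ⟨s, by omega⟩ h1 hs
    · exact hmax ⟨s + 1, by omega⟩ (hσ _ _ (by simp [Fin.lt_def]) (by left; simp; omega))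
  have hsq : (s : ℕ) + 1 = p + q := by
    by_contra h1
    exact hmax ⟨s + 1, by omega⟩ (hσ _ _ (by simp [Fin.lt_def]) (by right; exact hsp))
  change (P _) ((Q fun i => X (σ (Fin.natAdd p i))) y) = 0
  have : (Q fun i => X (σ (Fin.natAdd p i))) y = 0 := by
    refine hQ _ ⟨s - p, by omega⟩ x y (by simp; omega) ?_
    have e : Fin.natAdd p (⟨s - p, by omega⟩ : Fin q) = s := Fin.ext (by simp; omega)
    simp only [e, hs, hX]
  rw [this, map_zero]

theorem circ_mem {p q : ℕ} {P : PreCochain K V V p} {Q : PreCochain K V V q}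
    (hP : P ∈ Cochain K V V p) (hQ : Q ∈ Cochain K V V q) : circ P Q ∈ Cochain K V V (p + q) := by
  intro X i x y hi hX
  rcases p with _ | p
  · simp only [circ, Finset.univ_eq_empty, Finset.sum_empty, zero_add, sum_apply,
      LinearMap.sum_apply, smul_apply, LinearMap.smul_apply]
    refine Finset.sum_eq_zero fun σ hσ => ?_
    rw [outerTerm_eq_zero P hQ σ hσ X i x y hi hX (fun j => j.elim0), smul_zero]
  obtain ⟨e, he1, he2, he3, hsgn, hsum⟩ :=
    exists_shuffle_ext (p + q) p (p + 1 + q) (by omega) (by omega)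
  have hi' : (i : ℕ) = p + q := by omega
  simp only [circ, add_apply, LinearMap.add_apply, sum_apply,
      LinearMap.sum_apply, smul_apply, LinearMap.smul_apply]
  rw [Fin.sum_univ_castSucc, Finset.sum_eq_zero, zero_add]
  · -- the two families of terms in which the last pair and the last vector meet cancel
    have hout : ∑ σ ∈ shuffles (p + 1) (p + 1 + q),
        ((-1 : K) ^ ((p + 1) * q) * ((Equiv.Perm.sign σ : ℤ) : K)) • outerTerm P Q σ X y =
        ∑ τ ∈ shuffles p (p + q), ((-1 : K) ^ ((p + 1) * q) * ((Equiv.Perm.sign (e τ) : ℤ) : K)) •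
          outerTerm P Q (e τ) X y := by
      rw [← hsum V (fun σ => ((-1 : K) ^ ((p + 1) * q) * ((Equiv.Perm.sign σ : ℤ) : K)) •
        outerTerm P Q σ X y)]
      refine (Finset.sum_filter_of_ne fun σ hσ hne => ?_).symm
      by_contra hc
      apply hne
      rw [outerTerm_eq_zero P hQ σ hσ X i x y hi hX, smul_zero]
      intro j hj hji
      apply hc
      have : (⟨p, by omega⟩ : Fin (p + 1 + q)) = Fin.castAdd q j := Fin.ext (by simp; omega)
      rw [this, hji, hi']
    rw [hout]
    refine (Finset.sum_add_distrib (s := shuffles p (p + q))).symm.trans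
      (Finset.sum_eq_zero fun τ hτ => ?_)
    have hins : insertTerm P Q (Fin.last p) τ X y = - outerTerm P Q (e τ) X y := by
      change P (insertArgs Q (Fin.last p) τ X) y =
        - P (fun j => X (e τ (Fin.castAdd q j))) ((Q fun i => X (e τ (Fin.natAdd (p + 1) i))) y)
      have hlast : (⟨(Fin.last p : ℕ) + q, by simp⟩ : Fin (p + 1 + q)) = i :=
        Fin.ext hi'.symm
      have hQe : (fun i : Fin q => X (e τ (Fin.natAdd (p + 1) i))) =
          fun i => X (Fin.castLE (by simp) (τ (Fin.natAdd ((Fin.last p : Fin (p + 1)) : ℕ) i))) := by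
        ext1 t
        congr 1
        apply Fin.ext
        have := he3 τ (p + t) (by omega) (by omega)
        have e4 : Fin.natAdd (p + 1) t = (⟨p + t + 1, by omega⟩ : Fin (p + 1 + q)) :=
          Fin.ext (by simp; omega)
        rw [e4, this]; rfl
      have hPe : (fun j => X (e τ (Fin.castAdd q j))) = Function.update
          (insertArgs Q (Fin.last p) τ X) (Fin.last p) (wedge K x y) := by
        ext1 j
        by_cases hj : j = Fin.last p
        · subst hj
          rw [Function.update_self, ← hX]
          congr 1
          apply Fin.ext
          rw [hi']; exact he2 τ
        · rw [Function.update_of_ne hj]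
          have hj' : (j : ℕ) < (Fin.last p : Fin (p + 1)) := Fin.lt_last_iff_ne_last.2 hj
          rw [insertArgs, dif_pos hj']
          congr 1
          apply Fin.ext
          exact he1 τ j hj'
      rw [hPe, hQe, insertArgs_eq_update Q Q, hlast, hX, wedgeDer_wedge, P.map_update_add,
        LinearMap.add_apply]
      rw [hP _ (Fin.last p) _ y (by simp) (Function.update_self ..), zero_add]
      rw [Function.update_idem]
      exact Cochain.swap_last hP _ (Fin.last p) (by simp) _ _ _
    rw [hins, hsgn, smul_neg, neg_add_eq_zero]
    congr 1
    have e5 : p + q - p = q := by omega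
    have e6 : ((Fin.last p : Fin (p + 1)) : ℕ) = p := rfl
    rw [e5]
    push_cast
    have e7 : ((-1 : K) ^ q) * (-1) ^ q = 1 := by rw [← mul_pow]; simp
    rw [add_mul, one_mul, pow_add, mul_assoc, ← mul_assoc ((-1 : K) ^ q), e7, one_mul]
  · intro k _
    refine Finset.sum_eq_zero fun σ hσ => ?_
    have : insertTerm P Q k.castSucc σ X y = 0 := by
      change P (insertArgs Q k.castSucc σ X) y = 0
      refine hP _ (Fin.last p) x y (by simp) ?_
      have h1 : ¬ ((Fin.last p : Fin (p + 1)) : ℕ) < k.castSucc := by simp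
      have h2 : Fin.last p ≠ k.castSucc := (Fin.castSucc_lt_last k).ne'
      rw [insertArgs, dif_neg h1, if_neg h2, ← hX]
      congr 1
      exact Fin.ext hi'.symm
    rw [this, smul_zero]

/-- The circle product `Cᵖ(V, V) × C^q(V, V) → C^{p+q}(V, V)`. -/
noncomputable def circC (p q : ℕ) :
    Cochain K V V p →ₗ[K] Cochain K V V q →ₗ[K] Cochain K V V (p + q) :=
  LinearMap.mk₂ K (fun P Q => ⟨circLinear p q P.1 Q.1, circ_mem P.2 Q.2⟩)
    (fun P P' Q => Subtype.ext (by simp))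
    (fun c P Q => Subtype.ext (by simp))
    (fun P Q Q' => Subtype.ext (by simp))
    (fun c P Q => Subtype.ext (by simp))

variable (K V W) in
/-- `C*(V, W) = ⊕_{n ≥ 0} Cⁿ(V, W)`. -/
abbrev TotalCochain : Type _ := DirectSum ℕ fun n => Cochain K V W n

noncomputable instance : AddCommGroup (TotalCochain K V W) := inferInstance

noncomputable instance : Module K (TotalCochain K V W) := inferInstance

/-- The graded commutator bracket `[P, Q] = P ∘ Q - (-1)^{pq} Q ∘ P` on `C*(V, V)`,
for `P` of degree `p` and `Q` of degree `q`, extended bilinearly. -/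
noncomputable def nrBracket :
    TotalCochain K V V →ₗ[K] TotalCochain K V V →ₗ[K] TotalCochain K V V :=
  DirectSum.toModule K ℕ _ fun p => LinearMap.flip <| DirectSum.toModule K ℕ _ fun q =>
    LinearMap.flip <|
      (circC p q).compr₂ (DirectSum.lof K ℕ (fun n => Cochain K V V n) (p + q)) -
      ((-1 : K) ^ (p * q)) •
        ((circC q p).compr₂ (DirectSum.lof K ℕ (fun n => Cochain K V V n) (q + p))).flip

theorem nrBracket_lof (p q : ℕ) (P : Cochain K V V p) (Q : Cochain K V V q) :
    nrBracket (DirectSum.lof K ℕ (fun n => Cochain K V V n) p P)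
      (DirectSum.lof K ℕ (fun n => Cochain K V V n) q Q) =
    DirectSum.lof K ℕ (fun n => Cochain K V V n) (p + q) (circC p q P Q) -
      ((-1 : K) ^ (p * q)) •
        DirectSum.lof K ℕ (fun n => Cochain K V V n) (q + p) (circC q p Q P) := by
  simp [nrBracket]

/-- Pull back along `f : V' → V` and push forward along `u : W → W'`:
`P ↦ u ∘ P ∘ (∧²f ⊗ ⋯ ⊗ ∧²f ⊗ f)`. -/
noncomputable def Cochain.map {V' W' : Type*} [AddCommGroup V'] [Module K V'] [AddCommGroup W']
    [Module K W'] (f : V' →ₗ[K] V) (u : W →ₗ[K] W') (n : ℕ) :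
    Cochain K V W n →ₗ[K] Cochain K V' W' n where
  toFun P := ⟨((LinearMap.lcomp K W' f) ∘ₗ (LinearMap.llcomp K V W W' u)).compMultilinearMap
      (P.1.compLinearMap fun _ => exteriorPower.map 2 f), by
    intro X i x y hi hX
    have h := P.2 (fun j => exteriorPower.map 2 f (X j)) i (f x) (f y) hi (by
      have e : (f ∘ ![x, y]) = ![f x, f y] := by ext t; fin_cases t <;> rfl
      simp only [hX, wedge, exteriorPower.map_apply_ιMulti, e])
    change u (P.1 (fun j => exteriorPower.map 2 f (X j)) (f y)) = 0
    rw [h, map_zero]⟩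
  map_add' P P' := by
    apply Subtype.ext; ext X v; simp
  map_smul' c P := by
    apply Subtype.ext; ext X v; simp

theorem Cochain.map_apply {V' W' : Type*} [AddCommGroup V'] [Module K V'] [AddCommGroup W']
    [Module K W'] (f : V' →ₗ[K] V) (u : W →ₗ[K] W') (n : ℕ) (P : Cochain K V W n)
    (X : Fin n → ⋀[K]^2 V') (v : V') :
    (Cochain.map f u n P).1 X v = u (P.1 (fun i => exteriorPower.map 2 f (X i)) (f v)) := rfl

/-- A trilinear alternating bracket, viewed as an element of `C¹(V, V) = Hom(∧³V, V)`. -/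
noncomputable def ofBracket (m : V [⋀^Fin 3]→ₗ[K] V) : Cochain K V V 1 :=
  ⟨MultilinearMap.ofSubsingleton K (⋀[K]^2 V) (V →ₗ[K] V) (0 : Fin 1)
    (LinearMap.flip ((exteriorPower.alternatingMapLinearEquiv (R := K) (n := 2)).toLinearMap ∘ₗ
      m.curryLeft)), by
    intro X i x y _ hX
    obtain rfl : i = 0 := Subsingleton.elim _ _
    simp only [MultilinearMap.ofSubsingleton_apply_apply, hX, wedge, LinearMap.flip_apply,
      LinearMap.comp_apply, LinearEquiv.coe_coe, exteriorPower.alternatingMapLinearEquiv_apply_ιMulti,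
      AlternatingMap.curryLeft_apply_apply]
    exact m.map_eq_zero_of_eq _ (i := 0) (j := 2) rfl (by decide)⟩

theorem ofBracket_apply (m : V [⋀^Fin 3]→ₗ[K] V) (x y z : V) :
    (ofBracket m).1 (fun _ => wedge K x y) z = m ![x, y, z] := by
  have e : (ofBracket m).1 (fun _ => wedge K x y) z = m ![z, x, y] := by
    simp [ofBracket, wedge]
  have h1 := m.map_swap ![z, x, y] (i := 0) (j := 1) (by decide)
  have h2 := m.map_swap ![x, z, y] (i := 1) (j := 2) (by decide)
  have e1 : ![z, x, y] ∘ Equiv.swap (0 : Fin 3) 1 = ![x, z, y] := by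
    ext t; fin_cases t <;> rfl
  have e2 : ![x, z, y] ∘ Equiv.swap (1 : Fin 3) 2 = ![x, y, z] := by
    ext t; fin_cases t <;> rfl
  rw [e1] at h1
  rw [e2] at h2
  rw [e, h2, h1, neg_neg]

/-- A linear map, viewed as an element of `C⁰(V, W) = Hom(V, W)`. -/
noncomputable def ofHom (f : V →ₗ[K] W) : TotalCochain K V W :=
  DirectSum.lof K ℕ (fun n => Cochain K V W n) 0
    ⟨MultilinearMap.constOfIsEmpty K _ f, fun _ i => i.elim0⟩

variable (K V W) in
/-- The `ℤ`-grading: `Cⁿ(V, W)` sits in degree `n`, and negative degrees are zero. -/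
def cochainGrading (d : ℤ) : Submodule K (TotalCochain K V W) where
  carrier := {P | ∀ n : ℕ, (n : ℤ) ≠ d → P n = 0}
  add_mem' := by
    intro P Q hP hQ n hn
    rw [DirectSum.add_apply, hP n hn, hQ n hn, add_zero]
  zero_mem' := fun _ _ => rfl
  smul_mem' := by
    intro c P hP n hn
    rw [DirectSum.smul_apply, hP n hn, smul_zero]

end Cochain

section LInfinity
variable {K A : Type*} [Field K] [AddCommGroup A] [Module K A]

/-- The Koszul sign `ε(σ)` of homogeneous elements of degrees `d`: the product of
`(-1)^{|x_i||x_j|}` over all pairs whose order is reversed in `x_{σ(1)}, …, x_{σ(n)}`. -/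
def koszulSign {n : ℕ} (d : Fin n → ℤ) (σ : Equiv.Perm (Fin n)) : ℤˣ :=
  ∏ a : Fin n, ∏ b : Fin n,
    if a < b ∧ σ b < σ a then (-1 : ℤˣ) ^ (d (σ a) * d (σ b)) else 1

/-- `L_∞`-algebra structure (graded symmetric brackets `l_k`, `k ≥ 1`, of degree `1`) on the graded
vector space `A = ⊕ 𝒜 d`; the map `l 0` plays no role. In the generalized Jacobi identity the inner
bracket is `l_{i+1}` with `i = 0, …, n - 1`, the outer one is `l_{n-i}`. -/
structure IsLInfinityAlgebra (𝒜 : ℤ → Submodule K A)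
    (l : (k : ℕ) → MultilinearMap K (fun _ : Fin k => A) A) : Prop where
  isInternal : DirectSum.IsInternal 𝒜
  degree_one : ∀ k : ℕ, 1 ≤ k → ∀ (d : Fin k → ℤ) (x : Fin k → A), (∀ i, x i ∈ 𝒜 (d i)) →
    l k x ∈ 𝒜 ((∑ i, d i) + 1)
  graded_symmetry : ∀ n : ℕ, 1 ≤ n → ∀ (d : Fin n → ℤ) (x : Fin n → A), (∀ i, x i ∈ 𝒜 (d i)) →
    ∀ σ : Equiv.Perm (Fin n),
      l n (fun i => x (σ i)) = ((koszulSign d σ : ℤ) : K) • l n x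
  generalized_jacobi : ∀ n : ℕ, 1 ≤ n → ∀ (d : Fin n → ℤ) (x : Fin n → A),
    (∀ i, x i ∈ 𝒜 (d i)) →
    ∑ i : Fin n, ∑ σ ∈ shuffles (i + 1) n, ((koszulSign d σ : ℤ) : K) •
      l (n - 1 - i + 1) (Matrix.vecCons
        (l (i + 1) fun s : Fin (i + 1) => x (σ ⟨s, by omega⟩))
        (fun t : Fin (n - 1 - i) => x (σ ⟨i + 1 + t, by omega⟩))) = 0

/-- Maurer-Cartan elements: degree zero elements with `∑_{n ≥ 1} (1 / n!) l_n(α, …, α) = 0`,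
where the sum is required to be finite. -/
structure IsMaurerCartan (𝒜 : ℤ → Submodule K A)
    (l : (k : ℕ) → MultilinearMap K (fun _ : Fin k => A) A) (α : A) : Prop where
  mem_zero : α ∈ 𝒜 0
  finite_support : {n : ℕ | l (n + 1) (fun _ => α) ≠ 0}.Finite
  equation : ∑ᶠ n : ℕ, (((n + 1).factorial : K))⁻¹ • l (n + 1) (fun _ => α) = 0

/-- `(x₁, …, x_k) ↦ f(α, …, α, x₁, …, x_k)` with `n` copies of `α`. -/
def insertLeft (α : A) (n k : ℕ) (f : MultilinearMap K (fun _ : Fin (n + k) => A) A) :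
    MultilinearMap K (fun _ : Fin k => A) A :=
  (f.domDomCongr finSumFinEquiv.symm).currySum (fun _ : Fin n => α)

theorem insertLeft_apply (α : A) (n k : ℕ) (f : MultilinearMap K (fun _ : Fin (n + k) => A) A)
    (x : Fin k → A) : insertLeft α n k f x = f (Fin.append (fun _ => α) x) := by
  simp only [insertLeft, MultilinearMap.currySum_apply', MultilinearMap.domDomCongr_apply]
  congr 1
  ext1 i
  refine Fin.addCases (fun j => ?_) (fun j => ?_) i <;> simp

/-- The twisted brackets `l_k^α = ∑_{n ≥ 0} (1 / n!) l_{n+k}(α, …, α, -)`. -/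
noncomputable def twist (l : (k : ℕ) → MultilinearMap K (fun _ : Fin k => A) A) (α : A) (k : ℕ) :
    MultilinearMap K (fun _ : Fin k => A) A :=
  ∑ᶠ n : ℕ, ((n.factorial : K))⁻¹ • insertLeft α n k (l (n + k))

end LInfinity

section DerivedBrackets
variable {K g h : Type*} [Field K] [AddCommGroup g] [Module K g] [AddCommGroup h] [Module K h]

variable (K g h) in
/-- The inclusion of `C*(g, h)` in `C*(g ⊕ h, g ⊕ h)`. -/
noncomputable def inclF : TotalCochain K g h →ₗ[K] TotalCochain K (g × h) (g × h) :=
  DirectSum.lmap (Cochain.map (LinearMap.fst K g h) (LinearMap.inr K g h))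

variable (K g h) in
/-- The projection of `C*(g ⊕ h, g ⊕ h)` onto `C*(g, h)`: restrict to `g`, then take the
`h`-component. -/
noncomputable def projF : TotalCochain K (g × h) (g × h) →ₗ[K] TotalCochain K g h :=
  DirectSum.lmap (Cochain.map (LinearMap.inl K g h) (LinearMap.snd K g h))

/-- `[⋯[[Δ, a₁], a₂], ⋯, a_k]`, for `a_i` in `C*(g, h)`. -/
noncomputable def iteratedBracket (Δ : TotalCochain K (g × h) (g × h)) :
    (k : ℕ) → MultilinearMap K (fun _ : Fin k => TotalCochain K g h) (TotalCochain K (g × h) (g × h))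
  | 0 => MultilinearMap.constOfIsEmpty K _ Δ
  | k + 1 => MultilinearMap.uncurryRight
      ((nrBracket.compl₂ (inclF K g h)).compMultilinearMap (iteratedBracket Δ k))

/-- The higher derived brackets `l_k(a₁, …, a_k)` on `C*(g, h)`: the projection of
`[⋯[[Δ, a₁], a₂], ⋯, a_k]` with `Δ = π + ρ + μ`. -/
noncomputable def derivedBracket (π : g [⋀^Fin 3]→ₗ[K] g) (μ : h [⋀^Fin 3]→ₗ[K] h)
    (ρ : g [⋀^Fin 2]→ₗ[K] Module.End K h) (k : ℕ) :
    MultilinearMap K (fun _ : Fin k => TotalCochain K g h) (TotalCochain K g h) :=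
  (projF K g h).compMultilinearMap (iteratedBracket
    (DirectSum.lof K ℕ (fun n => Cochain K (g × h) (g × h) n) 1
      (ofBracket (semidirectBracket π μ ρ))) k)

end DerivedBrackets
end ThreeLie

/-!
The circle product of `C*(V, V)` interacts with the contractions `i_X A = A(X, -)`, `X ∈ ∧²V`, by
the Leibniz rule `i_X (P ∘ Q) = (-1)^q i_X P ∘ Q + P ∘ i_X Q + i_{Q · X} P` for `Q` of degree `q`,
where only the component of degree zero of `Q` acts on `∧²V`. A cochain is determined by its
contractions and its component of degree zero, so the graded right pre-Lie identity for `∘`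
follows by induction on the degree, and `[-, -]` is a graded Lie bracket. The fundamental identity
for a ternary bracket `m` says that `[m, m] = 0`; in particular `[Δ, Δ] = 0`.

Since `C*(g, h)` is an abelian subalgebra and `ker 𝒫` is a subalgebra, Voronov's construction
makes the higher derived brackets of `Δ` an `L_∞`-algebra. Bracketing with the projection onto `h`
gives a weight grading: `π + ρ` has weight `0`, `μ` has weight `2`, and `C*(g, h)` has weight
`-1`, the least possible one. Hence `𝒫[⋯[Δ, a₁], ⋯, a_k]` vanishes unless `k = 1` (only `π + ρ`
contributes) or `k = 3` (only `μ` does). Twisting by `H` replaces `Δ` by `e^{[-, H]} Δ`, which is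
again of square zero and which `𝒫` sends to the Maurer–Cartan expression of `H`, so Voronov's
construction applies again.
-/

namespace ThreeLie

/-! ### Shuffles -/

section Shuffles

/-- The permutation with value `0` at position `p` and, at the other positions in order, the values
`τ 0 + 1, τ 1 + 1, …`; every permutation of `Fin (n + 1)` arises from a unique pair `(p, τ)`. -/
def insertZeroPerm {n : ℕ} (p : Fin (n + 1)) (τ : Equiv.Perm (Fin n)) :
    Equiv.Perm (Fin (n + 1)) :=
  ((finSuccEquiv' p).trans (Equiv.optionCongr τ)).trans (finSuccEquiv' 0).symm

theorem insertZeroPerm_self {n : ℕ} (p : Fin (n + 1)) (τ : Equiv.Perm (Fin n)) :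
    insertZeroPerm p τ p = 0 := by
  simp [insertZeroPerm]

theorem insertZeroPerm_succAbove {n : ℕ} (p : Fin (n + 1)) (τ : Equiv.Perm (Fin n)) (j : Fin n) :
    insertZeroPerm p τ (p.succAbove j) = (τ j).succ := by
  simp [insertZeroPerm]

theorem insertZeroPerm_bijective (n : ℕ) :
    Function.Bijective fun x : Fin (n + 1) × Equiv.Perm (Fin n) => insertZeroPerm x.1 x.2 := by
  rw [Fintype.bijective_iff_injective_and_card]
  constructor
  · rintro ⟨p, τ⟩ ⟨q, τ'⟩ h
    have h' : insertZeroPerm p τ = insertZeroPerm q τ' := h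
    obtain rfl : p = q := (insertZeroPerm q τ').injective <| by
      rw [insertZeroPerm_self, ← h', insertZeroPerm_self]
    congr 1
    ext1 j
    simpa only [insertZeroPerm_succAbove, Fin.succ_inj] using
      DFunLike.congr_fun h' (p.succAbove j)
  · simp [Fintype.card_perm, Nat.factorial_succ]

theorem mem_shuffles {i n : ℕ} {σ : Equiv.Perm (Fin n)} :
    σ ∈ shuffles i n ↔ ∀ a b : Fin n, a < b → ((b : ℕ) < i ∨ i ≤ (a : ℕ)) → σ a < σ b := by
  simp [shuffles]

theorem insertZeroPerm_zero_mem_shuffles {n i : ℕ} {τ : Equiv.Perm (Fin n)} :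
    insertZeroPerm 0 τ ∈ shuffles (i + 1) (n + 1) ↔ τ ∈ shuffles i n := by
  have h_succ (j : Fin n) : insertZeroPerm 0 τ j.succ = (τ j).succ :=
    insertZeroPerm_succAbove 0 τ j
  simp [mem_shuffles, Fin.forall_fin_succ, h_succ, insertZeroPerm_self]

theorem insertZeroPerm_mem_shuffles {n : ℕ} {p : Fin (n + 1)} {τ : Equiv.Perm (Fin n)} :
    insertZeroPerm p τ ∈ shuffles p (n + 1) ↔ τ ∈ shuffles p n := by
  have h_lt (j : Fin n) : (p.succAbove j : ℕ) < p ↔ (j : ℕ) < p :=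
    Fin.succAbove_lt_iff_castSucc_lt p j
  have h_le (j : Fin n) : (p : ℕ) ≤ p.succAbove j ↔ (p : ℕ) ≤ j := by
    simpa only [not_lt] using not_congr (h_lt j)
  simp only [mem_shuffles, Fin.forall_iff_succAbove p, insertZeroPerm_self,
    insertZeroPerm_succAbove, h_lt, h_le, (Fin.strictMono_succAbove p).lt_iff_lt,
    Fin.succ_lt_succ_iff, Fin.succ_pos, lt_irrefl]
  grind

theorem eq_zero_or_eq_of_insertZeroPerm_mem_shuffles {n i : ℕ} {p : Fin (n + 1)}
    {τ : Equiv.Perm (Fin n)} (h : insertZeroPerm p τ ∈ shuffles i (n + 1)) :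
    (p : ℕ) = 0 ∨ (p : ℕ) = i := by
  by_contra! hp
  have h_lt := mem_shuffles.1 h ⟨p - 1, by omega⟩ p (Fin.lt_def.2 (by dsimp only; omega))
    (by dsimp only; omega)
  rw [insertZeroPerm_self] at h_lt
  exact Fin.not_lt_zero _ h_lt

/-- The permutation `σ` of `{0, …, n - 1}`, extended to `ℕ` by the identity: with arguments indexed
by `ℕ`, the recursions over shuffles below are free of casts between the types `Fin n`. -/
def extendPerm {n : ℕ} (σ : Equiv.Perm (Fin n)) (a : ℕ) : ℕ :=
  if h : a < n then σ ⟨a, h⟩ else a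

theorem extendPerm_of_lt {n : ℕ} (σ : Equiv.Perm (Fin n)) {a : ℕ} (h : a < n) :
    extendPerm σ a = σ ⟨a, h⟩ := dif_pos h

theorem extendPerm_val {n : ℕ} (σ : Equiv.Perm (Fin n)) (a : Fin n) : extendPerm σ a = σ a :=
  dif_pos a.2

/-- The analogue of `insertZeroPerm` for functions on `ℕ`. -/
def insertZero (p : ℕ) (s : ℕ → ℕ) (a : ℕ) : ℕ :=
  if a < p then s a + 1 else if a = p then 0 else s (a - 1) + 1

theorem insertZero_of_lt {p a : ℕ} (s : ℕ → ℕ) (h : a < p) : insertZero p s a = s a + 1 := by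
  simp [insertZero, h]

theorem insertZero_self (p : ℕ) (s : ℕ → ℕ) : insertZero p s p = 0 := by simp [insertZero]

theorem insertZero_of_le {p a : ℕ} (s : ℕ → ℕ) (h : p ≤ a) :
    insertZero p s (a + 1) = s a + 1 := by
  rw [insertZero, if_neg (by omega), if_neg (by omega), Nat.add_sub_cancel]

theorem insertZero_zero_succ (s : ℕ → ℕ) (a : ℕ) : insertZero 0 s (a + 1) = s a + 1 :=
  insertZero_of_le s a.zero_le

theorem extendPerm_insertZeroPerm {n : ℕ} (p : Fin (n + 1)) (τ : Equiv.Perm (Fin n)) :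
    extendPerm (insertZeroPerm p τ) = insertZero p (extendPerm τ) := by
  ext a
  by_cases ha : a < n + 1
  · lift a to Fin (n + 1) using ha
    rw [extendPerm_val]
    obtain rfl | ⟨b, rfl⟩ := Fin.eq_self_or_eq_succAbove p a
    · rw [insertZeroPerm_self, insertZero_self, Fin.val_zero]
    rw [insertZeroPerm_succAbove, Fin.val_succ]
    obtain hb | hb := lt_or_ge (b : ℕ) p
    · rw [Fin.succAbove_of_castSucc_lt _ _ hb, Fin.val_castSucc, insertZero_of_lt _ hb,
        extendPerm_val]
    · rw [Fin.succAbove_of_le_castSucc _ _ hb, Fin.val_succ, insertZero_of_le _ hb,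
        extendPerm_val]
  · obtain ⟨b, rfl⟩ : ∃ b, a = b + 1 := Nat.exists_eq_add_one.2 (by omega)
    rw [insertZero_of_le _ (by omega), extendPerm, extendPerm, dif_neg ha, dif_neg (by omega)]

theorem koszulSign_insertZeroPerm {n : ℕ} (d : Fin (n + 1) → ℤ) (p : Fin (n + 1))
    (τ : Equiv.Perm (Fin n)) : koszulSign d (insertZeroPerm p τ) =
      (∏ j : Fin n, if (j : ℕ) < p then (-1 : ℤˣ) ^ (d 0 * d (τ j).succ) else 1) *
        koszulSign (fun a => d a.succ) τ := by
  rw [koszulSign, Fin.prod_univ_succAbove _ p, Finset.prod_eq_one, one_mul, koszulSign,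
    ← Finset.prod_mul_distrib]
  · refine Finset.prod_congr rfl fun j _ => ?_
    rw [Fin.prod_univ_succAbove _ p]
    congr 1
    · have h_lt : p.succAbove j < p ↔ (j : ℕ) < p := Fin.succAbove_lt_iff_castSucc_lt p j
      simp [insertZeroPerm_self, insertZeroPerm_succAbove, mul_comm (d 0), h_lt]
    · simp only [insertZeroPerm_succAbove, Fin.succ_lt_succ_iff,
        (Fin.strictMono_succAbove p).lt_iff_lt]
  · intro b _
    simp [insertZeroPerm_self]

theorem koszulSign_const_one {n : ℕ} (σ : Equiv.Perm (Fin n)) :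
    koszulSign (fun _ => 1) σ = Equiv.Perm.sign σ := by
  rw [Equiv.Perm.sign_eq_prod_prod_Ioi, koszulSign]
  refine Finset.prod_congr rfl fun a _ => ?_
  rw [← Finset.prod_subset (Finset.subset_univ (Finset.Ioi a)) fun b _ hb =>
    if_neg fun h => hb (Finset.mem_Ioi.2 h.1)]
  refine Finset.prod_congr rfl fun b hb => ?_
  have h_lt : a < b := Finset.mem_Ioi.1 hb
  have h_ne : σ a ≠ σ b := fun h => h_lt.ne (σ.injective h)
  obtain h | h := h_ne.lt_or_gt
  · simp [h, h.le]
  · simp [h, h_lt, h.not_gt]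

end Shuffles

section Signs
variable {K : Type*} [Field K]

theorem neg_one_zpow_add (a b : ℤ) : (-1 : K) ^ (a + b) = (-1) ^ a * (-1) ^ b :=
  zpow_add₀ (neg_ne_zero.2 one_ne_zero) a b

theorem neg_one_zpow_sq (a : ℤ) : (-1 : K) ^ a * (-1) ^ a = 1 := by
  rw [← neg_one_zpow_add, (Even.add_self a).neg_one_zpow]

theorem neg_one_zpow_eq_of_even_add {a b : ℤ} (h : Even (a + b)) : (-1 : K) ^ a = (-1) ^ b := by
  simp only [neg_one_zpow_eq_ite, Int.even_add.1 h]

theorem neg_one_zpow_sum {ι : Type*} (s : Finset ι) (f : ι → ℤ) :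
    (-1 : K) ^ (∑ i ∈ s, f i) = ∏ i ∈ s, (-1) ^ f i := by
  classical
  induction s using Finset.induction_on with
  | empty => simp
  | insert a s ha ih => rw [Finset.sum_insert ha, Finset.prod_insert ha, neg_one_zpow_add, ih]

end Signs

section ShuffleSum
variable {K M : Type*} [Field K] [AddCommMonoid M] [Module K M]

theorem koszulSign_insertZeroPerm_cast {n : ℕ} (d : ℕ → ℤ) (p : Fin (n + 1))
    (τ : Equiv.Perm (Fin n)) :
    ((koszulSign (fun a : Fin (n + 1) => d a) (insertZeroPerm p τ) : ℤ) : K) =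
      ((koszulSign (fun a : Fin n => d (a + 1)) τ : ℤ) : K) *
        (-1) ^ (d 0 * ∑ j ∈ Finset.range p, d (extendPerm τ j + 1)) := by
  rw [koszulSign_insertZeroPerm, mul_comm, Finset.mul_sum, neg_one_zpow_sum, Units.val_mul,
    Int.cast_mul]
  congr 1
  have h_term (j : Fin n) :
      (((if (j : ℕ) < p then (-1 : ℤˣ) ^ (d 0 * d (extendPerm τ j + 1)) else 1 : ℤˣ) : ℤ) : K) =
        if (j : ℕ) < p then (-1 : K) ^ (d 0 * d (extendPerm τ j + 1)) else 1 := by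
    split_ifs
    · exact Int.cast_negOnePow K _
    · simp
  simp only [Units.coe_prod, Int.cast_prod, Fin.val_zero, Fin.val_succ, ← extendPerm_val, h_term]
  rw [Fin.prod_univ_eq_prod_range
    (fun j => if j < (p : ℕ) then (-1 : K) ^ (d 0 * d (extendPerm τ j + 1)) else 1) n,
    ← Finset.prod_filter]
  congr 1
  ext j
  simp only [Finset.mem_filter, Finset.mem_range]
  omega

/-- The sum of `ε(σ) G(σ)` over the `(i, n - i)`-shuffles `σ`, where `ε` is the Koszul sign of
elements of degrees `d 0, …, d (n - 1)`. -/
def shuffleSum (K : Type*) [Field K] {M : Type*} [AddCommMonoid M] [Module K M]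
    (d : ℕ → ℤ) (i n : ℕ) (G : (ℕ → ℕ) → M) : M :=
  ∑ σ ∈ shuffles i n, ((koszulSign (fun a : Fin n => d a) σ : ℤ) : K) • G (extendPerm σ)

theorem shuffleSum_smul (d : ℕ → ℤ) (i n : ℕ) (c : K) (G : (ℕ → ℕ) → M) :
    shuffleSum K d i n (fun s => c • G s) = c • shuffleSum K d i n G := by
  simp only [shuffleSum, Finset.smul_sum, smul_comm c]

theorem shuffleSum_eq_sum_insertZero (d : ℕ → ℤ) (i n : ℕ) (G : (ℕ → ℕ) → M) :
    shuffleSum K d i (n + 1) G = ∑ p : Fin (n + 1), ∑ τ : Equiv.Perm (Fin n),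
      if insertZeroPerm p τ ∈ shuffles i (n + 1) then
        (((koszulSign (fun a : Fin n => d (a + 1)) τ : ℤ) : K) *
          (-1) ^ (d 0 * ∑ j ∈ Finset.range p, d (extendPerm τ j + 1))) •
            G (insertZero p (extendPerm τ))
      else 0 := by
  rw [shuffleSum, shuffles, Finset.sum_filter,
    ← (Equiv.ofBijective _ (insertZeroPerm_bijective n)).sum_comp, Fintype.sum_prod_type]
  refine Finset.sum_congr rfl fun p _ => Finset.sum_congr rfl fun τ _ => ?_
  simp only [Equiv.ofBijective_apply, Finset.mem_filter, Finset.mem_univ, true_and,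
    koszulSign_insertZeroPerm_cast, extendPerm_insertZeroPerm]

theorem shuffleSum_size_zero (d : ℕ → ℤ) (i : ℕ) (G : (ℕ → ℕ) → M) :
    shuffleSum K d i 0 G = G id := by
  have h_univ : shuffles i 0 = Finset.univ :=
    Finset.eq_univ_of_forall fun σ => mem_shuffles.2 fun a => a.elim0
  have h_id (σ : Equiv.Perm (Fin 0)) : extendPerm σ = id :=
    funext fun a => dif_neg a.not_lt_zero
  simp [shuffleSum, h_univ, h_id, koszulSign]

theorem shuffleSum_zero_succ (d : ℕ → ℤ) (n : ℕ) (G : (ℕ → ℕ) → M) :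
    shuffleSum K d 0 (n + 1) G =
      shuffleSum K (fun a => d (a + 1)) 0 n (fun s => G (insertZero 0 s)) := by
  rw [shuffleSum_eq_sum_insertZero, Fin.sum_univ_succ, Finset.sum_eq_zero (s := Finset.univ)
    (f := fun p : Fin n => _), add_zero, shuffleSum, ← Finset.sum_filter]
  · refine Finset.sum_congr ?_ fun τ _ => ?_
    · ext τ
      simpa using insertZeroPerm_mem_shuffles (p := 0) (τ := τ)
    · simp
  · refine fun p _ => Finset.sum_eq_zero fun τ _ => if_neg fun h => ?_
    simpa using eq_zero_or_eq_of_insertZeroPerm_mem_shuffles h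

theorem shuffleSum_succ_self (d : ℕ → ℤ) (n : ℕ) (G : (ℕ → ℕ) → M) :
    shuffleSum K d (n + 1) (n + 1) G =
      shuffleSum K (fun a => d (a + 1)) n n (fun s => G (insertZero 0 s)) := by
  rw [shuffleSum_eq_sum_insertZero, Fin.sum_univ_succ, Finset.sum_eq_zero (s := Finset.univ)
    (f := fun p : Fin n => _), add_zero, shuffleSum, ← Finset.sum_filter]
  · refine Finset.sum_congr ?_ fun τ _ => ?_
    · ext τ
      simpa using insertZeroPerm_zero_mem_shuffles (τ := τ)
    · simp
  · refine fun p _ => Finset.sum_eq_zero fun τ _ => if_neg fun h => ?_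
    have := eq_zero_or_eq_of_insertZeroPerm_mem_shuffles h
    simp only [Fin.val_succ] at this
    omega

theorem shuffleSum_succ_succ (d : ℕ → ℤ) {i n : ℕ} (hi : i < n) (G : (ℕ → ℕ) → M) :
    shuffleSum K d (i + 1) (n + 1) G =
      shuffleSum K (fun a => d (a + 1)) i n (fun s => G (insertZero 0 s)) +
      shuffleSum K (fun a => d (a + 1)) (i + 1) n (fun s =>
        (-1 : K) ^ (d 0 * ∑ j ∈ Finset.range (i + 1), d (s j + 1)) •
          G (insertZero (i + 1) s)) := by
  rw [shuffleSum_eq_sum_insertZero, Fin.sum_univ_succ, Finset.sum_eq_single (⟨i, hi⟩ : Fin n)]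
  · congr 1
    · rw [shuffleSum, ← Finset.sum_filter]
      refine Finset.sum_congr ?_ fun τ _ => ?_
      · ext τ
        simpa using insertZeroPerm_zero_mem_shuffles (τ := τ)
      · simp
    · rw [shuffleSum, ← Finset.sum_filter]
      refine Finset.sum_congr ?_ fun τ _ => ?_
      · ext τ
        simpa using insertZeroPerm_mem_shuffles (p := Fin.succ ⟨i, hi⟩) (τ := τ)
      · simp [mul_smul]
  · intro p _ hp
    refine Finset.sum_eq_zero fun τ _ => if_neg fun h => hp (Fin.ext ?_)
    simpa using eq_zero_or_eq_of_insertZeroPerm_mem_shuffles h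
  · simp

/-- The first element is either the first one of the first block or the first one of the second
block of a shuffle; in the latter case it has passed the whole first block. -/
theorem sum_shuffleSum_succ (d : ℕ → ℤ) (n : ℕ) (G : ℕ → (ℕ → ℕ) → M) :
    ∑ i ∈ Finset.range (n + 2), shuffleSum K d i (n + 1) (G i) =
      ∑ i ∈ Finset.range (n + 1),
        shuffleSum K (fun a => d (a + 1)) i n (fun s => G (i + 1) (insertZero 0 s)) +
      ∑ i ∈ Finset.range (n + 1), shuffleSum K (fun a => d (a + 1)) i n (fun s =>
        (-1 : K) ^ (d 0 * ∑ j ∈ Finset.range i, d (s j + 1)) • G i (insertZero i s)) := by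
  have h_split : ∑ i ∈ Finset.range n, shuffleSum K d (i + 1) (n + 1) (G (i + 1)) = _ :=
    Finset.sum_congr rfl fun i hi => shuffleSum_succ_succ d (Finset.mem_range.1 hi) (G (i + 1))
  rw [Finset.sum_range_succ', Finset.sum_range_succ, h_split, Finset.sum_add_distrib,
    shuffleSum_succ_self, shuffleSum_zero_succ, Finset.sum_range_succ (n := n),
    Finset.sum_range_succ' (n := n)]
  simp only [Finset.range_zero, Finset.sum_empty, mul_zero, zpow_zero, one_smul]
  abel

/-- The sum over the `(k, q)`-shuffles with the signs of the circle product. -/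
def circShuffleSum (K : Type*) [Field K] {M : Type*} [AddCommMonoid M] [Module K M]
    (k q : ℕ) (G : (ℕ → ℕ) → M) : M :=
  (-1 : K) ^ (k * q) • shuffleSum K (fun _ => 1) k (k + q) G

theorem circShuffleSum_eq_sum (k q : ℕ) (G : (ℕ → ℕ) → M) :
    circShuffleSum K k q G = ∑ σ ∈ shuffles k (k + q),
      ((-1 : K) ^ (k * q) * ((Equiv.Perm.sign σ : ℤ) : K)) • G (extendPerm σ) := by
  simp only [circShuffleSum, shuffleSum, koszulSign_const_one, Finset.smul_sum, mul_smul]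

theorem circShuffleSum_zero_zero (G : (ℕ → ℕ) → M) : circShuffleSum K 0 0 G = G id := by
  simp [circShuffleSum, shuffleSum_size_zero]

theorem circShuffleSum_zero_succ (q : ℕ) (G : (ℕ → ℕ) → M) :
    circShuffleSum K 0 (q + 1) G = circShuffleSum K 0 q fun s => G (insertZero 0 s) := by
  simp only [circShuffleSum, ← add_assoc, shuffleSum_zero_succ, zero_mul]

theorem circShuffleSum_succ_zero (k : ℕ) (G : (ℕ → ℕ) → M) :
    circShuffleSum K (k + 1) 0 G = circShuffleSum K k 0 fun s => G (insertZero 0 s) := by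
  simp only [circShuffleSum, add_zero, shuffleSum_succ_self, mul_zero]

theorem circShuffleSum_succ_succ (k q : ℕ) (G : (ℕ → ℕ) → M) :
    circShuffleSum K (k + 1) (q + 1) G =
      (-1 : K) ^ (q + 1) • circShuffleSum K k (q + 1) (fun s => G (insertZero 0 s)) +
      circShuffleSum K (k + 1) q fun s => G (insertZero (k + 1) s) := by
  have h_sign : (-1 : K) ^ ((k + 1) * (q + 1)) *
      (-1) ^ ((1 : ℤ) * ∑ _j ∈ Finset.range (k + 1), 1) = (-1) ^ ((k + 1) * q) := by
    rw [Finset.sum_const, Finset.card_range, one_mul, nsmul_one, zpow_natCast, mul_add, pow_add,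
      mul_assoc, mul_one, ← mul_pow, neg_mul_neg, one_mul, one_pow, mul_one]
  simp only [circShuffleSum]
  rw [show k + 1 + (q + 1) = k + (q + 1) + 1 by omega, shuffleSum_succ_succ _ (by omega),
    shuffleSum_smul, smul_add, smul_smul, smul_smul, h_sign, ← pow_add,
    show q + 1 + k * (q + 1) = (k + 1) * (q + 1) by ring,
    show k + (q + 1) = k + 1 + q by omega]

end ShuffleSum

/-! ### The recursion for the circle product -/

section CircRecursion
variable {K V W : Type*} [Field K] [AddCommGroup V] [Module K V] [AddCommGroup W] [Module K W]

/-- The arguments of `P` in an inner term of the circle product `P ∘ Q`, as in `insertArgs`, for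
arguments `Z` indexed by `ℕ` and a shuffle `s`. -/
noncomputable def insertSeq {q : ℕ} (Q : PreCochain K V V q) (k : ℕ) (s : ℕ → ℕ)
    (Z : ℕ → ⋀[K]^2 V) (j : ℕ) : ⋀[K]^2 V :=
  if j < k then Z (s j)
  else if j = k then wedgeDer (Q fun i => Z (s (k + i))) (Z (k + q))
  else Z (j + q)

/-- The outer term of the circle product `P ∘ Q`, as in `outerTerm`, for arguments `Z` indexed by
`ℕ` and a shuffle `s`. -/
noncomputable def outerSeq {p q : ℕ} (P : PreCochain K V V p) (Q : PreCochain K V V q)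
    (s : ℕ → ℕ) (Z : ℕ → ⋀[K]^2 V) : V →ₗ[K] V :=
  (P fun j => Z (s j)) ∘ₗ Q fun i => Z (s (p + i))

theorem insertArgs_eq_insertSeq {p q : ℕ} (Q : PreCochain K V V q) (k : Fin p)
    (σ : Equiv.Perm (Fin (k + q))) (Z : ℕ → ⋀[K]^2 V) :
    insertArgs Q k σ (fun j : Fin (p + q) => Z j) =
      fun j : Fin p => insertSeq Q k (extendPerm σ) Z j := by
  ext1 j
  unfold insertArgs insertSeq
  split_ifs with h_lt h_eq h_val h_val
  · rw [extendPerm_of_lt]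
    rfl
  · have h_block (i : Fin q) : extendPerm σ (k + i) = σ (Fin.natAdd k i) :=
      extendPerm_val σ (Fin.natAdd k i)
    simp only [h_block, Fin.val_castLE]
  · exact absurd (congrArg Fin.val h_eq) h_val
  · exact absurd (Fin.ext h_val) h_eq
  · rfl

theorem outerTerm_eq_outerSeq {p q : ℕ} (P : PreCochain K V V p) (Q : PreCochain K V V q)
    (σ : Equiv.Perm (Fin (p + q))) (Z : ℕ → ⋀[K]^2 V) :
    outerTerm P Q σ (fun j : Fin (p + q) => Z j) = outerSeq P Q (extendPerm σ) Z := by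
  have h_left (j : Fin p) : extendPerm σ j = σ (Fin.castAdd q j) :=
    extendPerm_val σ (Fin.castAdd q j)
  have h_right (i : Fin q) : extendPerm σ (p + i) = σ (Fin.natAdd p i) :=
    extendPerm_val σ (Fin.natAdd p i)
  simp only [outerSeq, h_left, h_right]
  rfl

theorem circ_eq_sum_circShuffleSum {p q : ℕ} (P : PreCochain K V V p) (Q : PreCochain K V V q)
    (Z : ℕ → ⋀[K]^2 V) :
    circ P Q (fun j : Fin (p + q) => Z j) =
      ∑ k ∈ Finset.range p, circShuffleSum K k q (fun s => P fun j => insertSeq Q k s Z j) +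
      circShuffleSum K p q (fun s => outerSeq P Q s Z) := by
  have h_insert (k : Fin p) (σ : Equiv.Perm (Fin (k + q))) :
      insertTerm P Q k σ (fun j : Fin (p + q) => Z j) =
        P fun j => insertSeq Q k (extendPerm σ) Z j :=
    congrArg P (insertArgs_eq_insertSeq Q k σ Z)
  rw [← Fin.sum_univ_eq_sum_range
    (fun k => circShuffleSum K k q fun s => P fun j => insertSeq Q k s Z j) p]
  simp only [circ, add_apply, sum_apply, smul_apply, circShuffleSum_eq_sum, h_insert,
    outerTerm_eq_outerSeq]

theorem apply_seq_eq_curryLeft {n : ℕ} (P : PreCochain K V W (n + 1)) (f : ℕ → ⋀[K]^2 V) :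
    (P fun j => f j) = P.curryLeft (f 0) fun j => f (j + 1) := by
  rw [MultilinearMap.curryLeft_apply]
  congr 1
  ext1 j
  refine Fin.cases ?_ (fun j => ?_) j <;> simp

theorem insertSeq_insertZero_zero {p q : ℕ} (P : PreCochain K V V (p + 1))
    (Q : PreCochain K V V q) (k : ℕ) (s : ℕ → ℕ) (Z : ℕ → ⋀[K]^2 V) :
    (P fun j => insertSeq Q (k + 1) (insertZero 0 s) Z j) =
      P.curryLeft (Z 0) fun j => insertSeq Q k s (fun a => Z (a + 1)) j := by
  have h_zero : insertSeq Q (k + 1) (insertZero 0 s) Z 0 = Z 0 := by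
    simp [insertSeq, insertZero_self]
  rw [apply_seq_eq_curryLeft, h_zero]
  simp only [insertSeq, add_lt_add_iff_right, insertZero_zero_succ, add_left_inj,
    add_right_comm _ 1]

theorem insertSeq_insertZero_self {q : ℕ} (Q : PreCochain K V V (q + 1)) (k : ℕ)
    (s : ℕ → ℕ) (Z : ℕ → ⋀[K]^2 V) (j : ℕ) :
    insertSeq Q k (insertZero k s) Z j =
      insertSeq (Q.curryLeft (Z 0)) k s (fun a => Z (a + 1)) j := by
  unfold insertSeq
  split_ifs with h_lt
  · rw [insertZero_of_lt s h_lt]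
  · rw [apply_seq_eq_curryLeft Q fun i => Z (insertZero k s (k + i))]
    simp only [add_zero, insertZero_self, ← add_assoc, insertZero_of_le s (Nat.le_add_right k _)]
  · rfl

theorem outerSeq_insertZero_zero {p q : ℕ} (P : PreCochain K V V (p + 1))
    (Q : PreCochain K V V q) (s : ℕ → ℕ) (Z : ℕ → ⋀[K]^2 V) :
    outerSeq P Q (insertZero 0 s) Z =
      outerSeq (P.curryLeft (Z 0)) Q s (fun a => Z (a + 1)) := by
  rw [outerSeq, apply_seq_eq_curryLeft P fun j => Z (insertZero 0 s j), outerSeq]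
  simp only [insertZero_self, insertZero_zero_succ, add_right_comm p 1]

theorem outerSeq_insertZero_self {p q : ℕ} (P : PreCochain K V V p)
    (Q : PreCochain K V V (q + 1)) (s : ℕ → ℕ) (Z : ℕ → ⋀[K]^2 V) :
    outerSeq P Q (insertZero p s) Z =
      outerSeq P (Q.curryLeft (Z 0)) s (fun a => Z (a + 1)) := by
  rw [outerSeq, apply_seq_eq_curryLeft Q fun i => Z (insertZero p s (p + i)), outerSeq]
  simp only [add_zero, insertZero_self, ← add_assoc, insertZero_of_le s (Nat.le_add_right p _),
    insertZero_of_lt s (Fin.is_lt _)]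

theorem circ_succ_succ {p q : ℕ} (P : PreCochain K V V (p + 1)) (Q : PreCochain K V V (q + 1))
    (Z : ℕ → ⋀[K]^2 V) :
    circ P Q (fun j : Fin (p + 1 + (q + 1)) => Z j) =
      (-1 : K) ^ (q + 1) • circ (P.curryLeft (Z 0)) Q (fun j : Fin (p + (q + 1)) => Z (j + 1)) +
      circ P (Q.curryLeft (Z 0)) (fun j : Fin (p + 1 + q) => Z (j + 1)) := by
  rw [circ_eq_sum_circShuffleSum, circ_eq_sum_circShuffleSum _ _ fun a => Z (a + 1),
    circ_eq_sum_circShuffleSum _ _ fun a => Z (a + 1), Finset.sum_range_succ',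
    Finset.sum_range_succ' (n := p)]
  simp only [circShuffleSum_succ_succ, circShuffleSum_zero_succ, insertSeq_insertZero_zero,
    insertSeq_insertZero_self, outerSeq_insertZero_zero, outerSeq_insertZero_self,
    Finset.sum_add_distrib, smul_add, Finset.smul_sum]
  abel

theorem circ_succ_zero {p : ℕ} (P : PreCochain K V V (p + 1)) (Q : PreCochain K V V 0)
    (Z : ℕ → ⋀[K]^2 V) :
    circ P Q (fun j : Fin (p + 1 + 0) => Z j) =
      circ (P.curryLeft (Z 0)) Q (fun j : Fin (p + 0) => Z (j + 1)) +
      P.curryLeft (wedgeDer (Q Fin.elim0) (Z 0)) (fun j => Z (j + 1)) := by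
  have h_first : (P fun j => insertSeq Q 0 id Z j) =
      P.curryLeft (wedgeDer (Q Fin.elim0) (Z 0)) (fun j => Z (j + 1)) := by
    rw [apply_seq_eq_curryLeft, Subsingleton.elim Fin.elim0 fun i : Fin 0 => Z (id (0 + i))]
    simp [insertSeq]
  rw [circ_eq_sum_circShuffleSum, circ_eq_sum_circShuffleSum _ _ fun a => Z (a + 1),
    Finset.sum_range_succ', circShuffleSum_zero_zero, h_first]
  simp only [circShuffleSum_succ_zero, insertSeq_insertZero_zero, outerSeq_insertZero_zero]
  abel

theorem circ_zero_succ {q : ℕ} (P : PreCochain K V V 0) (Q : PreCochain K V V (q + 1))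
    (Z : ℕ → ⋀[K]^2 V) :
    circ P Q (fun j : Fin (0 + (q + 1)) => Z j) =
      circ P (Q.curryLeft (Z 0)) (fun j : Fin (0 + q) => Z (j + 1)) := by
  rw [circ_eq_sum_circShuffleSum, circ_eq_sum_circShuffleSum _ _ fun a => Z (a + 1)]
  simp only [Finset.range_zero, Finset.sum_empty, zero_add, circShuffleSum_zero_succ,
    outerSeq_insertZero_self]

theorem circ_zero_zero (P Q : PreCochain K V V 0) (f : Fin (0 + 0) → ⋀[K]^2 V) :
    circ P Q f = P Fin.elim0 ∘ₗ Q Fin.elim0 := by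
  have hf : f = fun _ => 0 := funext fun j => j.elim0
  rw [hf, circ_eq_sum_circShuffleSum P Q fun _ => 0, Finset.range_zero, Finset.sum_empty, zero_add,
    circShuffleSum_zero_zero, outerSeq]
  congr 2 <;> exact Subsingleton.elim _ _

end CircRecursion

/-! ### Contraction of cochains -/

section Contraction
variable {K V W : Type*} [Field K] [AddCommGroup V] [Module K V] [AddCommGroup W] [Module K W]

/-- The inclusion `Cⁿ(V, W) → C*(V, W)`. -/
noncomputable abbrev TotalCochain.lof (n : ℕ) : Cochain K V W n →ₗ[K] TotalCochain K V W :=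
  DirectSum.lof K ℕ (fun n => Cochain K V W n) n

theorem TotalCochain.linearMap_ext {M : Type*} [AddCommGroup M] [Module K M]
    {f f' : TotalCochain K V W →ₗ[K] M} (h : ∀ n P, f (lof n P) = f' (lof n P)) : f = f' :=
  DirectSum.linearMap_ext K fun n => LinearMap.ext (h n)

/-- The value of a total cochain at the first `n` members of a sequence of elements of `∧²V`. -/
noncomputable def evalSeq (n : ℕ) (Z : ℕ → ⋀[K]^2 V) : TotalCochain K V W →ₗ[K] V →ₗ[K] W where
  toFun A := (A n).1 fun j => Z j
  map_add' A B := by rw [DirectSum.add_apply]; rfl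
  map_smul' c A := by rw [DirectSum.smul_apply]; rfl

theorem evalSeq_lof {m n : ℕ} (h : m = n) (Z : ℕ → ⋀[K]^2 V) (A : Cochain K V W m) :
    evalSeq n Z (TotalCochain.lof m A) = A.1 fun j => Z j := by
  subst h
  simp [evalSeq]

theorem evalSeq_lof_of_ne {m n : ℕ} (h : m ≠ n) (Z : ℕ → ⋀[K]^2 V) (A : Cochain K V W m) :
    evalSeq n Z (TotalCochain.lof m A) = 0 := by
  simp [evalSeq, DirectSum.lof_eq_of, DirectSum.of_eq_of_ne _ _ _ h.symm]

theorem exists_seq {n : ℕ} (X : Fin n → ⋀[K]^2 V) :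
    ∃ Z : ℕ → ⋀[K]^2 V, X = fun j : Fin n => Z j :=
  ⟨fun a => if h : a < n then X ⟨a, h⟩ else 0, by ext1 j; simp⟩

theorem TotalCochain.ext_evalSeq {A B : TotalCochain K V W}
    (h : ∀ n Z, evalSeq n Z A = evalSeq n Z B) : A = B := by
  refine DFinsupp.ext fun n => Subtype.ext (MultilinearMap.ext fun X => ?_)
  obtain ⟨Z, rfl⟩ := exists_seq X
  exact h n Z

/-- The sequence `X, Z 0, Z 1, …`. -/
def consSeq {α : Type*} (X : α) (Z : ℕ → α) : ℕ → α
  | 0 => X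
  | n + 1 => Z n

theorem consSeq_head_tail {α : Type*} (Z : ℕ → α) : consSeq (Z 0) (fun a => Z (a + 1)) = Z := by
  ext1 a
  cases a <;> rfl

theorem evalSeq_succ_consSeq (X : ⋀[K]^2 V) (n : ℕ) (Z : ℕ → ⋀[K]^2 V) (A : TotalCochain K V W) :
    evalSeq (n + 1) (consSeq X Z) A = (A (n + 1)).1.curryLeft X fun j => Z j :=
  apply_seq_eq_curryLeft (A (n + 1)).1 (consSeq X Z)

/-- Contraction of a cochain with an element of `∧²V`, in the first argument. -/
noncomputable def Cochain.contr (X : ⋀[K]^2 V) (n : ℕ) :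
    Cochain K V W (n + 1) →ₗ[K] Cochain K V W n where
  toFun P := ⟨P.1.curryLeft X, fun Y i x y hi hY =>
    P.2 (Fin.cons X Y) i.succ x y (by simp [hi]) (by simpa using hY)⟩
  map_add' P Q := by ext; simp
  map_smul' c P := by ext; simp

/-- Contraction of a total cochain with an element of `∧²V`; it vanishes on `C⁰`. -/
noncomputable def contrWith (X : ⋀[K]^2 V) : TotalCochain K V W →ₗ[K] TotalCochain K V W :=
  DirectSum.toModule K ℕ _ fun n => match n with
    | 0 => 0
    | n + 1 => TotalCochain.lof n ∘ₗ Cochain.contr X n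

theorem contrWith_lof_succ (X : ⋀[K]^2 V) (n : ℕ) (P : Cochain K V W (n + 1)) :
    contrWith X (TotalCochain.lof (n + 1) P) = TotalCochain.lof n (Cochain.contr X n P) := by
  rw [contrWith, DirectSum.toModule_lof]
  rfl

theorem contrWith_lof_zero (X : ⋀[K]^2 V) (P : Cochain K V W 0) :
    contrWith X (TotalCochain.lof 0 P) = 0 := by
  rw [contrWith, DirectSum.toModule_lof]
  rfl

theorem evalSeq_contrWith (X : ⋀[K]^2 V) (n : ℕ) (Z : ℕ → ⋀[K]^2 V) (A : TotalCochain K V W) :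
    evalSeq n Z (contrWith X A) = evalSeq (n + 1) (consSeq X Z) A := by
  suffices h : evalSeq n Z ∘ₗ contrWith X = evalSeq (W := W) (n + 1) (consSeq X Z) from
    LinearMap.congr_fun h A
  refine TotalCochain.linearMap_ext fun m P => ?_
  rw [LinearMap.comp_apply]
  rcases m with _ | m
  · rw [contrWith_lof_zero, map_zero, evalSeq_lof_of_ne (by omega)]
  · rw [contrWith_lof_succ]
    by_cases h : m = n
    · rw [evalSeq_lof h, evalSeq_lof (by omega), apply_seq_eq_curryLeft]
      rfl
    · rw [evalSeq_lof_of_ne h, evalSeq_lof_of_ne (by omega)]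

/-- The contraction `i_X A = A(X, -)` of total cochains, as a bilinear map. -/
noncomputable def contr : ⋀[K]^2 V →ₗ[K] TotalCochain K V W →ₗ[K] TotalCochain K V W :=
  LinearMap.mk₂ K (fun X A => contrWith X A)
    (fun X Y A => TotalCochain.ext_evalSeq fun n Z => by
      simp only [map_add, evalSeq_contrWith, evalSeq_succ_consSeq, add_apply])
    (fun c X A => TotalCochain.ext_evalSeq fun n Z => by
      simp only [map_smul, evalSeq_contrWith, evalSeq_succ_consSeq, smul_apply])
    (fun X A B => map_add _ A B) (fun c X A => map_smul _ c A)

theorem evalSeq_contr (X : ⋀[K]^2 V) (n : ℕ) (Z : ℕ → ⋀[K]^2 V) (A : TotalCochain K V W) :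
    evalSeq n Z (contr X A) = evalSeq (n + 1) (consSeq X Z) A :=
  evalSeq_contrWith X n Z A

theorem contr_lof_succ (X : ⋀[K]^2 V) (n : ℕ) (P : Cochain K V W (n + 1)) :
    contr X (TotalCochain.lof (n + 1) P) = TotalCochain.lof n (Cochain.contr X n P) :=
  contrWith_lof_succ X n P

theorem contr_lof_zero (X : ⋀[K]^2 V) (P : Cochain K V W 0) :
    contr X (TotalCochain.lof 0 P) = 0 :=
  contrWith_lof_zero X P

attribute [irreducible] contr

/-- The component of degree zero of a total cochain, as a linear map `V → W`. -/
noncomputable def degZero : TotalCochain K V W →ₗ[K] V →ₗ[K] W := evalSeq 0 fun _ => 0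

theorem evalSeq_zero (Z : ℕ → ⋀[K]^2 V) (A : TotalCochain K V W) : evalSeq 0 Z A = degZero A :=
  congrArg (A 0).1 (Subsingleton.elim _ _)

theorem TotalCochain.ext_contr {A B : TotalCochain K V W} (h_zero : degZero A = degZero B)
    (h_contr : ∀ X, contr X A = contr X B) : A = B := by
  refine TotalCochain.ext_evalSeq fun n Z => ?_
  rcases n with _ | n
  · rw [evalSeq_zero, evalSeq_zero, h_zero]
  · rw [← consSeq_head_tail Z, ← evalSeq_contr, ← evalSeq_contr, h_contr]

theorem degZero_lof_zero (P : Cochain K V W 0) :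
    degZero (TotalCochain.lof 0 P) = P.1 Fin.elim0 := by
  rw [degZero, evalSeq_lof rfl]
  exact congrArg P.1 (Subsingleton.elim _ _)

theorem degZero_lof_succ (n : ℕ) (P : Cochain K V W (n + 1)) :
    degZero (TotalCochain.lof (n + 1) P) = 0 :=
  evalSeq_lof_of_ne (by omega) _ _

theorem degZero_ofHom (f : V →ₗ[K] W) : degZero (ofHom f) = f := by
  rw [ofHom, degZero_lof_zero]
  rfl

theorem contr_ofHom (X : ⋀[K]^2 V) (f : V →ₗ[K] W) : contr X (ofHom f) = 0 :=
  contr_lof_zero X _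

theorem TotalCochain.eq_of_contr_comm {V' W' : Type*} [AddCommGroup V'] [Module K V']
    [AddCommGroup W'] [Module K W'] {τ : ⋀[K]^2 V' → ⋀[K]^2 V}
    {F G : TotalCochain K V W → TotalCochain K V' W'}
    (hF : ∀ X A, contr X (F A) = F (contr (τ X) A)) (hG : ∀ X A, contr X (G A) = G (contr (τ X) A))
    (h_zero : ∀ A, degZero (F A) = degZero (G A)) (A : TotalCochain K V W) : F A = G A := by
  refine TotalCochain.ext_evalSeq fun n => ?_
  induction n generalizing A with
  | zero =>
    intro Z
    rw [evalSeq_zero, evalSeq_zero, h_zero]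
  | succ n ih =>
    intro Z
    rw [← consSeq_head_tail Z, ← evalSeq_contr, ← evalSeq_contr, hF, hG, ih]

end Contraction

section Grading
variable {K V W : Type*} [Field K] [AddCommGroup V] [Module K V] [AddCommGroup W] [Module K W]

theorem lof_mem_cochainGrading (n : ℕ) (P : Cochain K V W n) :
    TotalCochain.lof n P ∈ cochainGrading K V W n := by
  intro m hm
  rw [DirectSum.lof_eq_of, DirectSum.of_eq_of_ne]
  exact fun h => hm (by rw [h])

theorem eq_zero_of_mem_cochainGrading_of_neg {d : ℤ} (hd : d < 0) {A : TotalCochain K V W}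
    (hA : A ∈ cochainGrading K V W d) : A = 0 :=
  DFinsupp.ext fun n => hA n (by omega)

theorem exists_eq_lof_of_mem_cochainGrading {n : ℕ} {A : TotalCochain K V W}
    (hA : A ∈ cochainGrading K V W n) : ∃ P : Cochain K V W n, A = TotalCochain.lof n P := by
  refine ⟨A n, DFinsupp.ext fun m => ?_⟩
  by_cases h : m = n
  · subst h
    simp [DirectSum.lof_eq_of]
  · rw [hA m (by omega), DirectSum.lof_eq_of, DirectSum.of_eq_of_ne _ _ _ h]

theorem eq_zero_or_exists_eq_lof {d : ℤ} {A : TotalCochain K V W}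
    (hA : A ∈ cochainGrading K V W d) :
    A = 0 ∨ ∃ (n : ℕ) (P : Cochain K V W n), d = n ∧ A = TotalCochain.lof n P := by
  rcases lt_or_ge d 0 with hd | hd
  · exact .inl (eq_zero_of_mem_cochainGrading_of_neg hd hA)
  · lift d to ℕ using hd
    obtain ⟨P, hP⟩ := exists_eq_lof_of_mem_cochainGrading hA
    exact .inr ⟨d, P, rfl, hP⟩

theorem ofHom_mem_cochainGrading (f : V →ₗ[K] W) : ofHom f ∈ cochainGrading K V W 0 :=
  lof_mem_cochainGrading 0 _

theorem contr_mem_cochainGrading (X : ⋀[K]^2 V) {d : ℤ} {A : TotalCochain K V W}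
    (hA : A ∈ cochainGrading K V W d) : contr X A ∈ cochainGrading K V W (d - 1) := by
  rcases eq_zero_or_exists_eq_lof hA with rfl | ⟨n, P, rfl, rfl⟩
  · rw [map_zero]
    exact zero_mem _
  rcases n with _ | n
  · rw [contr_lof_zero]
    exact zero_mem _
  · rw [contr_lof_succ, Nat.cast_succ, add_sub_cancel_right]
    exact lof_mem_cochainGrading n _

theorem degZero_eq_zero_of_mem_cochainGrading {d : ℤ} (hd : d ≠ 0) {A : TotalCochain K V W}
    (hA : A ∈ cochainGrading K V W d) : degZero A = 0 := by
  rcases eq_zero_or_exists_eq_lof hA with rfl | ⟨n, P, rfl, rfl⟩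
  · exact map_zero _
  rcases n with _ | n
  · exact absurd rfl hd
  · exact degZero_lof_succ n P

end Grading

/-! ### The circle product and the contraction -/

section CircleProduct
variable {K V : Type*} [Field K] [AddCommGroup V] [Module K V]

/-- The circle product on `C*(V, V)`. -/
noncomputable def circProd :
    TotalCochain K V V →ₗ[K] TotalCochain K V V →ₗ[K] TotalCochain K V V :=
  DirectSum.toModule K ℕ _ fun p => LinearMap.flip <| DirectSum.toModule K ℕ _ fun q =>
    LinearMap.flip <| (circC p q).compr₂ (TotalCochain.lof (p + q))

/-- The derivation of `∧²V` induced by the component of degree zero of a cochain. -/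
noncomputable def actWedge : TotalCochain K V V →ₗ[K] (⋀[K]^2 V →ₗ[K] ⋀[K]^2 V) :=
  wedgeDer ∘ₗ degZero

theorem actWedge_apply (A : TotalCochain K V V) : actWedge A = wedgeDer (degZero A) := rfl

theorem circProd_lof (p q : ℕ) (P : Cochain K V V p) (Q : Cochain K V V q) :
    circProd (TotalCochain.lof p P) (TotalCochain.lof q Q) =
      TotalCochain.lof (p + q) (circC p q P Q) := by
  simp [circProd]

attribute [irreducible] circProd

theorem evalSeq_circProd_lof {p q n : ℕ} (h : p + q = n) (Z : ℕ → ⋀[K]^2 V)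
    (P : Cochain K V V p) (Q : Cochain K V V q) :
    evalSeq n Z (circProd (TotalCochain.lof p P) (TotalCochain.lof q Q)) =
      circ P.1 Q.1 fun j : Fin (p + q) => Z j := by
  rw [circProd_lof, evalSeq_lof h]
  rfl

theorem evalSeq_circProd_lof_of_ne {p q n : ℕ} (h : p + q ≠ n) (Z : ℕ → ⋀[K]^2 V)
    (P : Cochain K V V p) (Q : Cochain K V V q) :
    evalSeq n Z (circProd (TotalCochain.lof p P) (TotalCochain.lof q Q)) = 0 := by
  rw [circProd_lof, evalSeq_lof_of_ne h]

theorem degZero_circProd_lof (p q : ℕ) (P : Cochain K V V p) (Q : Cochain K V V q) :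
    degZero (circProd (TotalCochain.lof p P) (TotalCochain.lof q Q)) =
      degZero (TotalCochain.lof p P) ∘ₗ degZero (TotalCochain.lof q Q) := by
  rcases p with _ | p
  · rcases q with _ | q
    · rw [degZero_lof_zero, degZero_lof_zero, degZero, evalSeq_circProd_lof (by omega)]
      exact circ_zero_zero _ _ _
    · rw [degZero_lof_succ q Q, LinearMap.comp_zero]
      exact evalSeq_circProd_lof_of_ne (by omega) _ _ _
  · rw [degZero_lof_succ p P, LinearMap.zero_comp]
    exact evalSeq_circProd_lof_of_ne (by omega) _ _ _

theorem degZero_circProd (A B : TotalCochain K V V) :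
    degZero (circProd A B) = degZero A ∘ₗ degZero B := by
  suffices h : circProd.compr₂ degZero =
      (LinearMap.llcomp K V V V).compl₁₂ degZero degZero from
    LinearMap.congr_fun₂ h A B
  refine TotalCochain.linearMap_ext fun p P => TotalCochain.linearMap_ext fun q Q => ?_
  exact degZero_circProd_lof p q P Q

theorem contr_circProd_lof_zero (X : ⋀[K]^2 V) (q : ℕ) (P : Cochain K V V 0)
    (Q : Cochain K V V q) :
    contr X (circProd (TotalCochain.lof 0 P) (TotalCochain.lof q Q)) =
      circProd (TotalCochain.lof 0 P) (contr X (TotalCochain.lof q Q)) := by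
  refine TotalCochain.ext_evalSeq fun n Z => ?_
  rw [evalSeq_contr]
  rcases q with _ | q
  · rw [contr_lof_zero, map_zero, map_zero, evalSeq_circProd_lof_of_ne (by omega)]
  · rw [contr_lof_succ]
    by_cases h : 0 + q = n
    · rw [evalSeq_circProd_lof (by omega), evalSeq_circProd_lof h]
      exact circ_zero_succ P.1 Q.1 (consSeq X Z)
    · rw [evalSeq_circProd_lof_of_ne (by omega), evalSeq_circProd_lof_of_ne h]

theorem contr_circProd_lof_succ_zero (X : ⋀[K]^2 V) (p : ℕ) (P : Cochain K V V (p + 1))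
    (Q : Cochain K V V 0) :
    contr X (circProd (TotalCochain.lof (p + 1) P) (TotalCochain.lof 0 Q)) =
      circProd (contr X (TotalCochain.lof (p + 1) P)) (TotalCochain.lof 0 Q) +
        contr (wedgeDer (Q.1 Fin.elim0) X) (TotalCochain.lof (p + 1) P) := by
  refine TotalCochain.ext_evalSeq fun n Z => ?_
  rw [evalSeq_contr, map_add, contr_lof_succ X, contr_lof_succ (wedgeDer _ X)]
  by_cases h : p = n
  · rw [evalSeq_circProd_lof (by omega), evalSeq_circProd_lof (by omega), evalSeq_lof h]
    exact circ_succ_zero P.1 Q.1 (consSeq X Z)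
  · rw [evalSeq_circProd_lof_of_ne (by omega), evalSeq_circProd_lof_of_ne (by omega),
      evalSeq_lof_of_ne h, add_zero]

theorem contr_circProd_lof_succ_succ (X : ⋀[K]^2 V) (p q : ℕ) (P : Cochain K V V (p + 1))
    (Q : Cochain K V V (q + 1)) :
    contr X (circProd (TotalCochain.lof (p + 1) P) (TotalCochain.lof (q + 1) Q)) =
      (-1 : K) ^ (q + 1) •
          circProd (contr X (TotalCochain.lof (p + 1) P)) (TotalCochain.lof (q + 1) Q) +
        circProd (TotalCochain.lof (p + 1) P) (contr X (TotalCochain.lof (q + 1) Q)) := by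
  refine TotalCochain.ext_evalSeq fun n Z => ?_
  rw [evalSeq_contr, map_add, map_smul, contr_lof_succ X p, contr_lof_succ X q]
  by_cases h : p + 1 + q = n
  · rw [evalSeq_circProd_lof (show p + 1 + (q + 1) = n + 1 by omega),
      evalSeq_circProd_lof (show p + (q + 1) = n by omega), evalSeq_circProd_lof h]
    exact circ_succ_succ P.1 Q.1 (consSeq X Z)
  · rw [evalSeq_circProd_lof_of_ne (show p + 1 + (q + 1) ≠ n + 1 by omega),
      evalSeq_circProd_lof_of_ne (show p + (q + 1) ≠ n by omega), evalSeq_circProd_lof_of_ne h,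
      smul_zero, add_zero]

theorem contr_circProd_lof (X : ⋀[K]^2 V) (p q : ℕ) (P : Cochain K V V p) (Q : Cochain K V V q) :
    contr X (circProd (TotalCochain.lof p P) (TotalCochain.lof q Q)) =
      (-1 : K) ^ q • circProd (contr X (TotalCochain.lof p P)) (TotalCochain.lof q Q) +
        circProd (TotalCochain.lof p P) (contr X (TotalCochain.lof q Q)) +
        contr (actWedge (TotalCochain.lof q Q) X) (TotalCochain.lof p P) := by
  rcases p with _ | p
  · simp only [contr_circProd_lof_zero, contr_lof_zero X P, contr_lof_zero _ P, map_zero,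
      LinearMap.zero_apply, smul_zero, zero_add, add_zero]
  rcases q with _ | q
  · refine (contr_circProd_lof_succ_zero X p P Q).trans ?_
    simp only [contr_lof_zero X Q, map_zero, pow_zero, one_smul, add_zero,
      actWedge_apply, degZero_lof_zero]
  · refine (contr_circProd_lof_succ_succ X p q P Q).trans ?_
    simp only [actWedge_apply, degZero_lof_succ, map_zero, LinearMap.zero_apply, add_zero]

theorem contr_circProd (X : ⋀[K]^2 V) (A : TotalCochain K V V) {q : ℤ} {B : TotalCochain K V V}
    (hB : B ∈ cochainGrading K V V q) :
    contr X (circProd A B) = (-1 : K) ^ q • circProd (contr X A) B + circProd A (contr X B) +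
      contr (actWedge B X) A := by
  rcases eq_zero_or_exists_eq_lof hB with rfl | ⟨q, Q, rfl, rfl⟩
  · simp only [map_zero, LinearMap.zero_apply, smul_zero, add_zero]
  rw [zpow_natCast]
  induction A using DirectSum.induction_on with
  | zero => simp only [map_zero, LinearMap.zero_apply, smul_zero, add_zero]
  | of p P => exact contr_circProd_lof X p q P Q
  | add A A' hA hA' =>
    simp only [map_add, LinearMap.add_apply, hA, hA', smul_add]
    abel

theorem circProd_mem_cochainGrading {p q : ℤ} {A B : TotalCochain K V V}
    (hA : A ∈ cochainGrading K V V p) (hB : B ∈ cochainGrading K V V q) :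
    circProd A B ∈ cochainGrading K V V (p + q) := by
  rcases eq_zero_or_exists_eq_lof hA with rfl | ⟨p, P, rfl, rfl⟩
  · rw [map_zero, LinearMap.zero_apply]
    exact zero_mem _
  rcases eq_zero_or_exists_eq_lof hB with rfl | ⟨q, Q, rfl, rfl⟩
  · rw [map_zero]
    exact zero_mem _
  rw [circProd_lof]
  exact_mod_cast lof_mem_cochainGrading (p + q) _

theorem nrBracket_eq {p q : ℤ} {A B : TotalCochain K V V} (hA : A ∈ cochainGrading K V V p)
    (hB : B ∈ cochainGrading K V V q) :
    nrBracket A B = circProd A B - (-1 : K) ^ (p * q) • circProd B A := by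
  rcases eq_zero_or_exists_eq_lof hA with rfl | ⟨p, P, rfl, rfl⟩
  · simp only [map_zero, LinearMap.zero_apply, smul_zero, sub_zero]
  rcases eq_zero_or_exists_eq_lof hB with rfl | ⟨q, Q, rfl, rfl⟩
  · simp only [map_zero, LinearMap.zero_apply, smul_zero, sub_zero]
  rw [circProd_lof, circProd_lof, nrBracket_lof, ← Nat.cast_mul, zpow_natCast]

end CircleProduct

/-! ### From contractions to graded Lie algebras -/

section ContractionAlgebra
variable {K T L E : Type*} [Field K] [AddCommGroup T] [Module K T] [AddCommGroup L] [Module K L]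
  [AddCommGroup E] [Module K E]

/-- The associator `(x y) z - x (y z)` of a bilinear product `m`. -/
def bilinAssociator (m : T →ₗ[K] T →ₗ[K] T) (x y z : T) : T :=
  m (m x y) z - m x (m y z)

/-- A graded vector space with a product `m` of degree `0` that is determined by contractions
`i X` of degree `-1`: the product satisfies the Leibniz rule for `i X` up to the term `i (a y X) x`,
where only the component of degree zero of `y` acts on the parameters `X` by `a`. The map `c`
remembers what is lost by all contractions (for cochains, the component of degree zero). -/
structure IsContractionAlgebra (𝒯 : ℤ → Submodule K T) (m : T →ₗ[K] T →ₗ[K] T)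
    (i : L →ₗ[K] T →ₗ[K] T) (a : T →ₗ[K] L →ₗ[K] L) (c : T →ₗ[K] E) : Prop where
  eq_zero_of_neg : ∀ {d : ℤ} {x}, d < 0 → x ∈ 𝒯 d → x = 0
  mul_mem : ∀ {p q x y}, x ∈ 𝒯 p → y ∈ 𝒯 q → m x y ∈ 𝒯 (p + q)
  contr_mem : ∀ {p x} X, x ∈ 𝒯 p → i X x ∈ 𝒯 (p - 1)
  act_eq_zero : ∀ {p x}, p ≠ 0 → x ∈ 𝒯 p → a x = 0
  contr_mul : ∀ X x {q y}, y ∈ 𝒯 q →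
    i X (m x y) = (-1 : K) ^ q • m (i X x) y + m x (i X y) + i (a y X) x
  act_symm : ∀ x y X, a x (a y X) - a (m x y) X = a y (a x X) - a (m y x) X
  ext : ∀ {x}, c x = 0 → (∀ X, i X x = 0) → x = 0
  assoc_zero : ∀ x y z, c (bilinAssociator m x y z) = 0

namespace IsContractionAlgebra
variable {𝒯 : ℤ → Submodule K T} {m : T →ₗ[K] T →ₗ[K] T} {i : L →ₗ[K] T →ₗ[K] T}
  {a : T →ₗ[K] L →ₗ[K] L} {c : T →ₗ[K] E}

theorem contr_eq_zero (h : IsContractionAlgebra 𝒯 m i a c) {x : T} (hx : x ∈ 𝒯 0) (X : L) :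
    i X x = 0 :=
  h.eq_zero_of_neg (by norm_num) (h.contr_mem X hx)

theorem contr_associator (h : IsContractionAlgebra 𝒯 m i a c) {q r : ℤ} (x : T) {y z : T}
    (hy : y ∈ 𝒯 q) (hz : z ∈ 𝒯 r) (X : L) :
    i X (bilinAssociator m x y z) =
      ((-1 : K) ^ q * (-1) ^ r) • bilinAssociator m (i X x) y z +
      (-1 : K) ^ r • bilinAssociator m x (i X y) z + bilinAssociator m x y (i X z) +
      ((-1 : K) ^ r • m (i (a y X) x) z + (-1 : K) ^ q • m (i (a z X) x) y +
        i (a y (a z X) - a (m y z) X) x) := by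
  rw [bilinAssociator, map_sub, h.contr_mul X _ hz, h.contr_mul X x (h.mul_mem hy hz),
    h.contr_mul X x hy, h.contr_mul X y hz, h.contr_mul (a z X) x hy, neg_one_zpow_add]
  simp only [bilinAssociator, map_add, map_smul, LinearMap.add_apply, LinearMap.smul_apply,
    map_sub, LinearMap.sub_apply]
  module

theorem contr_associator_correction_swap (h : IsContractionAlgebra 𝒯 m i a c) {q r : ℤ}
    (hq : 0 ≤ q) (hr : 0 ≤ r) (x : T) {y z : T} (hy : y ∈ 𝒯 q) (hz : z ∈ 𝒯 r) (X : L) :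
    (-1 : K) ^ r • m (i (a y X) x) z + (-1 : K) ^ q • m (i (a z X) x) y +
        i (a y (a z X) - a (m y z) X) x =
      (-1 : K) ^ (q * r) • ((-1 : K) ^ q • m (i (a z X) x) y +
        (-1 : K) ^ r • m (i (a y X) x) z + i (a z (a y X) - a (m z y) X) x) := by
  rcases Int.even_or_odd (q * r) with heven | hodd
  · rw [heven.neg_one_zpow, one_smul, h.act_symm,
      add_comm ((-1 : K) ^ r • _) ((-1 : K) ^ q • _)]
  · -- Both degrees are odd, hence positive, so nothing acts on the parameters.
    obtain ⟨hq_odd, hr_odd⟩ := Int.odd_mul.1 hodd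
    have hq_ne : q ≠ 0 := by rintro rfl; simp at hq_odd
    have hr_ne : r ≠ 0 := by rintro rfl; simp at hr_odd
    simp [h.act_eq_zero hq_ne hy, h.act_eq_zero hr_ne hz,
      h.act_eq_zero (by omega) (h.mul_mem hy hz), h.act_eq_zero (by omega) (h.mul_mem hz hy)]

/-- The graded right pre-Lie identity. -/
theorem bilinAssociator_swap (h : IsContractionAlgebra 𝒯 m i a c) {p q r : ℤ} {x y z : T}
    (hx : x ∈ 𝒯 p) (hy : y ∈ 𝒯 q) (hz : z ∈ 𝒯 r) :
    bilinAssociator m x y z = (-1 : K) ^ (q * r) • bilinAssociator m x z y := by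
  obtain ⟨n, hn⟩ : ∃ n : ℕ, p + q + r < n := ⟨(p + q + r).toNat + 1, by omega⟩
  induction n generalizing p q r x y z with
  | zero =>
    have : p < 0 ∨ q < 0 ∨ r < 0 := by push_cast at hn; omega
    rcases this with hp | hq | hr
    · simp [h.eq_zero_of_neg hp hx, bilinAssociator]
    · simp [h.eq_zero_of_neg hq hy, bilinAssociator]
    · simp [h.eq_zero_of_neg hr hz, bilinAssociator]
  | succ n ih =>
    push_cast at hn
    rcases lt_or_ge q 0 with hq | hq
    · simp [h.eq_zero_of_neg hq hy, bilinAssociator]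
    rcases lt_or_ge r 0 with hr | hr
    · simp [h.eq_zero_of_neg hr hz, bilinAssociator]
    refine sub_eq_zero.1 (h.ext ?_ fun X => ?_)
    · rw [map_sub, map_smul, h.assoc_zero, h.assoc_zero, smul_zero, sub_zero]
    have hX := ih (h.contr_mem X hx) hy hz (by omega)
    have hY := ih hx (h.contr_mem X hy) hz (by omega)
    have hZ := ih hx hy (h.contr_mem X hz) (by omega)
    have hq_sign : (-1 : K) ^ ((q - 1) * r) = (-1) ^ (q * r) * (-1) ^ r := by
      rw [← neg_one_zpow_add]
      exact neg_one_zpow_eq_of_even_add ⟨q * r, by ring⟩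
    have hr_sign : (-1 : K) ^ (q * (r - 1)) = (-1) ^ (q * r) * (-1) ^ q := by
      rw [← neg_one_zpow_add]
      exact neg_one_zpow_eq_of_even_add ⟨q * r, by ring⟩
    rw [hq_sign] at hY
    rw [hr_sign] at hZ
    rw [map_sub, sub_eq_zero, map_smul, h.contr_associator x hy hz, h.contr_associator x hz hy,
      h.contr_associator_correction_swap hq hr x hy hz X, hX, hY, hZ, smul_add, smul_add]
    linear_combination (norm := module)
      ((-1 : K) ^ (q * r) * neg_one_zpow_sq (K := K) r) • bilinAssociator m x z (i X y)

end IsContractionAlgebra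
end ContractionAlgebra

section GradedLie
variable {K T : Type*} [Field K] [AddCommGroup T] [Module K T]

/-- The laws of a graded Lie algebra, in terms of homogeneous elements. -/
structure IsGradedLie (𝒯 : ℤ → Submodule K T) (B : T →ₗ[K] T →ₗ[K] T) : Prop where
  bracket_mem : ∀ {p q x y}, x ∈ 𝒯 p → y ∈ 𝒯 q → B x y ∈ 𝒯 (p + q)
  skew : ∀ {p q x y}, x ∈ 𝒯 p → y ∈ 𝒯 q → B x y = -(-1 : K) ^ (p * q) • B y x
  jacobi : ∀ {p q r x y z}, x ∈ 𝒯 p → y ∈ 𝒯 q → z ∈ 𝒯 r →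
    B (B x y) z = B x (B y z) + (-1 : K) ^ (q * r) • B (B x z) y

theorem IsGradedLie.leibniz_zero {𝒯 : ℤ → Submodule K T} {B : T →ₗ[K] T →ₗ[K] T}
    (h : IsGradedLie 𝒯 B) (hT : ⨆ d, 𝒯 d = ⊤) {e : T} (he : e ∈ 𝒯 0) (x y : T) :
    B (B x y) e = B x (B y e) + B (B x e) y := by
  induction (hT ▸ Submodule.mem_top : x ∈ ⨆ d, 𝒯 d) using Submodule.iSup_induction' with
  | zero => simp only [map_zero, LinearMap.zero_apply, add_zero]
  | add x x' _ _ hx hx' =>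
    simp only [map_add, LinearMap.add_apply, hx, hx']
    abel
  | mem p x hx =>
    induction (hT ▸ Submodule.mem_top : y ∈ ⨆ d, 𝒯 d) using Submodule.iSup_induction' with
    | zero => simp only [map_zero, LinearMap.zero_apply, add_zero]
    | add y y' _ _ hy hy' =>
      simp only [map_add, LinearMap.add_apply, hy, hy']
      abel
    | mem q y hy => rw [h.jacobi hx hy he, mul_zero, zpow_zero, one_smul]

end GradedLie

namespace IsContractionAlgebra
variable {K T L E : Type*} [Field K] [AddCommGroup T] [Module K T] [AddCommGroup L] [Module K L]
  [AddCommGroup E] [Module K E] {𝒯 : ℤ → Submodule K T} {m B : T →ₗ[K] T →ₗ[K] T}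
  {i : L →ₗ[K] T →ₗ[K] T} {a : T →ₗ[K] L →ₗ[K] L} {c : T →ₗ[K] E}

theorem isGradedLie (h : IsContractionAlgebra 𝒯 m i a c)
    (hB : ∀ {p q x y}, x ∈ 𝒯 p → y ∈ 𝒯 q → B x y = m x y - (-1 : K) ^ (p * q) • m y x) :
    IsGradedLie 𝒯 B := by
  have hmem {p q x y} (hx : x ∈ 𝒯 p) (hy : y ∈ 𝒯 q) : B x y ∈ 𝒯 (p + q) := by
    rw [hB hx hy]
    exact sub_mem (h.mul_mem hx hy)
      (Submodule.smul_mem _ _ (add_comm q p ▸ h.mul_mem hy hx))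
  refine ⟨hmem, fun {p q x y} hx hy => ?_, fun {p q r x y z} hx hy hz => ?_⟩
  · rw [hB hx hy, hB hy hx, mul_comm q p]
    linear_combination (norm := module) -(neg_one_zpow_sq (K := K) (p * q) • m x y)
  · have hxyz := h.bilinAssociator_swap hx hy hz
    have hyxz := h.bilinAssociator_swap hy hx hz
    have hzxy := h.bilinAssociator_swap hz hx hy
    have hsq := neg_one_zpow_sq (K := K) (q * r)
    rw [hB (hmem hx hy) hz, hB hx (hmem hy hz), hB (hmem hx hz) hy, hB hx hy, hB hy hz, hB hx hz]
    simp only [bilinAssociator, map_sub, map_smul, LinearMap.sub_apply, LinearMap.smul_apply,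
      add_mul, mul_add, neg_one_zpow_add] at hxyz hyxz hzxy ⊢
    rw [mul_comm r q]
    generalize (-1 : K) ^ (p * q) = sxy, (-1 : K) ^ (q * r) = syz, (-1 : K) ^ (p * r) = sxz at *
    linear_combination (norm := module) hxyz - sxy • hyxz + (syz * sxz) • hzxy +
      hsq • (sxy • (m y (m x z) - sxz • m y (m z x)))

theorem contr_bracket_zero (h : IsContractionAlgebra 𝒯 m i a c)
    (hB : ∀ {p q x y}, x ∈ 𝒯 p → y ∈ 𝒯 q → B x y = m x y - (-1 : K) ^ (p * q) • m y x)
    (X : L) {d : ℤ} {x e : T} (hx : x ∈ 𝒯 d) (he : e ∈ 𝒯 0) :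
    i X (B x e) = B (i X x) e + i (a e X) x := by
  rw [hB hx he, hB (h.contr_mem X hx) he, map_sub, map_smul, h.contr_mul X x he,
    h.contr_mul X e hx, h.contr_eq_zero he, h.contr_eq_zero he, mul_zero, mul_zero, zpow_zero]
  simp only [map_zero, LinearMap.zero_apply, smul_zero, one_smul, add_zero, zero_add]
  abel

end IsContractionAlgebra

/-! ### Higher derived brackets -/

section NestedBracket
variable {K T A : Type*} [Field K] [AddCommGroup T] [Module K T] [AddCommGroup A] [Module K A]
  {𝒯 : ℤ → Submodule K T} {B : T →ₗ[K] T →ₗ[K] T} {𝒜 : ℤ → Submodule K A} {ι : A →ₗ[K] T}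
  {P : T →ₗ[K] A}

/-- Voronov's data for higher derived brackets: a graded Lie algebra, an abelian subalgebra and a
projection onto it whose kernel is a subalgebra. -/
structure IsVoronovData (𝒯 : ℤ → Submodule K T) (B : T →ₗ[K] T →ₗ[K] T) (𝒜 : ℤ → Submodule K A)
    (ι : A →ₗ[K] T) (P : T →ₗ[K] A) : Prop extends IsGradedLie 𝒯 B where
  incl_mem : ∀ {d a}, a ∈ 𝒜 d → ι a ∈ 𝒯 d
  proj_mem : ∀ {d x}, x ∈ 𝒯 d → P x ∈ 𝒜 d
  proj_incl : ∀ a, P (ι a) = a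
  abelian : ∀ {p q a b}, a ∈ 𝒜 p → b ∈ 𝒜 q → B (ι a) (ι b) = 0
  ker_bracket : ∀ {p q x y}, x ∈ 𝒯 p → y ∈ 𝒯 q → P x = 0 → P y = 0 → P (B x y) = 0

/-- The nested bracket `[⋯[[Y, x₀], x₁], ⋯, x_{n-1}]`. The arguments form an infinite sequence, of
which only the first `n` terms matter. -/
def nestedBracket (B : T →ₗ[K] T →ₗ[K] T) (ι : A →ₗ[K] T) : ℕ → (ℕ → A) → T →ₗ[K] T
  | 0, _ => LinearMap.id
  | n + 1, x => nestedBracket B ι n (fun j => x (j + 1)) ∘ₗ B.flip (ι (x 0))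

theorem nestedBracket_zero (x : ℕ → A) (Y : T) : nestedBracket B ι 0 x Y = Y := rfl

theorem nestedBracket_succ (n : ℕ) (x : ℕ → A) (Y : T) :
    nestedBracket B ι (n + 1) x Y = nestedBracket B ι n (fun j => x (j + 1)) (B Y (ι (x 0))) :=
  rfl

theorem nestedBracket_congr {n : ℕ} {x x' : ℕ → A} (h : ∀ j < n, x j = x' j) (Y : T) :
    nestedBracket B ι n x Y = nestedBracket B ι n x' Y := by
  induction n generalizing x x' Y with
  | zero => rfl
  | succ n ih =>
    rw [nestedBracket_succ, nestedBracket_succ, h 0 (by omega),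
      ih fun j hj => h (j + 1) (by omega)]

theorem nestedBracket_succ' (n : ℕ) (x : ℕ → A) (Y : T) :
    nestedBracket B ι (n + 1) x Y = B (nestedBracket B ι n x Y) (ι (x n)) := by
  induction n generalizing x Y with
  | zero => rfl
  | succ n ih => rw [nestedBracket_succ, ih, nestedBracket_succ]

namespace IsVoronovData

theorem proj_bracket (h : IsVoronovData 𝒯 B 𝒜 ι P) {p q : ℤ} {x y : T} (hx : x ∈ 𝒯 p)
    (hy : y ∈ 𝒯 q) : P (B x y) = P (B x (ι (P y))) + P (B (ι (P x)) y) := by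
  have h_sub (z : T) : P (z - ι (P z)) = 0 := by rw [map_sub, h.proj_incl, sub_self]
  have h_ker := h.ker_bracket (sub_mem hx (h.incl_mem (h.proj_mem hx)))
    (sub_mem hy (h.incl_mem (h.proj_mem hy))) (h_sub x) (h_sub y)
  have h_abelian := h.abelian (h.proj_mem hx) (h.proj_mem hy)
  simp only [map_sub, LinearMap.sub_apply, h_abelian, sub_zero] at h_ker
  linear_combination (norm := module) h_ker

theorem bracket_incl_comm (h : IsVoronovData 𝒯 B 𝒜 ι P) {y p q : ℤ} {Y : T} {a b : A}
    (hY : Y ∈ 𝒯 y) (ha : a ∈ 𝒜 p) (hb : b ∈ 𝒜 q) :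
    B (B Y (ι a)) (ι b) = (-1 : K) ^ (p * q) • B (B Y (ι b)) (ι a) := by
  rw [h.jacobi hY (h.incl_mem ha) (h.incl_mem hb), h.abelian ha hb, map_zero, zero_add]

theorem nestedBracket_mem (h : IsVoronovData 𝒯 B 𝒜 ι P) {y : ℤ} {Y : T} (hY : Y ∈ 𝒯 y)
    {d : ℕ → ℤ} {x : ℕ → A} (hx : ∀ j, x j ∈ 𝒜 (d j)) (n : ℕ) :
    nestedBracket B ι n x Y ∈ 𝒯 (y + ∑ j ∈ Finset.range n, d j) := by
  induction n with
  | zero => simpa [nestedBracket_zero] using hY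
  | succ n ih =>
    rw [nestedBracket_succ', Finset.sum_range_succ, ← add_assoc]
    exact h.bracket_mem ih (h.incl_mem (hx n))

theorem nestedBracket_insertZero (h : IsVoronovData 𝒯 B 𝒜 ι P) {d : ℕ → ℤ} {x : ℕ → A}
    (hx : ∀ j, x j ∈ 𝒜 (d j)) {p n : ℕ} (hp : p ≤ n) {y : ℤ} {Y : T} (hY : Y ∈ 𝒯 y)
    (s : ℕ → ℕ) :
    nestedBracket B ι (n + 1) (fun j => x (insertZero p s j)) Y =
      (-1 : K) ^ (d 0 * ∑ j ∈ Finset.range p, d (s j + 1)) •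
        nestedBracket B ι n (fun j => x (s j + 1)) (B Y (ι (x 0))) := by
  induction p generalizing n y Y s with
  | zero =>
    simp only [nestedBracket_succ, insertZero_zero_succ, insertZero_self, Finset.range_zero,
      Finset.sum_empty, mul_zero, zpow_zero, one_smul]
  | succ p ih =>
    obtain ⟨n, rfl⟩ : ∃ k, n = k + 1 := ⟨n - 1, by omega⟩
    have h_tail (j : ℕ) :
        insertZero (p + 1) s (j + 1) = insertZero p (fun a => s (a + 1)) j := by
      rcases lt_trichotomy j p with hj | rfl | hj
      · rw [insertZero_of_lt _ (by omega), insertZero_of_lt _ hj]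
      · rw [insertZero_self, insertZero_self]
      · obtain ⟨k, rfl⟩ : ∃ k, j = k + 1 := ⟨j - 1, by omega⟩
        rw [insertZero_of_le _ (by omega), insertZero_of_le _ (by omega)]
    rw [nestedBracket_succ]
    simp only [h_tail, insertZero_of_lt s p.succ_pos]
    rw [ih (by omega) (h.bracket_mem hY (h.incl_mem (hx _))), nestedBracket_succ,
      h.bracket_incl_comm hY (hx _) (hx 0), map_smul, smul_smul, ← neg_one_zpow_add,
      Finset.sum_range_succ', mul_add, mul_comm (d (s 0 + 1))]

theorem nestedBracket_perm (h : IsVoronovData 𝒯 B 𝒜 ι P) {d : ℕ → ℤ} {x : ℕ → A}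
    (hx : ∀ j, x j ∈ 𝒜 (d j)) {n : ℕ} {y : ℤ} {Y : T} (hY : Y ∈ 𝒯 y) (σ : Equiv.Perm (Fin n)) :
    nestedBracket B ι n (fun j => x (extendPerm σ j)) Y =
      ((koszulSign (fun a : Fin n => d a) σ : ℤ) : K) • nestedBracket B ι n x Y := by
  induction n generalizing d x y Y with
  | zero => simp [koszulSign, nestedBracket_zero]
  | succ n ih =>
    obtain ⟨⟨p, τ⟩, rfl⟩ := (insertZeroPerm_bijective n).surjective σ
    have h_rest := ih (fun j => hx (j + 1)) (h.bracket_mem hY (h.incl_mem (hx 0))) τ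
    simp only
    rw [extendPerm_insertZeroPerm, h.nestedBracket_insertZero hx (by omega) hY,
      koszulSign_insertZeroPerm_cast, mul_comm (Int.cast _), mul_smul, nestedBracket_succ, h_rest]

end IsVoronovData

/-- The sum `∑ ε(σ) P[Y, P[X, x_{σ(1)}, …, x_{σ(i)}], x_{σ(i+1)}, …, x_{σ(n)}]` over all
`(i, n - i)`-shuffles `σ` with `i = 0, …, n`; here `[Y, a, b, …]` stands for `[⋯[[Y, a], b], ⋯]`. -/
noncomputable def jacobiSum (B : T →ₗ[K] T →ₗ[K] T) (ι : A →ₗ[K] T) (P : T →ₗ[K] A) (n : ℕ)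
    (d : ℕ → ℤ) (x : ℕ → A) (Y X : T) : A :=
  ∑ i ∈ Finset.range (n + 1), shuffleSum K d i n fun s =>
    P (nestedBracket B ι (n - i) (fun t => x (s (i + t)))
      (B Y (ι (P (nestedBracket B ι i (fun j => x (s j)) X)))))

namespace IsVoronovData

theorem jacobiSum_succ (h : IsVoronovData 𝒯 B 𝒜 ι P) {d : ℕ → ℤ} {x : ℕ → A}
    (hx : ∀ j, x j ∈ 𝒜 (d j)) (n : ℕ) {y u : ℤ} {Y X : T} (hY : Y ∈ 𝒯 y) (hX : X ∈ 𝒯 u) :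
    jacobiSum B ι P (n + 1) d x Y X =
      jacobiSum B ι P n (fun j => d (j + 1)) (fun j => x (j + 1)) Y (B X (ι (x 0))) +
      (-1 : K) ^ (d 0 * u) •
        jacobiSum B ι P n (fun j => d (j + 1)) (fun j => x (j + 1)) (B Y (ι (x 0))) X := by
  rw [jacobiSum, sum_shuffleSum_succ]
  congr 1
  · refine Finset.sum_congr rfl fun i _ => ?_
    have h_shift (s : ℕ → ℕ) (t : ℕ) : insertZero 0 s (i + 1 + t) = s (i + t) + 1 := by
      rw [add_right_comm, insertZero_zero_succ]
    simp only [nestedBracket_succ, h_shift, insertZero_zero_succ, insertZero_self,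
      Nat.add_sub_add_right]
  · rw [jacobiSum, Finset.smul_sum]
    refine Finset.sum_congr rfl fun i hi => ?_
    rw [← shuffleSum_smul]
    congr 1
    ext1 s
    have h_inner : nestedBracket B ι i (fun j => x (insertZero i s j)) X =
        nestedBracket B ι i (fun j => x (s j + 1)) X :=
      nestedBracket_congr (fun j hj => by rw [insertZero_of_lt s hj]) X
    have h_outer (t : ℕ) : insertZero i s (i + (t + 1)) = s (i + t) + 1 := by
      rw [← add_assoc, insertZero_of_le s (by omega)]
    have h_sign : (-1 : K) ^ (d 0 * ∑ j ∈ Finset.range i, d (s j + 1)) *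
        (-1) ^ ((u + ∑ j ∈ Finset.range i, d (s j + 1)) * d 0) = (-1) ^ (d 0 * u) := by
      rw [← neg_one_zpow_add]
      exact neg_one_zpow_eq_of_even_add
        ⟨d 0 * u + d 0 * ∑ j ∈ Finset.range i, d (s j + 1), by ring⟩
    have h_mem := h.proj_mem (h.nestedBracket_mem hX (fun j => hx (s j + 1)) i)
    rw [h_inner, Nat.sub_add_comm (Finset.mem_range_succ_iff.1 hi), nestedBracket_succ, add_zero,
      insertZero_self]
    simp only [h_outer]
    rw [h.bracket_incl_comm hY h_mem (hx 0), map_smul, map_smul, smul_smul, h_sign]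

theorem proj_nestedBracket_bracket (h : IsVoronovData 𝒯 B 𝒜 ι P) {d : ℕ → ℤ} {x : ℕ → A}
    (hx : ∀ j, x j ∈ 𝒜 (d j)) (n : ℕ) {y u : ℤ} {Y X : T} (hY : Y ∈ 𝒯 y) (hX : X ∈ 𝒯 u) :
    P (nestedBracket B ι n x (B Y X)) =
      jacobiSum B ι P n d x Y X - (-1 : K) ^ (y * u) • jacobiSum B ι P n d x X Y := by
  induction n generalizing d x y u Y X with
  | zero =>
    simp only [jacobiSum, zero_add, Finset.sum_range_one, shuffleSum_size_zero,
      nestedBracket_zero]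
    rw [h.proj_bracket hY hX, h.skew (h.incl_mem (h.proj_mem hY)) hX, neg_smul, map_neg, map_smul,
      sub_eq_add_neg]
    rfl
  | succ n ih =>
    have hx0 := h.incl_mem (hx 0)
    rw [nestedBracket_succ, h.jacobi hY hX hx0, map_add, map_add, map_smul, map_smul,
      ih (fun j => hx (j + 1)) hY (h.bracket_mem hX hx0),
      ih (fun j => hx (j + 1)) (h.bracket_mem hY hx0) hX,
      h.jacobiSum_succ hx n hY hX, h.jacobiSum_succ hx n hX hY]
    simp only [mul_add, add_mul, neg_one_zpow_add]
    rw [mul_comm u (d 0), mul_comm y (d 0)]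
    linear_combination (norm := module)
      -(((-1 : K) ^ (y * u) * neg_one_zpow_sq (K := K) (d 0 * u)) •
        jacobiSum B ι P n (fun j => d (j + 1)) (fun j => x (j + 1)) X (B Y (ι (x 0))))

theorem jacobiSum_eq_zero [CharZero K] (h : IsVoronovData 𝒯 B 𝒜 ι P) {d : ℕ → ℤ} {x : ℕ → A}
    (hx : ∀ j, x j ∈ 𝒜 (d j)) (n : ℕ) {Δ : T} (hΔ : Δ ∈ 𝒯 1) (hΔΔ : B Δ Δ = 0) :
    jacobiSum B ι P n d x Δ Δ = 0 := by
  have h_double := h.proj_nestedBracket_bracket hx n hΔ hΔ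
  rw [hΔΔ, map_zero, map_zero, mul_one, zpow_one, neg_smul, one_smul, sub_neg_eq_add,
    ← two_smul K] at h_double
  exact (smul_eq_zero.1 h_double.symm).resolve_left two_ne_zero

end IsVoronovData

end NestedBracket

section DerivedLInfinity
variable {K T A : Type*} [Field K] [AddCommGroup T] [Module K T] [AddCommGroup A] [Module K A]
  {𝒯 : ℤ → Submodule K T} {B : T →ₗ[K] T →ₗ[K] T} {𝒜 : ℤ → Submodule K A} {ι : A →ₗ[K] T}
  {P : T →ₗ[K] A} {Δ : T} {l : (k : ℕ) → MultilinearMap K (fun _ : Fin k => A) A}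

theorem exists_homogeneous_seq {n : ℕ} {d : Fin n → ℤ} {x : Fin n → A} (hx : ∀ i, x i ∈ 𝒜 (d i)) :
    ∃ (d' : ℕ → ℤ) (x' : ℕ → A), (∀ j, x' j ∈ 𝒜 (d' j)) ∧ d = (fun i : Fin n => d' i) ∧
      x = fun i : Fin n => x' i := by
  refine ⟨Function.extend Fin.val d 0, Function.extend Fin.val x 0, fun j => ?_,
    funext fun i => (Fin.val_injective.extend_apply d 0 i).symm,
    funext fun i => (Fin.val_injective.extend_apply x 0 i).symm⟩
  by_cases hj : ∃ i : Fin n, (i : ℕ) = j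
  · obtain ⟨i, rfl⟩ := hj
    rw [Fin.val_injective.extend_apply, Fin.val_injective.extend_apply]
    exact hx i
  · rw [Function.extend_apply' x _ _ hj]
    exact zero_mem _

theorem apply_vecCons_eq_proj_nestedBracket
    (hl : ∀ k (x : ℕ → A), l k (fun j => x j) = P (nestedBracket B ι k x Δ)) (m : ℕ) (b : A)
    (y : ℕ → A) :
    l (m + 1) (Matrix.vecCons b fun t : Fin m => y t) = P (nestedBracket B ι m y (B Δ (ι b))) := by
  refine .trans (congrArg _ (funext fun j => ?_))
    (hl (m + 1) fun j => Nat.casesOn j b y)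
  cases j using Fin.cases <;> rfl

namespace IsVoronovData

/-- Voronov's theorem. -/
theorem isLInfinityAlgebra [CharZero K] (h : IsVoronovData 𝒯 B 𝒜 ι P)
    (h_int : DirectSum.IsInternal 𝒜) (hΔ : Δ ∈ 𝒯 1) (hΔΔ : B Δ Δ = 0) (hPΔ : P Δ = 0)
    (hl : ∀ k (x : ℕ → A), l k (fun j => x j) = P (nestedBracket B ι k x Δ)) :
    IsLInfinityAlgebra 𝒜 l where
  isInternal := h_int
  degree_one k _ d x hx := by
    obtain ⟨d, x, hx', rfl, rfl⟩ := exists_homogeneous_seq hx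
    rw [hl, Fin.sum_univ_eq_sum_range, add_comm]
    exact h.proj_mem (h.nestedBracket_mem hΔ hx' k)
  graded_symmetry n _ d x hx σ := by
    obtain ⟨d, x, hx', rfl, rfl⟩ := exists_homogeneous_seq hx
    simp only [← extendPerm_val]
    rw [hl, hl n fun j => x (extendPerm σ j), h.nestedBracket_perm hx' hΔ, map_smul]
  generalized_jacobi n _ d x hx := by
    obtain ⟨d, x, hx', rfl, rfl⟩ := exists_homogeneous_seq hx
    have h_term (i : Fin n) (σ : Equiv.Perm (Fin n)) :
        l (n - 1 - i + 1) (Matrix.vecCons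
          (l (i + 1) fun s : Fin (i + 1) => x (σ ⟨s, by omega⟩))
          fun t : Fin (n - 1 - i) => x (σ ⟨i + 1 + t, by omega⟩)) =
        P (nestedBracket B ι (n - (i + 1)) (fun t => x (extendPerm σ (i + 1 + t)))
          (B Δ (ι (P (nestedBracket B ι (i + 1) (fun j => x (extendPerm σ j)) Δ))))) := by
      simp only [← extendPerm_of_lt]
      rw [apply_vecCons_eq_proj_nestedBracket hl _ _ fun t => x (extendPerm σ (i + 1 + t)),
        hl (i + 1) fun j => x (extendPerm σ j), Nat.sub_sub, add_comm 1]
    have h_zero : shuffleSum K d 0 n (fun s => P (nestedBracket B ι n (fun t => x (s (0 + t)))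
        (B Δ (ι (P (nestedBracket B ι 0 (fun j => x (s j)) Δ)))))) = 0 := by
      simp only [nestedBracket_zero, hPΔ, map_zero, shuffleSum, smul_zero, Finset.sum_const_zero]
    have h_sum := h.jacobiSum_eq_zero hx' n hΔ hΔΔ
    rw [jacobiSum, Finset.sum_range_succ', Nat.sub_zero, h_zero, add_zero, Finset.sum_range]
      at h_sum
    refine .trans (Finset.sum_congr rfl fun i _ => ?_) h_sum
    exact Finset.sum_congr rfl fun σ _ => congrArg _ (h_term i σ)

end IsVoronovData

end DerivedLInfinity

section Weight
variable {K T A : Type*} [Field K] [AddCommGroup T] [Module K T] [AddCommGroup A] [Module K A]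
  {B : T →ₗ[K] T →ₗ[K] T} {ι : A →ₗ[K] T} {P : T →ₗ[K] A}

theorem nestedBracket_weight {E : T} (hE : ∀ x y, B (B x y) E = B x (B y E) + B (B x E) y)
    (hι : ∀ a, B (ι a) E = (-1 : K) • ι a) {w : K} {Y : T} (hY : B Y E = w • Y) (n : ℕ)
    (x : ℕ → A) : B (nestedBracket B ι n x Y) E = (w - n) • nestedBracket B ι n x Y := by
  induction n with
  | zero => rw [nestedBracket_zero, hY, Nat.cast_zero, sub_zero]
  | succ n ih =>
    rw [nestedBracket_succ', hE, hι, ih, map_smul, map_smul, LinearMap.smul_apply, Nat.cast_succ]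
    module

theorem proj_nestedBracket_eq_zero_of_weight {E : T}
    (hE : ∀ x y, B (B x y) E = B x (B y E) + B (B x E) y) (hι : ∀ a, B (ι a) E = (-1 : K) • ι a)
    (hP : ∀ x, P (B x E) = (-1 : K) • P x) {w : K} {Y : T} (hY : B Y E = w • Y) {n : ℕ}
    (hn : w + 1 ≠ n) (x : ℕ → A) : P (nestedBracket B ι n x Y) = 0 := by
  have h_weight := hP (nestedBracket B ι n x Y)
  rw [nestedBracket_weight hE hι hY, map_smul] at h_weight
  have h_smul : (w + 1 - n) • P (nestedBracket B ι n x Y) = 0 := by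
    linear_combination (norm := module) h_weight
  exact (smul_eq_zero.1 h_smul).resolve_left (sub_ne_zero.2 hn)

end Weight

/-! ### Twisting -/

section ExponentialTwist
variable {K T A : Type*} [Field K] [AddCommGroup T] [Module K T] [AddCommGroup A] [Module K A]
  {𝒯 : ℤ → Submodule K T} {B : T →ₗ[K] T →ₗ[K] T} {𝒜 : ℤ → Submodule K A} {ι : A →ₗ[K] T}
  {P : T →ₗ[K] A} {α : A} {Δ : T}

theorem nestedBracket_add (n k : ℕ) (x : ℕ → A) (Y : T) :
    nestedBracket B ι (n + k) x Y =
      nestedBracket B ι k (fun j => x (n + j)) (nestedBracket B ι n x Y) := by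
  induction k with
  | zero => rfl
  | succ k ih => rw [← add_assoc, nestedBracket_succ', nestedBracket_succ', ih]

/-- The `n`-th term of the series of `e^{[-, α]} Δ`. -/
noncomputable def expTerm (B : T →ₗ[K] T →ₗ[K] T) (ι : A →ₗ[K] T) (α : A) (Δ : T) (n : ℕ) : T :=
  (n.factorial : K)⁻¹ • nestedBracket B ι n (fun _ => α) Δ

/-- The partial sum of the first `N` terms of `e^{[-, α]} Δ`. It is the whole series as soon as the
remaining terms vanish. -/
noncomputable def twistElem (B : T →ₗ[K] T →ₗ[K] T) (ι : A →ₗ[K] T) (α : A) (N : ℕ) (Δ : T) : T :=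
  ∑ n ∈ Finset.range N, expTerm B ι α Δ n

theorem IsVoronovData.twistElem_mem (h : IsVoronovData 𝒯 B 𝒜 ι P) (hΔ : Δ ∈ 𝒯 1) (hα : α ∈ 𝒜 0)
    (N : ℕ) : twistElem B ι α N Δ ∈ 𝒯 1 := by
  refine Submodule.sum_mem _ fun n _ => Submodule.smul_mem _ _ ?_
  simpa only [Finset.sum_const_zero, add_zero] using
    h.nestedBracket_mem hΔ (d := fun _ => 0) (fun _ => hα) n

section Square
variable [CharZero K]

open Finset.HasAntidiagonal (antidiagonal mem_antidiagonal)

theorem bracket_expTerm (α : A) (Δ : T) (n : ℕ) :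
    B (expTerm B ι α Δ n) (ι α) = ((n : K) + 1) • expTerm B ι α Δ (n + 1) := by
  have h_succ : (n : K) + 1 ≠ 0 := Nat.cast_add_one_ne_zero n
  rw [expTerm, expTerm, map_smul, LinearMap.smul_apply, ← nestedBracket_succ' n fun _ => α,
    smul_smul, Nat.factorial_succ, Nat.cast_mul, Nat.cast_succ, mul_inv,
    mul_inv_cancel_left₀ h_succ]

theorem bracket_sum_antidiagonal_expTerm
    (hα : ∀ x y, B (B x y) (ι α) = B x (B y (ι α)) + B (B x (ι α)) y) (Δ : T) (n : ℕ) :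
    B (∑ ij ∈ antidiagonal n, B (expTerm B ι α Δ ij.1) (expTerm B ι α Δ ij.2)) (ι α) =
      ((n : K) + 1) • ∑ ij ∈ antidiagonal (n + 1),
        B (expTerm B ι α Δ ij.1) (expTerm B ι α Δ ij.2) := by
  have h_split : ((n : K) + 1) • ∑ ij ∈ antidiagonal (n + 1),
        B (expTerm B ι α Δ ij.1) (expTerm B ι α Δ ij.2) =
      ∑ ij ∈ antidiagonal (n + 1),
        (ij.2 : K) • B (expTerm B ι α Δ ij.1) (expTerm B ι α Δ ij.2) +
      ∑ ij ∈ antidiagonal (n + 1),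
        (ij.1 : K) • B (expTerm B ι α Δ ij.1) (expTerm B ι α Δ ij.2) := by
    rw [Finset.smul_sum, ← Finset.sum_add_distrib]
    refine Finset.sum_congr rfl fun ij hij => ?_
    rw [← add_smul, ← Nat.cast_add, add_comm ij.2, mem_antidiagonal.1 hij, Nat.cast_succ]
  rw [h_split, Finset.Nat.sum_antidiagonal_succ', Finset.Nat.sum_antidiagonal_succ, map_sum,
    LinearMap.sum_apply]
  simp only [hα, bracket_expTerm, map_smul, LinearMap.smul_apply, Finset.sum_add_distrib,
    Nat.cast_add, Nat.cast_one, Nat.cast_zero, zero_smul, zero_add]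

theorem sum_antidiagonal_bracket_expTerm
    (hα : ∀ x y, B (B x y) (ι α) = B x (B y (ι α)) + B (B x (ι α)) y) (hΔ : B Δ Δ = 0) (n : ℕ) :
    ∑ ij ∈ antidiagonal n, B (expTerm B ι α Δ ij.1) (expTerm B ι α Δ ij.2) = 0 := by
  induction n with
  | zero =>
    simp only [Finset.Nat.antidiagonal_zero, Finset.sum_singleton, expTerm, nestedBracket_zero,
      map_smul, LinearMap.smul_apply, hΔ, smul_zero]
  | succ n ih =>
    have h_smul := bracket_sum_antidiagonal_expTerm hα Δ n
    rw [ih, map_zero, LinearMap.zero_apply] at h_smul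
    exact (smul_eq_zero.1 h_smul.symm).resolve_left (Nat.cast_add_one_ne_zero n)

theorem bracket_twistElem (hα : ∀ x y, B (B x y) (ι α) = B x (B y (ι α)) + B (B x (ι α)) y)
    (hΔ : B Δ Δ = 0) {N : ℕ} (hN : ∀ n ≥ N, nestedBracket B ι n (fun _ => α) Δ = 0) :
    B (twistElem B ι α N Δ) (twistElem B ι α N Δ) = 0 := by
  have h_zero (n) (hn : N ≤ n) : expTerm B ι α Δ n = 0 := by rw [expTerm, hN n hn, smul_zero]
  simp only [twistElem, map_sum, LinearMap.sum_apply]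
  rw [Finset.sum_comm]
  rw [← Finset.sum_product', ← Finset.sum_fiberwise_of_maps_to (t := Finset.range (N + N))
    (g := fun ij => ij.1 + ij.2) fun ij hij => by
      simp only [Finset.mem_product, Finset.mem_range] at hij ⊢; omega]
  refine Finset.sum_eq_zero fun n _ => ?_
  rw [← sum_antidiagonal_bracket_expTerm hα hΔ n]
  refine Finset.sum_subset (fun ij hij => mem_antidiagonal.2 (Finset.mem_filter.1 hij).2)
    fun ij hij hij' => ?_
  have h_large : N ≤ ij.1 ∨ N ≤ ij.2 := by
    simp only [mem_antidiagonal, Finset.mem_filter, Finset.mem_product,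
      Finset.mem_range] at hij hij'
    omega
  rcases h_large with h_large | h_large
  · rw [h_zero _ h_large, map_zero, LinearMap.zero_apply]
  · rw [h_zero _ h_large, map_zero]

end Square

section TwistedBrackets
variable {l : (k : ℕ) → MultilinearMap K (fun _ : Fin k => A) A} {N : ℕ}

theorem twist_apply_eq_sum {k : ℕ} (hN : ∀ n ≥ N, insertLeft α n k (l (n + k)) = 0)
    (x : Fin k → A) :
    twist l α k x = ∑ n ∈ Finset.range N,
      (n.factorial : K)⁻¹ • l (n + k) (Fin.append (fun _ => α) x) := by
  rw [twist, finsum_eq_sum_of_support_subset (s := Finset.range N) _ fun n hn => ?_,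
    sum_apply]
  · exact Finset.sum_congr rfl fun n _ => by rw [smul_apply, insertLeft_apply]
  · contrapose! hn
    rw [Function.notMem_support, hN n (by simpa using hn), smul_zero]

theorem apply_append_eq_proj_nestedBracket
    (hl : ∀ k (x : ℕ → A), l k (fun j => x j) = P (nestedBracket B ι k x Δ)) (n k : ℕ)
    (x : ℕ → A) :
    l (n + k) (Fin.append (fun _ => α) fun j : Fin k => x j) =
      P (nestedBracket B ι k x (nestedBracket B ι n (fun _ => α) Δ)) := by
  have h_append : (Fin.append (fun _ : Fin n => α) fun j : Fin k => x j) =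
      fun j : Fin (n + k) => if (j : ℕ) < n then α else x (j - n) := by
    ext1 j
    refine Fin.addCases (fun i => ?_) (fun i => ?_) j <;> simp
  rw [h_append, hl (n + k) fun i => if i < n then α else x (i - n), nestedBracket_add,
    nestedBracket_congr (x' := fun _ => α) fun j hj => if_pos hj]
  simp only [Nat.not_lt.2 (Nat.le_add_right n _), if_false, Nat.add_sub_cancel_left]

theorem twist_apply_eq_proj_nestedBracket
    (hl : ∀ k (x : ℕ → A), l k (fun j => x j) = P (nestedBracket B ι k x Δ))
    (hN : ∀ n ≥ N, nestedBracket B ι n (fun _ => α) Δ = 0) (k : ℕ) (x : ℕ → A) :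
    twist l α k (fun j => x j) = P (nestedBracket B ι k x (twistElem B ι α N Δ)) := by
  have h_insert (n) (hn : n ≥ N) : insertLeft α n k (l (n + k)) = 0 := by
    ext y
    obtain ⟨x, rfl⟩ : ∃ x : ℕ → A, y = fun j : Fin k => x j :=
      ⟨Function.extend Fin.val y 0, funext fun j => (Fin.val_injective.extend_apply y 0 j).symm⟩
    rw [insertLeft_apply, apply_append_eq_proj_nestedBracket hl, hN n hn, map_zero, map_zero,
      zero_apply]
  rw [twist_apply_eq_sum h_insert, twistElem, map_sum, map_sum]
  refine Finset.sum_congr rfl fun n _ => ?_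
  rw [apply_append_eq_proj_nestedBracket hl, expTerm, map_smul, map_smul]

theorem proj_twistElem (hl : ∀ k (x : ℕ → A), l k (fun j => x j) = P (nestedBracket B ι k x Δ))
    (hN : ∀ n ≥ N, nestedBracket B ι n (fun _ => α) Δ = 0) (hPΔ : P Δ = 0)
    (hα : IsMaurerCartan 𝒜 l α) : P (twistElem B ι α N Δ) = 0 := by
  have h_term (n) : P (expTerm B ι α Δ n) = (n.factorial : K)⁻¹ • l n fun _ => α := by
    rw [expTerm, map_smul, hl n fun _ => α]
  have h_twist : twistElem B ι α N Δ = ∑ n ∈ Finset.range (N + 1), expTerm B ι α Δ n := by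
    rw [Finset.sum_range_succ, expTerm.eq_def _ _ _ _ N, hN N le_rfl, smul_zero, add_zero,
      twistElem]
  have h_zero : P (expTerm B ι α Δ 0) = 0 := by
    rw [expTerm, nestedBracket_zero, map_smul, hPΔ, smul_zero]
  rw [h_twist, Finset.sum_range_succ', map_add, h_zero, add_zero, map_sum, ← hα.equation,
    finsum_eq_sum_of_support_subset (s := Finset.range N) _ fun n hn => ?_]
  · exact Finset.sum_congr rfl fun n _ => h_term _
  · contrapose! hn
    have hn : N ≤ n := by simpa using hn
    rw [Function.notMem_support, hl (n + 1) fun _ => α, hN _ (by omega), map_zero, smul_zero]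

theorem IsVoronovData.isLInfinityAlgebra_twist [CharZero K] (h : IsVoronovData 𝒯 B 𝒜 ι P)
    (h_top : ⨆ d, 𝒯 d = ⊤) (h_int : DirectSum.IsInternal 𝒜) (hΔ : Δ ∈ 𝒯 1) (hΔΔ : B Δ Δ = 0)
    (hPΔ : P Δ = 0) (hl : ∀ k (x : ℕ → A), l k (fun j => x j) = P (nestedBracket B ι k x Δ))
    (hN : ∀ n ≥ N, nestedBracket B ι n (fun _ => α) Δ = 0) (hα : IsMaurerCartan 𝒜 l α) :
    IsLInfinityAlgebra 𝒜 (twist l α) :=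
  h.isLInfinityAlgebra h_int (h.twistElem_mem hΔ hα.mem_zero N)
    (bracket_twistElem (h.leibniz_zero h_top (h.incl_mem hα.mem_zero)) hΔΔ hN)
    (proj_twistElem hl hN hPΔ hα) (twist_apply_eq_proj_nestedBracket hl hN)

end TwistedBrackets

end ExponentialTwist

section CubicTwist
variable {K A : Type*} [Field K] [AddCommGroup A] [Module K A]
  {l : (k : ℕ) → MultilinearMap K (fun _ : Fin k => A) A} {α : A}

theorem twist_apply_eq_sum_of_four_le (h4 : ∀ k ≥ 4, l k = 0) (k : ℕ) (x : Fin k → A) :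
    twist l α k x = ∑ n ∈ Finset.range 4,
      (n.factorial : K)⁻¹ • l (n + k) (Fin.append (fun _ => α) x) :=
  twist_apply_eq_sum (fun n hn => MultilinearMap.ext fun x => by
    rw [insertLeft_apply, h4 (n + k) (by omega), zero_apply,
      zero_apply]) x

theorem twist_one (h2 : l 2 = 0) (h4 : ∀ k ≥ 4, l k = 0) (x : A) :
    twist l α 1 ![x] = l 1 ![x] + (1 / 2 : K) • l 3 ![α, α, x] := by
  have h_zero : l (0 + 1) (Fin.append (fun _ : Fin 0 => α) ![x]) = l 1 ![x] :=
    congrArg (l 1) (by ext j; fin_cases j; rfl)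
  have h_append : Fin.append (fun _ : Fin 2 => α) ![x] = ![α, α, x] := by
    ext j; fin_cases j <;> rfl
  simp only [twist_apply_eq_sum_of_four_le h4, Finset.sum_range_succ, Finset.sum_range_zero, h_zero,
    Nat.reduceAdd, h2, h4 4 le_rfl, h_append, zero_apply, smul_zero]
  norm_num

theorem twist_two (h2 : l 2 = 0) (h4 : ∀ k ≥ 4, l k = 0) (x y : A) :
    twist l α 2 ![x, y] = l 3 ![α, x, y] := by
  have h_append : Fin.append (fun _ : Fin 1 => α) ![x, y] = ![α, x, y] := by
    ext j; fin_cases j <;> rfl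
  simp [twist_apply_eq_sum_of_four_le h4, Finset.sum_range_succ, h2, h4, h_append]

theorem twist_three (h4 : ∀ k ≥ 4, l k = 0) (x y z : A) :
    twist l α 3 ![x, y, z] = l 3 ![x, y, z] := by
  have h_zero : l (0 + 3) (Fin.append (fun _ : Fin 0 => α) ![x, y, z]) = l 3 ![x, y, z] :=
    congrArg (l 3) (by ext j; fin_cases j <;> rfl)
  simp [twist_apply_eq_sum_of_four_le h4, Finset.sum_range_succ, h4, h_zero]

theorem twist_eq_zero (h4 : ∀ k ≥ 4, l k = 0) {k : ℕ} (hk : 4 ≤ k) : twist l α k = 0 := by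
  ext x
  rw [twist_apply_eq_sum_of_four_le h4]
  exact Finset.sum_eq_zero fun n _ => by
    rw [h4 _ (by omega), zero_apply, smul_zero]

theorem isMaurerCartan_of_eq {𝒜 : ℤ → Submodule K A} (h2 : l 2 = 0) (h4 : ∀ k ≥ 4, l k = 0)
    (hα : α ∈ 𝒜 0) (h_eq : l 1 (fun _ => α) + (6 : K)⁻¹ • l 3 (fun _ => α) = 0) :
    IsMaurerCartan 𝒜 l α where
  mem_zero := hα
  finite_support := (Set.finite_lt_nat 3).subset fun n hn => by
    contrapose! hn
    simp only [Set.mem_ofPred_eq, not_lt] at hn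
    simp only [Set.mem_ofPred_eq, not_not, h4 (n + 1) (by omega), zero_apply]
  equation := by
    rw [finsum_eq_sum_of_support_subset (s := Finset.range 3) _ fun n hn => ?_, ← h_eq]
    · simp only [Finset.sum_range_succ, Finset.sum_range_zero, zero_add, Nat.reduceAdd, h2,
        zero_apply, smul_zero, add_zero]
      norm_num [Nat.factorial]
    · contrapose! hn
      have hn : 3 ≤ n := by simpa using hn
      rw [Function.notMem_support, h4 (n + 1) (by omega), zero_apply, smul_zero]

end CubicTwist

/-! ### The graded Lie algebra of cochains -/

section Wedge
variable {K V W : Type*} [Field K] [AddCommGroup V] [Module K V] [AddCommGroup W] [Module K W]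

theorem wedge_linearMap_ext {f f' : ⋀[K]^2 V →ₗ[K] W}
    (h : ∀ x y, f (wedge K x y) = f' (wedge K x y)) : f = f' := by
  refine exteriorPower.linearMap_ext (AlternatingMap.ext fun v => ?_)
  have h_eta : v = ![v 0, v 1] := by ext i; fin_cases i <;> rfl
  rw [h_eta]
  exact h _ _

theorem wedge_add_left (x x' y : V) : wedge K (x + x') y = wedge K x y + wedge K x' y :=
  alt_add_left _ _ _ _

theorem wedge_add_right (x y y' : V) : wedge K x (y + y') = wedge K x y + wedge K x y' :=
  alt_add_right _ _ _ _

theorem wedge_zero_left (y : V) : wedge K 0 y = 0 :=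
  (exteriorPower.ιMulti K 2).map_coord_zero 0 rfl

theorem wedge_zero_right (x : V) : wedge K x 0 = 0 :=
  (exteriorPower.ιMulti K 2).map_coord_zero 1 rfl

theorem map_wedge (f : V →ₗ[K] W) (x y : V) :
    exteriorPower.map 2 f (wedge K x y) = wedge K (f x) (f y) := by
  have h_comp : f ∘ ![x, y] = ![f x, f y] := by ext t; fin_cases t <;> rfl
  rw [wedge, exteriorPower.map_apply_ιMulti, h_comp, wedge]

theorem wedgeDer_wedgeDer_sub (S T : V →ₗ[K] V) (X : ⋀[K]^2 V) :
    wedgeDer S (wedgeDer T X) - wedgeDer (S ∘ₗ T) X =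
      wedgeDer T (wedgeDer S X) - wedgeDer (T ∘ₗ S) X := by
  suffices h : wedgeDer S ∘ₗ wedgeDer T - wedgeDer (S ∘ₗ T) =
      wedgeDer T ∘ₗ wedgeDer S - wedgeDer (T ∘ₗ S) from LinearMap.congr_fun h X
  refine wedge_linearMap_ext fun x y => ?_
  simp only [LinearMap.sub_apply, LinearMap.comp_apply, wedgeDer_wedge, map_add]
  abel

theorem wedgeDer_map {f : W →ₗ[K] V} {T : V →ₗ[K] V} {S : W →ₗ[K] W} (h : T ∘ₗ f = f ∘ₗ S)
    (X : ⋀[K]^2 W) :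
    wedgeDer T (exteriorPower.map 2 f X) = exteriorPower.map 2 f (wedgeDer S X) := by
  have h_apply (x : W) : T (f x) = f (S x) := LinearMap.congr_fun h x
  suffices h : wedgeDer T ∘ₗ exteriorPower.map 2 f = exteriorPower.map 2 f ∘ₗ wedgeDer S from
    LinearMap.congr_fun h X
  refine wedge_linearMap_ext fun x y => ?_
  simp only [LinearMap.comp_apply, wedgeDer_wedge, map_add, map_wedge, h_apply]

end Wedge

section NijenhuisRichardson
variable {K V W : Type*} [Field K] [AddCommGroup V] [Module K V] [AddCommGroup W] [Module K W]

theorem isContractionAlgebra_circProd :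
    IsContractionAlgebra (cochainGrading K V V) circProd contr actWedge degZero where
  eq_zero_of_neg hd hx := eq_zero_of_mem_cochainGrading_of_neg hd hx
  mul_mem := circProd_mem_cochainGrading
  contr_mem X hx := contr_mem_cochainGrading X hx
  act_eq_zero hp hx := by rw [actWedge_apply, degZero_eq_zero_of_mem_cochainGrading hp hx, map_zero]
  contr_mul := contr_circProd
  act_symm x y X := by
    simp only [actWedge_apply, degZero_circProd]
    exact wedgeDer_wedgeDer_sub _ _ X
  ext h_zero h_contr := TotalCochain.ext_contr (by rw [h_zero, map_zero]) fun X => by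
    rw [h_contr X, map_zero]
  assoc_zero x y z := by
    simp only [bilinAssociator, map_sub, degZero_circProd, LinearMap.comp_assoc, sub_self]

theorem isGradedLie_nrBracket : IsGradedLie (cochainGrading K V V) nrBracket :=
  isContractionAlgebra_circProd.isGradedLie nrBracket_eq

theorem iSup_cochainGrading : ⨆ d, cochainGrading K V W d = ⊤ := by
  refine eq_top_iff.2 fun A _ => ?_
  induction A using DirectSum.induction_on with
  | zero => exact zero_mem _
  | of n P => exact Submodule.mem_iSup_of_mem (n : ℤ) (lof_mem_cochainGrading n P)
  | add A B hA hB => exact add_mem (hA trivial) (hB trivial)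

theorem isInternal_cochainGrading : DirectSum.IsInternal (cochainGrading K V W) := by
  refine DirectSum.isInternal_submodule_of_iSupIndep_of_iSup_eq_top
    (iSupIndep_def.2 fun d => Submodule.disjoint_def.2 fun A hA hA' => ?_) iSup_cochainGrading
  refine DFinsupp.ext fun n => ?_
  by_cases hn : (n : ℤ) = d
  · have h_le : ⨆ j ≠ d, cochainGrading K V W j ≤ LinearMap.ker (DirectSum.component K ℕ _ n) :=
      iSup₂_le fun j hj B hB => hB n (hn.trans_ne hj.symm)
    exact h_le hA'
  · exact hA n hn

theorem nrBracket_ofHom (A : TotalCochain K V V) (f : V →ₗ[K] V) :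
    nrBracket A (ofHom f) = circProd A (ofHom f) - circProd (ofHom f) A := by
  suffices h : nrBracket.flip (ofHom f) = circProd.flip (ofHom f) - circProd (ofHom f) from
    LinearMap.congr_fun h A
  refine TotalCochain.linearMap_ext fun n P => ?_
  refine (nrBracket_eq (lof_mem_cochainGrading n P) (ofHom_mem_cochainGrading f)).trans ?_
  rw [mul_zero, zpow_zero, one_smul]
  rfl

theorem contr_nrBracket_ofHom (X : ⋀[K]^2 V) (A : TotalCochain K V V) (f : V →ₗ[K] V) :
    contr X (nrBracket A (ofHom f)) =
      nrBracket (contr X A) (ofHom f) + contr (wedgeDer f X) A := by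
  suffices h : contr X ∘ₗ nrBracket.flip (ofHom f) =
      nrBracket.flip (ofHom f) ∘ₗ contr X + contr (wedgeDer f X) from LinearMap.congr_fun h A
  refine TotalCochain.linearMap_ext fun n P => ?_
  have h := isContractionAlgebra_circProd.contr_bracket_zero (B := nrBracket (K := K) (V := V))
    nrBracket_eq X (lof_mem_cochainGrading n P) (ofHom_mem_cochainGrading f)
  rw [actWedge_apply, degZero_ofHom] at h
  simp only [LinearMap.comp_apply, LinearMap.flip_apply, LinearMap.add_apply]
  exact h

theorem degZero_nrBracket_ofHom (A : TotalCochain K V V) (f : V →ₗ[K] V) :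
    degZero (nrBracket A (ofHom f)) = degZero A ∘ₗ f - f ∘ₗ degZero A := by
  rw [nrBracket_ofHom, map_sub, degZero_circProd, degZero_circProd, degZero_ofHom]

theorem nrBracket_ofHom_mem_cochainGrading {d : ℤ} {A : TotalCochain K V V}
    (hA : A ∈ cochainGrading K V V d) (f : V →ₗ[K] V) :
    nrBracket A (ofHom f) ∈ cochainGrading K V V d := by
  simpa only [add_zero] using isGradedLie_nrBracket.bracket_mem hA (ofHom_mem_cochainGrading f)

theorem nrBracket_nrBracket_ofHom (A B : TotalCochain K V V) (f : V →ₗ[K] V) :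
    nrBracket (nrBracket A B) (ofHom f) =
      nrBracket A (nrBracket B (ofHom f)) + nrBracket (nrBracket A (ofHom f)) B :=
  isGradedLie_nrBracket.leibniz_zero iSup_cochainGrading (ofHom_mem_cochainGrading f) A B

theorem nrBracket_contr_of_eigenvector {w e : K} {A : TotalCochain K V V} {X : ⋀[K]^2 V}
    {f : V →ₗ[K] V} (hA : nrBracket A (ofHom f) = w • A) (hX : wedgeDer f X = e • X) :
    nrBracket (contr X A) (ofHom f) = (w - e) • contr X A := by
  have h_contr : w • contr X A = nrBracket (contr X A) (ofHom f) + e • contr X A :=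
    calc
      w • contr X A = contr X (nrBracket A (ofHom f)) := by rw [hA, LinearMap.map_smul]
      _ = nrBracket (contr X A) (ofHom f) + contr (wedgeDer f X) A := contr_nrBracket_ofHom X A f
      _ = nrBracket (contr X A) (ofHom f) + e • contr X A := by rw [hX, LinearMap.map_smul₂]
  rw [sub_smul, h_contr, add_sub_cancel_right]

end NijenhuisRichardson

section Functoriality
variable {K V W V' W' : Type*} [Field K] [AddCommGroup V] [Module K V] [AddCommGroup W]
  [Module K W] [AddCommGroup V'] [Module K V'] [AddCommGroup W'] [Module K W']

/-- The map `C*(V, W) → C*(V', W')` induced by `f : V' → V` and `u : W → W'`. -/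
noncomputable def TotalCochain.map (f : V' →ₗ[K] V) (u : W →ₗ[K] W') :
    TotalCochain K V W →ₗ[K] TotalCochain K V' W' := DirectSum.lmap (Cochain.map f u)

theorem evalSeq_map (f : V' →ₗ[K] V) (u : W →ₗ[K] W') (n : ℕ) (Z : ℕ → ⋀[K]^2 V')
    (A : TotalCochain K V W) :
    evalSeq n Z (TotalCochain.map f u A) =
      u ∘ₗ evalSeq n (fun j => exteriorPower.map 2 f (Z j)) A ∘ₗ f := by
  ext v
  change (DirectSum.lmap (Cochain.map f u) A n).1 _ v = _
  rw [DirectSum.lmap_apply, Cochain.map_apply]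
  rfl

theorem degZero_map (f : V' →ₗ[K] V) (u : W →ₗ[K] W') (A : TotalCochain K V W) :
    degZero (TotalCochain.map f u A) = u ∘ₗ degZero A ∘ₗ f := by
  rw [degZero, evalSeq_map, evalSeq_zero]

theorem contr_map (f : V' →ₗ[K] V) (u : W →ₗ[K] W') (X : ⋀[K]^2 V') (A : TotalCochain K V W) :
    contr X (TotalCochain.map f u A) =
      TotalCochain.map f u (contr (exteriorPower.map 2 f X) A) := by
  refine TotalCochain.ext_evalSeq fun n Z => ?_
  have h_consSeq : (fun j => exteriorPower.map 2 f (consSeq X Z j)) =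
      consSeq (exteriorPower.map 2 f X) fun j => exteriorPower.map 2 f (Z j) := by
    ext1 j
    cases j <;> rfl
  rw [evalSeq_contr, evalSeq_map, evalSeq_map, evalSeq_contr, h_consSeq]

theorem map_mem_cochainGrading (f : V' →ₗ[K] V) (u : W →ₗ[K] W') {d : ℤ} {A : TotalCochain K V W}
    (hA : A ∈ cochainGrading K V W d) : TotalCochain.map f u A ∈ cochainGrading K V' W' d := by
  intro n hn
  rw [TotalCochain.map, DirectSum.lmap_apply, hA n hn, map_zero]

theorem contr_map_circProd {q : ℤ} {B : TotalCochain K V V} (hB : B ∈ cochainGrading K V V q)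
    {f : V' →ₗ[K] V} {S : V' →ₗ[K] V'} (hS : degZero B ∘ₗ f = f ∘ₗ S) (u : V →ₗ[K] W')
    (X : ⋀[K]^2 V') (A : TotalCochain K V V) :
    contr X (TotalCochain.map f u (circProd A B)) =
      (-1 : K) ^ q •
          TotalCochain.map f u (circProd (contr (exteriorPower.map 2 f X) A) B) +
        TotalCochain.map f u (circProd A (contr (exteriorPower.map 2 f X) B)) +
        TotalCochain.map f u (contr (exteriorPower.map 2 f (wedgeDer S X)) A) := by
  refine (contr_map f u X _).trans ?_
  rw [contr_circProd _ A hB, actWedge_apply, wedgeDer_map hS, map_add, map_add, map_smul]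

end Functoriality

/-! ### Weights -/

section Weights
variable {K g h : Type*} [Field K] [AddCommGroup g] [Module K g] [AddCommGroup h] [Module K h]

theorem inclF_eq_map : inclF K g h = TotalCochain.map (LinearMap.fst K g h) (LinearMap.inr K g h) :=
  rfl

theorem projF_eq_map : projF K g h = TotalCochain.map (LinearMap.inl K g h) (LinearMap.snd K g h) :=
  rfl

theorem inclF_mem_cochainGrading {d : ℤ} {a : TotalCochain K g h}
    (ha : a ∈ cochainGrading K g h d) : inclF K g h a ∈ cochainGrading K (g × h) (g × h) d :=
  map_mem_cochainGrading _ _ ha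

theorem projF_mem_cochainGrading {d : ℤ} {A : TotalCochain K (g × h) (g × h)}
    (hA : A ∈ cochainGrading K (g × h) (g × h) d) : projF K g h A ∈ cochainGrading K g h d :=
  map_mem_cochainGrading _ _ hA

theorem degZero_projF (A : TotalCochain K (g × h) (g × h)) :
    degZero (projF K g h A) = LinearMap.snd K g h ∘ₗ degZero A ∘ₗ LinearMap.inl K g h :=
  degZero_map _ _ A

theorem contr_projF (X : ⋀[K]^2 g) (A : TotalCochain K (g × h) (g × h)) :
    contr X (projF K g h A) =
      projF K g h (contr (exteriorPower.map 2 (LinearMap.inl K g h) X) A) :=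
  contr_map _ _ X A

theorem degZero_inclF (a : TotalCochain K g h) :
    degZero (inclF K g h a) = LinearMap.inr K g h ∘ₗ degZero a ∘ₗ LinearMap.fst K g h :=
  degZero_map _ _ a

theorem contr_inclF (X : ⋀[K]^2 (g × h)) (a : TotalCochain K g h) :
    contr X (inclF K g h a) =
      inclF K g h (contr (exteriorPower.map 2 (LinearMap.fst K g h) X) a) :=
  contr_map _ _ X a

theorem projF_inclF (a : TotalCochain K g h) : projF K g h (inclF K g h a) = a := by
  have h_map (X : ⋀[K]^2 g) : exteriorPower.map 2 (LinearMap.fst K g h)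
      (exteriorPower.map 2 (LinearMap.inl K g h) X) = X := by
    rw [← LinearMap.comp_apply, ← exteriorPower.map_comp, LinearMap.fst_comp_inl,
      exteriorPower.map_id, LinearMap.id_apply]
  refine TotalCochain.ext_evalSeq fun n Z => ?_
  rw [projF_eq_map, inclF_eq_map, evalSeq_map, evalSeq_map]
  simp only [h_map]
  rfl

theorem inclF_ofHom (H : g →ₗ[K] h) :
    inclF K g h (ofHom H) = ofHom (LinearMap.inr K g h ∘ₗ H ∘ₗ LinearMap.fst K g h) := by
  refine TotalCochain.ext_contr ?_ fun X => ?_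
  · rw [degZero_inclF, degZero_ofHom, degZero_ofHom]
  · rw [contr_inclF, contr_ofHom, contr_ofHom, map_zero]

variable (K g h) in
/-- The projection of `g ⊕ h` onto `h`, as an endomorphism of `g ⊕ h`. The cochains of weight `w`
are the eigenvectors of `A ↦ [A, weightHom]` with eigenvalue `w`: the number of their arguments in
`h`, minus one if their values are in `h`. -/
noncomputable def weightHom : g × h →ₗ[K] g × h := LinearMap.inr K g h ∘ₗ LinearMap.snd K g h

theorem weightHom_apply (v : g × h) : weightHom K g h v = (0, v.2) := rfl

theorem weightHom_comp_inl : weightHom K g h ∘ₗ LinearMap.inl K g h = 0 := by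
  rw [weightHom, LinearMap.comp_assoc, LinearMap.snd_comp_inl, LinearMap.comp_zero]

theorem fst_comp_weightHom : LinearMap.fst K g h ∘ₗ weightHom K g h = 0 := by
  rw [weightHom, ← LinearMap.comp_assoc, LinearMap.fst_comp_inr, LinearMap.zero_comp]

theorem wedgeDer_weightHom_map_inl (X : ⋀[K]^2 g) :
    wedgeDer (weightHom K g h) (exteriorPower.map 2 (LinearMap.inl K g h) X) = 0 := by
  rw [wedgeDer_map (S := 0) (by rw [weightHom_comp_inl, LinearMap.comp_zero]), map_zero,
    LinearMap.zero_apply, map_zero]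

theorem map_fst_wedgeDer_weightHom (X : ⋀[K]^2 (g × h)) :
    exteriorPower.map 2 (LinearMap.fst K g h) (wedgeDer (weightHom K g h) X) = 0 := by
  rw [← wedgeDer_map (T := 0) (by rw [fst_comp_weightHom, LinearMap.zero_comp]), map_zero,
    LinearMap.zero_apply]

theorem contr_projF_nrBracket_weightHom (X : ⋀[K]^2 g) (A : TotalCochain K (g × h) (g × h)) :
    contr X (projF K g h (nrBracket A (ofHom (weightHom K g h)))) =
      projF K g h (nrBracket (contr (exteriorPower.map 2 (LinearMap.inl K g h) X) A)
        (ofHom (weightHom K g h))) := by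
  refine (contr_projF X _).trans (congrArg _ ((contr_nrBracket_ofHom _ A _).trans ?_))
  rw [wedgeDer_weightHom_map_inl, map_zero, LinearMap.zero_apply, add_zero]

theorem projF_nrBracket_weightHom (A : TotalCochain K (g × h) (g × h)) :
    projF K g h (nrBracket A (ofHom (weightHom K g h))) = (-1 : K) • projF K g h A := by
  refine TotalCochain.eq_of_contr_comm
    (F := fun A => projF K g h (nrBracket A (ofHom (weightHom K g h))))
    (G := fun A => (-1 : K) • projF K g h A) contr_projF_nrBracket_weightHom
    (fun X A => (map_smul _ _ _).trans (congrArg _ (contr_projF X A))) (fun A => ?_) A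
  rw [map_smul, degZero_projF, degZero_projF, degZero_nrBracket_ofHom, LinearMap.sub_comp,
    LinearMap.comp_assoc, weightHom_comp_inl, LinearMap.comp_zero, zero_sub, neg_one_smul]
  rfl

theorem contr_nrBracket_inclF_weightHom (X : ⋀[K]^2 (g × h)) (a : TotalCochain K g h) :
    contr X (nrBracket (inclF K g h a) (ofHom (weightHom K g h))) =
      nrBracket (inclF K g h (contr (exteriorPower.map 2 (LinearMap.fst K g h) X) a))
        (ofHom (weightHom K g h)) := by
  refine (contr_nrBracket_ofHom X _ _).trans ?_
  rw [contr_inclF, contr_inclF, map_fst_wedgeDer_weightHom, map_zero, LinearMap.zero_apply,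
    map_zero, add_zero]

theorem nrBracket_inclF_weightHom (a : TotalCochain K g h) :
    nrBracket (inclF K g h a) (ofHom (weightHom K g h)) = (-1 : K) • inclF K g h a := by
  refine TotalCochain.eq_of_contr_comm
    (F := fun a => nrBracket (inclF K g h a) (ofHom (weightHom K g h)))
    (G := fun a => (-1 : K) • inclF K g h a) contr_nrBracket_inclF_weightHom
    (fun X a => (map_smul _ _ _).trans (congrArg _ (contr_inclF X a))) (fun a => ?_) a
  rw [map_smul, degZero_nrBracket_ofHom, degZero_inclF, LinearMap.comp_assoc, LinearMap.comp_assoc,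
    fst_comp_weightHom, LinearMap.comp_zero, LinearMap.comp_zero, zero_sub]
  exact (neg_one_smul K _).symm

theorem degZero_eq_zero_of_weight {w : K} (hw : w ≠ 0) (hw_add : w + 1 ≠ 0) (hw_sub : w - 1 ≠ 0)
    {A : TotalCochain K (g × h) (g × h)}
    (hA : nrBracket A (ofHom (weightHom K g h)) = w • A) : degZero A = 0 := by
  have h_weight (v : g × h) :
      degZero A (0, v.2) - weightHom K g h (degZero A v) = w • degZero A v := by
    have h := degZero_nrBracket_ofHom A (weightHom K g h)
    rw [hA, map_smul] at h
    exact (LinearMap.congr_fun h v).symm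
  refine LinearMap.prod_ext (LinearMap.ext fun x => ?_) (LinearMap.ext fun u => ?_)
  · have hx : -weightHom K g h (degZero A (x, 0)) = w • degZero A (x, 0) := by
      rw [← h_weight (x, 0), ← Prod.zero_eq_mk, map_zero, zero_sub]
    have hx_fst : w • (degZero A (x, 0)).1 = 0 := (congrArg Prod.fst hx).symm.trans neg_zero
    have hx_snd : (w + 1) • (degZero A (x, 0)).2 = 0 := by
      rw [add_smul, one_smul]
      exact eq_neg_iff_add_eq_zero.1 (congrArg Prod.snd hx).symm
    exact Prod.ext ((smul_eq_zero.1 hx_fst).resolve_left hw)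
      ((smul_eq_zero.1 hx_snd).resolve_left hw_add)
  · have hu := h_weight (0, u)
    have hu_fst : (w - 1) • (degZero A (0, u)).1 = 0 := by
      rw [sub_smul, one_smul]
      exact sub_eq_zero.2 ((congrArg Prod.fst hu).symm.trans (sub_zero _))
    have hu_snd : w • (degZero A (0, u)).2 = 0 := (congrArg Prod.snd hu).symm.trans (sub_self _)
    exact Prod.ext ((smul_eq_zero.1 hu_fst).resolve_left hw_sub)
      ((smul_eq_zero.1 hu_snd).resolve_left hw)

theorem eq_zero_of_wedgeDer_weight {M : Type*} [AddCommGroup M] [Module K M]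
    {f : ⋀[K]^2 (g × h) →ₗ[K] M}
    (hf : ∀ (e : ℕ) X, wedgeDer (weightHom K g h) X = (e : K) • X → f X = 0) : f = 0 := by
  have hgg (x y : g) : f (wedge K (x, 0) (y, 0)) = 0 := hf 0 _ <| by
    rw [wedgeDer_wedge, weightHom_apply, weightHom_apply, ← Prod.zero_eq_mk, wedge_zero_left,
      wedge_zero_right, add_zero, Nat.cast_zero, zero_smul]
  have hgh (x : g) (v : h) : f (wedge K (x, 0) (0, v)) = 0 := hf 1 _ <| by
    rw [wedgeDer_wedge, weightHom_apply, weightHom_apply, ← Prod.zero_eq_mk, wedge_zero_left,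
      zero_add, Nat.cast_one, one_smul]
  have hhg (u : h) (y : g) : f (wedge K (0, u) (y, 0)) = 0 := hf 1 _ <| by
    rw [wedgeDer_wedge, weightHom_apply, weightHom_apply, ← Prod.zero_eq_mk, wedge_zero_right,
      add_zero, Nat.cast_one, one_smul]
  have hhh (u v : h) : f (wedge K (0, u) (0, v)) = 0 := hf 2 _ <| by
    rw [wedgeDer_wedge, weightHom_apply, weightHom_apply, Nat.cast_two, two_smul]
  refine wedge_linearMap_ext fun ⟨x, u⟩ ⟨y, v⟩ => ?_
  have h_split (z : g) (w : h) : (z, w) = (z, 0) + (0, w) :=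
    Prod.ext (add_zero z).symm (zero_add w).symm
  rw [h_split x u, h_split y v, wedge_add_left, wedge_add_right, wedge_add_right]
  simp only [map_add, hgg, hgh, hhg, hhh, add_zero, LinearMap.zero_apply]

theorem eq_zero_of_weight [CharZero K] {w : ℤ} (hw : w ≤ -2) {A : TotalCochain K (g × h) (g × h)}
    (hA : nrBracket A (ofHom (weightHom K g h)) = (w : K) • A) : A = 0 := by
  refine TotalCochain.ext_evalSeq fun n => ?_
  induction n generalizing w A with
  | zero =>
    intro Z
    rw [evalSeq_zero, map_zero]
    exact degZero_eq_zero_of_weight (w := (w : K)) (by exact_mod_cast (by omega : w ≠ 0))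
      (by exact_mod_cast (by omega : w + 1 ≠ 0)) (by exact_mod_cast (by omega : w - 1 ≠ 0)) hA
  | succ n ih =>
    intro Z
    suffices h : evalSeq n (fun a => Z (a + 1)) ∘ₗ contr.flip A = 0 by
      rw [map_zero, ← consSeq_head_tail Z, ← evalSeq_contr]
      exact LinearMap.congr_fun h (Z 0)
    refine eq_zero_of_wedgeDer_weight fun e X hX => ?_
    have h_contr := ih (w := w - e) (by omega) (A := contr X A)
      (by rw [nrBracket_contr_of_eigenvector hA hX]; push_cast; rfl)
    exact (h_contr fun a => Z (a + 1)).trans (map_zero _)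

theorem nrBracket_inclF_inclF [CharZero K] (a b : TotalCochain K g h) :
    nrBracket (inclF K g h a) (inclF K g h b) = 0 := by
  refine eq_zero_of_weight (w := -2) le_rfl ?_
  rw [nrBracket_nrBracket_ofHom, nrBracket_inclF_weightHom, nrBracket_inclF_weightHom, map_smul,
    map_smul, LinearMap.smul_apply, ← add_smul]
  norm_num

theorem degZero_comp_inl_of_projF_eq_zero {A : TotalCochain K (g × h) (g × h)}
    (hA : projF K g h A = 0) :
    degZero A ∘ₗ LinearMap.inl K g h =
      LinearMap.inl K g h ∘ₗ LinearMap.fst K g h ∘ₗ degZero A ∘ₗ LinearMap.inl K g h := by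
  have h_snd : LinearMap.snd K g h ∘ₗ degZero A ∘ₗ LinearMap.inl K g h = 0 := by
    rw [← degZero_projF, hA, map_zero]
  exact LinearMap.ext fun x => Prod.ext rfl (LinearMap.congr_fun h_snd x)

theorem projF_contr_map_inl {A : TotalCochain K (g × h) (g × h)} (hA : projF K g h A = 0)
    (X : ⋀[K]^2 g) : projF K g h (contr (exteriorPower.map 2 (LinearMap.inl K g h) X) A) = 0 := by
  rw [← contr_projF, hA, map_zero]

theorem degZero_projF_circProd {A B : TotalCochain K (g × h) (g × h)} (hA : projF K g h A = 0)
    (hB : projF K g h B = 0) : degZero (projF K g h (circProd A B)) = 0 := by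
  rw [degZero_projF, degZero_circProd, LinearMap.comp_assoc, degZero_comp_inl_of_projF_eq_zero hB,
    ← LinearMap.comp_assoc _ (LinearMap.inl K g h), degZero_comp_inl_of_projF_eq_zero hA]
  ext x
  rfl

theorem contr_projF_circProd {q : ℤ} {A B : TotalCochain K (g × h) (g × h)}
    (hB_mem : B ∈ cochainGrading K (g × h) (g × h) q) (hA : projF K g h A = 0)
    (hB : projF K g h B = 0) (X : ⋀[K]^2 g) :
    contr X (projF K g h (circProd A B)) =
      (-1 : K) ^ q • projF K g h
          (circProd (contr (exteriorPower.map 2 (LinearMap.inl K g h) X) A) B) +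
        projF K g h (circProd A (contr (exteriorPower.map 2 (LinearMap.inl K g h) X) B)) :=
  (contr_map_circProd hB_mem (degZero_comp_inl_of_projF_eq_zero hB) _ X A).trans
    (add_eq_left.2 (projF_contr_map_inl hA _))

theorem projF_circProd {q : ℤ} {A B : TotalCochain K (g × h) (g × h)}
    (hB_mem : B ∈ cochainGrading K (g × h) (g × h) q) (hA : projF K g h A = 0)
    (hB : projF K g h B = 0) : projF K g h (circProd A B) = 0 := by
  refine TotalCochain.ext_evalSeq fun n => ?_
  induction n generalizing q A B with
  | zero =>
    intro Z
    rw [evalSeq_zero, degZero_projF_circProd hA hB, map_zero]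
  | succ n ih =>
    intro Z
    rw [← consSeq_head_tail Z, ← evalSeq_contr, contr_projF_circProd hB_mem hA hB, map_add,
      map_smul, ih hB_mem (projF_contr_map_inl hA _) hB,
      ih (contr_mem_cochainGrading _ hB_mem) hA (projF_contr_map_inl hB _)]
    simp only [map_zero, smul_zero, add_zero]

theorem isVoronovData [CharZero K] :
    IsVoronovData (cochainGrading K (g × h) (g × h)) nrBracket (cochainGrading K g h)
      (inclF K g h) (projF K g h) where
  toIsGradedLie := isGradedLie_nrBracket
  incl_mem := inclF_mem_cochainGrading
  proj_mem := projF_mem_cochainGrading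
  proj_incl := projF_inclF
  abelian {_ _ a b} _ _ := nrBracket_inclF_inclF a b
  ker_bracket hx hy hPx hPy := by
    rw [nrBracket_eq hx hy, map_sub, map_smul, projF_circProd hy hPx hPy,
      projF_circProd hx hPy hPx, smul_zero, sub_zero]

end Weights

/-! ### Cochains of degree one and 3-Lie brackets -/

section ContractionAlgebraSquare
variable {K T L E : Type*} [Field K] [AddCommGroup T] [Module K T] [AddCommGroup L] [Module K L]
  [AddCommGroup E] [Module K E] {𝒯 : ℤ → Submodule K T} {m : T →ₗ[K] T →ₗ[K] T}
  {i : L →ₗ[K] T →ₗ[K] T} {a : T →ₗ[K] L →ₗ[K] L} {c : T →ₗ[K] E} {x : T}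

namespace IsContractionAlgebra

theorem contr_contr_sq (h : IsContractionAlgebra 𝒯 m i a c) (hx : x ∈ 𝒯 1) (X Y : L) :
    i Y (i X (m x x)) = m (i Y x) (i X x) - m (i X x) (i Y x) + i (a (i X x) Y) x := by
  have hX : i X x ∈ 𝒯 0 := h.contr_mem X hx
  rw [h.contr_mul X x hx, map_add, map_add, map_smul, h.contr_mul Y _ hx, h.contr_mul Y x hX,
    h.contr_eq_zero hX, h.act_eq_zero one_ne_zero hx]
  simp only [map_zero, LinearMap.zero_apply, zpow_one, zpow_zero]
  module

theorem eq_zero_of_mem_two (h : IsContractionAlgebra 𝒯 m i a c)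
    (hc : ∀ {d x}, d ≠ 0 → x ∈ 𝒯 d → c x = 0) (hx : x ∈ 𝒯 2) (h0 : ∀ X Y, c (i Y (i X x)) = 0) :
    x = 0 := by
  refine h.ext (hc two_ne_zero hx) fun X => ?_
  have hX : i X x ∈ 𝒯 1 := h.contr_mem X hx
  refine h.ext (hc one_ne_zero hX) fun Y => ?_
  exact h.ext (h0 X Y) (h.contr_eq_zero (h.contr_mem Y hX))

end IsContractionAlgebra

end ContractionAlgebraSquare

section DegreeOne
variable {K V W V' W' : Type*} [Field K] [AddCommGroup V] [Module K V] [AddCommGroup W]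
  [Module K W] [AddCommGroup V'] [Module K V'] [AddCommGroup W'] [Module K W']

/-- The component of degree one of a total cochain, as a function of three vectors. -/
noncomputable def degOne (A : TotalCochain K V W) (x y z : V) : W :=
  degZero (contr (wedge K x y) A) z

theorem degOne_add (A B : TotalCochain K V W) (x y z : V) :
    degOne (A + B) x y z = degOne A x y z + degOne B x y z := by
  simp only [degOne, map_add, LinearMap.add_apply]

theorem degOne_smul (c : K) (A : TotalCochain K V W) (x y z : V) :
    degOne (c • A) x y z = c • degOne A x y z := by
  simp only [degOne, map_smul, LinearMap.smul_apply]

theorem degOne_zero (x y z : V) : degOne (0 : TotalCochain K V W) x y z = 0 := by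
  simp only [degOne, map_zero, LinearMap.zero_apply]

theorem ext_degOne {A B : TotalCochain K V W} (hA : A ∈ cochainGrading K V W 1)
    (hB : B ∈ cochainGrading K V W 1) (h : ∀ x y z, degOne A x y z = degOne B x y z) : A = B := by
  have h_contr_zero (X Y : ⋀[K]^2 V) {C : TotalCochain K V W} (hC : C ∈ cochainGrading K V W 1) :
      contr Y (contr X C) = 0 :=
    eq_zero_of_mem_cochainGrading_of_neg (by norm_num)
      (contr_mem_cochainGrading Y (contr_mem_cochainGrading X hC))
  have h_degZero : degZero ∘ₗ contr.flip A = degZero ∘ₗ contr.flip B :=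
    wedge_linearMap_ext fun x y => LinearMap.ext fun z => h x y z
  refine TotalCochain.ext_contr ?_ fun X => TotalCochain.ext_contr ?_ fun Y => ?_
  · rw [degZero_eq_zero_of_mem_cochainGrading one_ne_zero hA,
      degZero_eq_zero_of_mem_cochainGrading one_ne_zero hB]
  · exact LinearMap.congr_fun h_degZero X
  · rw [h_contr_zero X Y hA, h_contr_zero X Y hB]

theorem degOne_nrBracket_ofHom (A : TotalCochain K V V) (f : V →ₗ[K] V) (x y z : V) :
    degOne (nrBracket A (ofHom f)) x y z =
      degOne A (f x) y z + degOne A x (f y) z + degOne A x y (f z) - f (degOne A x y z) := by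
  rw [degOne, contr_nrBracket_ofHom, map_add, degZero_nrBracket_ofHom, wedgeDer_wedge]
  simp only [map_add, LinearMap.add_apply, LinearMap.sub_apply, LinearMap.comp_apply, degOne]
  abel

theorem degOne_map (f : V' →ₗ[K] V) (u : W →ₗ[K] W') (A : TotalCochain K V W) (x y z : V') :
    degOne (TotalCochain.map f u A) x y z = u (degOne A (f x) (f y) (f z)) := by
  rw [degOne, contr_map, degZero_map, map_wedge]
  rfl

/-- A ternary bracket, as a total cochain. -/
noncomputable def bracketCochain (m : V [⋀^Fin 3]→ₗ[K] V) : TotalCochain K V V :=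
  TotalCochain.lof 1 (ofBracket m)

theorem bracketCochain_mem_cochainGrading (m : V [⋀^Fin 3]→ₗ[K] V) :
    bracketCochain m ∈ cochainGrading K V V 1 :=
  lof_mem_cochainGrading 1 _

theorem degOne_bracketCochain (m : V [⋀^Fin 3]→ₗ[K] V) (x y z : V) :
    degOne (bracketCochain m) x y z = m ![x, y, z] := by
  rw [degOne, degZero, evalSeq_contr, bracketCochain, evalSeq_lof rfl, ← ofBracket_apply]
  congr 2
  ext1 j
  obtain rfl : j = 0 := Fin.ext (by omega)
  rfl

theorem circProd_bracketCochain_self {m : V [⋀^Fin 3]→ₗ[K] V} (hm : IsThreeLieBracket m) :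
    circProd (bracketCochain m) (bracketCochain m) = 0 := by
  have h_mem := bracketCochain_mem_cochainGrading m
  have h_contr := isContractionAlgebra_circProd (K := K) (V := V)
  refine h_contr.eq_zero_of_mem_two (fun hd => degZero_eq_zero_of_mem_cochainGrading hd)
    (circProd_mem_cochainGrading h_mem h_mem) fun X Y => ?_
  rw [h_contr.contr_contr_sq h_mem, map_add, map_sub, degZero_circProd, degZero_circProd]
  let φ : ⋀[K]^2 V →ₗ[K] Module.End K V := degZero ∘ₗ contr.flip (bracketCochain m)
  have hφ (x y z : V) : φ (wedge K x y) z = m ![x, y, z] := degOne_bracketCochain m x y z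
  suffices h : (LinearMap.mul K (Module.End K V)).compl₁₂ φ φ -
      ((LinearMap.mul K (Module.End K V)).compl₁₂ φ φ).flip +
      (wedgeDer ∘ₗ φ).flip.compr₂ φ = 0 from LinearMap.congr_fun₂ h Y X
  refine wedge_linearMap_ext fun x₃ x₄ => wedge_linearMap_ext fun x₁ x₂ => ?_
  ext x₅
  simp only [LinearMap.add_apply, LinearMap.sub_apply, LinearMap.compl₁₂_apply,
    LinearMap.flip_apply, LinearMap.compr₂_apply, LinearMap.comp_apply, LinearMap.mul_apply',
    Module.End.mul_apply, LinearMap.zero_apply, wedgeDer_wedge, map_add, hφ]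
  rw [hm x₁ x₂ x₃ x₄ x₅]
  abel

theorem nrBracket_bracketCochain_self {m : V [⋀^Fin 3]→ₗ[K] V} (hm : IsThreeLieBracket m) :
    nrBracket (bracketCochain m) (bracketCochain m) = 0 := by
  have h_mem := bracketCochain_mem_cochainGrading m
  rw [nrBracket_eq h_mem h_mem, circProd_bracketCochain_self hm, smul_zero, sub_zero]

end DegreeOne

/-! ### The semidirect product and its derived brackets -/

section AlternatingMaps
variable {K M N : Type*} [Field K] [AddCommGroup M] [Module K M] [AddCommGroup N] [Module K N]

theorem alt_zero_left (f : M [⋀^Fin 2]→ₗ[K] N) (x : M) : f ![0, x] = 0 :=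
  f.map_coord_zero (i := 0) rfl

theorem alt_zero_right (f : M [⋀^Fin 2]→ₗ[K] N) (x : M) : f ![x, 0] = 0 :=
  f.map_coord_zero (i := 1) rfl

theorem alt_three_zero_left (m : M [⋀^Fin 3]→ₗ[K] N) (x y : M) : m ![0, x, y] = 0 :=
  m.map_coord_zero (i := 0) rfl

theorem alt_three_zero_middle (m : M [⋀^Fin 3]→ₗ[K] N) (x y : M) : m ![x, 0, y] = 0 :=
  m.map_coord_zero (i := 1) rfl

theorem alt_three_zero_right (m : M [⋀^Fin 3]→ₗ[K] N) (x y : M) : m ![x, y, 0] = 0 :=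
  m.map_coord_zero (i := 2) rfl

theorem alt_three_rotate (m : M [⋀^Fin 3]→ₗ[K] N) (x y z : M) :
    m ![y, z, x] = m ![x, y, z] := by
  have h_rotate : ![y, z, x] = ![x, y, z] ∘ finRotate 3 := by ext i; fin_cases i <;> rfl
  rw [h_rotate, m.map_perm, sign_finRotate, neg_one_sq, one_smul]

end AlternatingMaps

section Semidirect
variable {K g h : Type*} [Field K] [AddCommGroup g] [Module K g] [AddCommGroup h] [Module K h]
  {π : g [⋀^Fin 3]→ₗ[K] g} {μ : h [⋀^Fin 3]→ₗ[K] h} {ρ : g [⋀^Fin 2]→ₗ[K] Module.End K h}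

theorem bracket_center_add_left {c : h} (hc : c ∈ center μ) (u v w : h) :
    μ ![c + u, v, w] = μ ![u, v, w] := by
  rw [← zero_add (μ ![u, v, w]), ← hc v w]
  exact μ.toMultilinearMap.cons_add ![v, w] c u

theorem bracket_center_add_right {c : h} (hc : c ∈ center μ) (u v w : h) :
    μ ![v, w, c + u] = μ ![v, w, u] := by
  rw [alt_three_rotate, bracket_center_add_left hc, ← alt_three_rotate]

theorem bracket_center_add_middle {c : h} (hc : c ∈ center μ) (u v w : h) :
    μ ![w, c + u, v] = μ ![w, u, v] := by
  rw [alt_three_rotate, bracket_center_add_right hc, ← alt_three_rotate]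

theorem add_mem_center {c c' : h} (hc : c ∈ center μ) (hc' : c' ∈ center μ) :
    c + c' ∈ center μ := fun v w => by rw [bracket_center_add_left hc, hc' v w]

theorem isThreeLieBracket_semidirect (hπ : IsThreeLieBracket π) (hμ : IsThreeLieBracket μ)
    (hρ : IsAction π μ ρ) : IsThreeLieBracket (semidirectBracket π μ ρ) := by
  have h_mul (a b c d : g) (u : h) : ρ ![a, b] (ρ ![c, d] u) =
      ρ ![π ![a, b, c], d] u + ρ ![c, π ![a, b, d]] u + ρ ![c, d] (ρ ![a, b] u) :=
    LinearMap.congr_fun (hρ.rho_mul_rho a b c d) u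
  have h_bracket (a b c d : g) (u : h) : ρ ![a, π ![b, c, d]] u =
      ρ ![c, d] (ρ ![a, b] u) - ρ ![b, d] (ρ ![a, c] u) + ρ ![b, c] (ρ ![a, d] u) :=
    LinearMap.congr_fun (hρ.rho_bracket a b c d) u
  have h_center (a b c d e f : g) (u v w : h) :
      ρ ![a, b] u + ρ ![c, d] v + ρ ![e, f] w ∈ center μ :=
    add_mem_center (add_mem_center (hρ.rho_mem_center a b u) (hρ.rho_mem_center c d v))
      (hρ.rho_mem_center e f w)
  rintro ⟨x₁, u₁⟩ ⟨x₂, u₂⟩ ⟨x₃, u₃⟩ ⟨x₄, u₄⟩ ⟨x₅, u₅⟩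
  simp only [semidirectBracket_apply, Prod.mk_add_mk]
  refine Prod.ext (hπ x₁ x₂ x₃ x₄ x₅) ?_
  simp only [bracket_center_add_left, bracket_center_add_middle, bracket_center_add_right, h_center,
    map_add, hρ.rho_bracket_eq_zero]
  rw [h_mul x₁ x₂ x₃ x₄ u₅, h_mul x₁ x₂ x₄ x₅ u₃, h_mul x₁ x₂ x₅ x₃ u₄, h_bracket x₂ x₃ x₄ x₅ u₁,
    alt_swap ρ (π ![x₃, x₄, x₅]) x₁, LinearMap.neg_apply, h_bracket x₁ x₃ x₄ x₅ u₂,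
    alt_swap ρ x₅ x₃, alt_swap ρ x₃ x₁, alt_swap ρ x₄ x₁, alt_swap ρ x₅ x₁, hμ u₁ u₂ u₃ u₄ u₅]
  simp only [LinearMap.neg_apply, map_neg]
  abel

variable (π μ ρ)

theorem degOne_semidirect (x y z : g × h) :
    degOne (bracketCochain (semidirectBracket π μ ρ)) x y z =
      (π ![x.1, y.1, z.1], ρ ![x.1, y.1] z.2 + ρ ![y.1, z.1] x.2 + ρ ![z.1, x.1] y.2 +
        μ ![x.2, y.2, z.2]) := by
  rw [degOne_bracketCochain]
  exact semidirectBracket_apply π μ ρ x.1 y.1 z.1 x.2 y.2 z.2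

theorem bracketCochain_semidirect_eq_add :
    bracketCochain (semidirectBracket π μ ρ) =
      bracketCochain (semidirectBracket π 0 ρ) + bracketCochain (semidirectBracket 0 μ 0) := by
  refine ext_degOne (bracketCochain_mem_cochainGrading _)
    (add_mem (bracketCochain_mem_cochainGrading _) (bracketCochain_mem_cochainGrading _))
    fun x y z => ?_
  simp only [degOne_add, degOne_semidirect]
  simp

theorem nrBracket_action_weightHom :
    nrBracket (bracketCochain (semidirectBracket π 0 ρ)) (ofHom (weightHom K g h)) =
      (0 : K) • bracketCochain (semidirectBracket π 0 ρ) := by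
  have h_mem := bracketCochain_mem_cochainGrading (semidirectBracket π 0 ρ)
  refine ext_degOne (nrBracket_ofHom_mem_cochainGrading h_mem _) (Submodule.smul_mem _ _ h_mem)
    fun x y z => ?_
  rw [degOne_nrBracket_ofHom, degOne_smul]
  simp only [degOne_semidirect, weightHom_apply, alt_zero_left, alt_zero_right,
    alt_three_zero_left, alt_three_zero_middle, alt_three_zero_right]
  ext <;> simp
  abel

theorem nrBracket_bracket_weightHom :
    nrBracket (bracketCochain (semidirectBracket (0 : g [⋀^Fin 3]→ₗ[K] g) μ 0))
      (ofHom (weightHom K g h)) = (2 : K) • bracketCochain (semidirectBracket 0 μ 0) := by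
  have h_mem := bracketCochain_mem_cochainGrading (semidirectBracket (0 : g [⋀^Fin 3]→ₗ[K] g) μ 0)
  refine ext_degOne (nrBracket_ofHom_mem_cochainGrading h_mem _) (Submodule.smul_mem _ _ h_mem)
    fun x y z => ?_
  rw [degOne_nrBracket_ofHom, degOne_smul]
  simp only [degOne_semidirect, weightHom_apply]
  ext <;> simp [two_smul]

theorem projF_nestedBracket_semidirect_eq_zero [CharZero K] {n : ℕ} (h1 : n ≠ 1) (h3 : n ≠ 3)
    (x : ℕ → TotalCochain K g h) : projF K g h (nestedBracket nrBracket (inclF K g h) n x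
      (bracketCochain (semidirectBracket π μ ρ))) = 0 := by
  have h_leibniz (A B : TotalCochain K (g × h) (g × h)) :=
    nrBracket_nrBracket_ofHom A B (weightHom K g h)
  rw [bracketCochain_semidirect_eq_add, map_add, map_add,
    proj_nestedBracket_eq_zero_of_weight h_leibniz nrBracket_inclF_weightHom
      projF_nrBracket_weightHom (nrBracket_action_weightHom π ρ) (by exact_mod_cast h1.symm),
    proj_nestedBracket_eq_zero_of_weight h_leibniz nrBracket_inclF_weightHom
      projF_nrBracket_weightHom (nrBracket_bracket_weightHom μ) (by exact_mod_cast h3.symm),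
    add_zero]

theorem nestedBracket_semidirect_eq_zero [CharZero K] {n : ℕ} (hn : n ≥ 4)
    (x : ℕ → TotalCochain K g h) : nestedBracket nrBracket (inclF K g h) n x
      (bracketCochain (semidirectBracket π μ ρ)) = 0 := by
  have h_leibniz (A B : TotalCochain K (g × h) (g × h)) :=
    nrBracket_nrBracket_ofHom A B (weightHom K g h)
  have h_action := nestedBracket_weight h_leibniz nrBracket_inclF_weightHom
    (nrBracket_action_weightHom π ρ) n x
  have h_bracket := nestedBracket_weight h_leibniz nrBracket_inclF_weightHom
    (nrBracket_bracket_weightHom (g := g) μ) n x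
  rw [bracketCochain_semidirect_eq_add, map_add,
    eq_zero_of_weight (w := 0 - n) (by omega) (h_action.trans (by push_cast; rfl)),
    eq_zero_of_weight (w := 2 - n) (by omega) (h_bracket.trans (by push_cast; rfl)), add_zero]

end Semidirect

section DerivedBracket
variable {K g h : Type*} [Field K] [AddCommGroup g] [Module K g] [AddCommGroup h] [Module K h]

theorem iteratedBracket_apply (Δ : TotalCochain K (g × h) (g × h)) (k : ℕ)
    (x : ℕ → TotalCochain K g h) :
    iteratedBracket Δ k (fun j => x j) = nestedBracket nrBracket (inclF K g h) k x Δ := by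
  induction k with
  | zero => rfl
  | succ k ih => rw [nestedBracket_succ', ← ih]; rfl

variable (π : g [⋀^Fin 3]→ₗ[K] g) (μ : h [⋀^Fin 3]→ₗ[K] h) (ρ : g [⋀^Fin 2]→ₗ[K] Module.End K h)

theorem derivedBracket_apply (k : ℕ) (x : ℕ → TotalCochain K g h) :
    derivedBracket π μ ρ k (fun j => x j) = projF K g h
      (nestedBracket nrBracket (inclF K g h) k x (bracketCochain (semidirectBracket π μ ρ))) :=
  congrArg (projF K g h) (iteratedBracket_apply _ k x)

theorem derivedBracket_eq_zero [CharZero K] {k : ℕ} (h1 : k ≠ 1) (h3 : k ≠ 3) :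
    derivedBracket π μ ρ k = 0 := by
  refine MultilinearMap.ext fun y => ?_
  obtain ⟨x, rfl⟩ : ∃ x : ℕ → TotalCochain K g h, y = fun j : Fin k => x j :=
    ⟨Function.extend Fin.val y 0, funext fun j => (Fin.val_injective.extend_apply y 0 j).symm⟩
  rw [derivedBracket_apply, projF_nestedBracket_semidirect_eq_zero π μ ρ h1 h3, zero_apply]

theorem projF_bracketCochain_semidirect [CharZero K] :
    projF K g h (bracketCochain (semidirectBracket π μ ρ)) = 0 :=
  projF_nestedBracket_semidirect_eq_zero π μ ρ (n := 0) (by norm_num) (by norm_num) fun _ => 0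

variable {π μ ρ}

theorem isLInfinityAlgebra_derivedBracket [CharZero K] (hπ : IsThreeLieBracket π)
    (hμ : IsThreeLieBracket μ) (hρ : IsAction π μ ρ) :
    IsLInfinityAlgebra (cochainGrading K g h) (derivedBracket π μ ρ) := by
  have h_mem := bracketCochain_mem_cochainGrading (semidirectBracket π μ ρ)
  have h_sq := nrBracket_bracketCochain_self (isThreeLieBracket_semidirect hπ hμ hρ)
  have h_proj := projF_bracketCochain_semidirect π μ ρ
  exact (isVoronovData (K := K) (g := g) (h := h)).isLInfinityAlgebra
    (Δ := bracketCochain (semidirectBracket π μ ρ)) (l := derivedBracket π μ ρ)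
    isInternal_cochainGrading h_mem h_sq h_proj (derivedBracket_apply π μ ρ)

theorem derivedBracket_crossedHom [CharZero K] {H : g →ₗ[K] h} (hH : IsCrossedHom π μ ρ H) :
    derivedBracket π μ ρ 1 (fun _ => ofHom H) +
      (6 : K)⁻¹ • derivedBracket π μ ρ 3 (fun _ => ofHom H) = 0 := by
  rw [derivedBracket_apply π μ ρ 1 fun _ => ofHom H, derivedBracket_apply π μ ρ 3 fun _ => ofHom H]
  simp only [nestedBracket_succ', nestedBracket_zero, inclF_ofHom]
  set f : g × h →ₗ[K] g × h := LinearMap.inr K g h ∘ₗ H ∘ₗ LinearMap.fst K g h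
  have hf (x : g × h) : f x = (0, H x.1) := rfl
  have h_mem₁ := nrBracket_ofHom_mem_cochainGrading
    (bracketCochain_mem_cochainGrading (semidirectBracket π μ ρ)) f
  have h_mem₃ := nrBracket_ofHom_mem_cochainGrading
    (nrBracket_ofHom_mem_cochainGrading h_mem₁ f) f
  refine ext_degOne (add_mem (projF_mem_cochainGrading h_mem₁)
    (Submodule.smul_mem _ _ (projF_mem_cochainGrading h_mem₃)))
    (Submodule.zero_mem _) fun x y z => ?_
  rw [degOne_add, degOne_smul, degOne_zero, projF_eq_map, degOne_map, degOne_map]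
  simp only [degOne_nrBracket_ofHom, hf, degOne_semidirect, LinearMap.inl_apply, map_zero,
    alt_zero_left, alt_zero_right, alt_three_zero_left, alt_three_zero_middle,
    alt_three_zero_right, LinearMap.snd_apply, Prod.snd_add, Prod.snd_sub, Prod.fst_add,
    Prod.fst_sub, LinearMap.zero_apply, add_zero, zero_add, sub_zero, hH x y z]
  module

theorem isMaurerCartan_crossedHom [CharZero K] {H : g →ₗ[K] h} (hH : IsCrossedHom π μ ρ H) :
    IsMaurerCartan (cochainGrading K g h) (derivedBracket π μ ρ) (ofHom H) :=
  isMaurerCartan_of_eq (derivedBracket_eq_zero π μ ρ (by norm_num) (by norm_num))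
    (fun _ hk => derivedBracket_eq_zero π μ ρ (by omega) (by omega))
    (ofHom_mem_cochainGrading H) (derivedBracket_crossedHom hH)

theorem isLInfinityAlgebra_twist_crossedHom [CharZero K] (hπ : IsThreeLieBracket π)
    (hμ : IsThreeLieBracket μ) (hρ : IsAction π μ ρ) {H : g →ₗ[K] h}
    (hH : IsCrossedHom π μ ρ H) :
    IsLInfinityAlgebra (cochainGrading K g h) (twist (derivedBracket π μ ρ) (ofHom H)) := by
  have h_mem := bracketCochain_mem_cochainGrading (semidirectBracket π μ ρ)
  have h_sq := nrBracket_bracketCochain_self (isThreeLieBracket_semidirect hπ hμ hρ)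
  have h_proj := projF_bracketCochain_semidirect π μ ρ
  exact (isVoronovData (K := K) (g := g) (h := h)).isLInfinityAlgebra_twist
    (Δ := bracketCochain (semidirectBracket π μ ρ)) (l := derivedBracket π μ ρ) (N := 4)
    iSup_cochainGrading isInternal_cochainGrading h_mem h_sq h_proj (derivedBracket_apply π μ ρ)
    (fun _ hn => nestedBracket_semidirect_eq_zero π μ ρ hn _) (isMaurerCartan_crossedHom hH)

end DerivedBracket

end ThreeLie

theorem mainTheorem9 {K g h : Type*} [Field K] [CharZero K] [AddCommGroup g] [Module K g]
    [AddCommGroup h] [Module K h]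
    (π : g [⋀^Fin 3]→ₗ[K] g) (hπ : ThreeLie.IsThreeLieBracket π)
    (μ : h [⋀^Fin 3]→ₗ[K] h) (hμ : ThreeLie.IsThreeLieBracket μ)
    (ρ : g [⋀^Fin 2]→ₗ[K] Module.End K h) (hρ : ThreeLie.IsAction π μ ρ)
    (H : g →ₗ[K] h) (hH : ThreeLie.IsCrossedHom π μ ρ H) :
    -- the `L_∞`-algebra `(C*(g, h), l₁, l₃)`, of which `H` is a Maurer-Cartan element
    ThreeLie.IsLInfinityAlgebra (ThreeLie.cochainGrading K g h) (ThreeLie.derivedBracket π μ ρ) ∧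
    ThreeLie.derivedBracket π μ ρ 2 = 0 ∧
    (∀ k, 4 ≤ k → ThreeLie.derivedBracket π μ ρ k = 0) ∧
    ThreeLie.IsMaurerCartan (ThreeLie.cochainGrading K g h) (ThreeLie.derivedBracket π μ ρ)
      (ThreeLie.ofHom H) ∧
    -- the `L_∞`-algebra obtained by twisting with `H`
    ThreeLie.IsLInfinityAlgebra (ThreeLie.cochainGrading K g h)
      (ThreeLie.twist (ThreeLie.derivedBracket π μ ρ) (ThreeLie.ofHom H)) ∧
    (∀ P, ThreeLie.twist (ThreeLie.derivedBracket π μ ρ) (ThreeLie.ofHom H) 1 ![P] =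
      ThreeLie.derivedBracket π μ ρ 1 ![P] +
        (1 / 2 : K) • ThreeLie.derivedBracket π μ ρ 3 ![ThreeLie.ofHom H, ThreeLie.ofHom H, P]) ∧
    (∀ P Q, ThreeLie.twist (ThreeLie.derivedBracket π μ ρ) (ThreeLie.ofHom H) 2 ![P, Q] =
      ThreeLie.derivedBracket π μ ρ 3 ![ThreeLie.ofHom H, P, Q]) ∧
    (∀ P Q R, ThreeLie.twist (ThreeLie.derivedBracket π μ ρ) (ThreeLie.ofHom H) 3 ![P, Q, R] =
      ThreeLie.derivedBracket π μ ρ 3 ![P, Q, R]) ∧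
    (∀ k, 4 ≤ k → ThreeLie.twist (ThreeLie.derivedBracket π μ ρ) (ThreeLie.ofHom H) k = 0) := by
  have h2 : ThreeLie.derivedBracket π μ ρ 2 = 0 :=
    ThreeLie.derivedBracket_eq_zero π μ ρ (by norm_num) (by norm_num)
  have h4 (k : ℕ) (hk : 4 ≤ k) : ThreeLie.derivedBracket π μ ρ k = 0 :=
    ThreeLie.derivedBracket_eq_zero π μ ρ (by omega) (by omega)
  exact ⟨ThreeLie.isLInfinityAlgebra_derivedBracket hπ hμ hρ, h2, h4,
    ThreeLie.isMaurerCartan_crossedHom hH,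
    ThreeLie.isLInfinityAlgebra_twist_crossedHom hπ hμ hρ hH,
    ThreeLie.twist_one h2 h4, ThreeLie.twist_two h2 h4, ThreeLie.twist_three h4,
    fun k hk => ThreeLie.twist_eq_zero h4 hk⟩
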